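/- **Setting.** A *Lorentzian pre-length space* $(X,d,\ll,\le,\tau)$ is a metric space $(X,d)$ ($d$ may take the value $\infty$) with a reflexive and transitive relation $\le$, a transitive relation $\ll$ contained in $\le$, and a map $\tau:X\times X\to[0,\infty]$, lower semicontinuous with respect to $d$, such that $\tau(a,b)>0\iff a\ll b$, and $\tau(a,b)+\tau(b,c)\le\tau(a,c)$ whenever $a\le b\le c$. A causal curve is a locally Lipschitz map $\gamma:[a,b]\to X$ with $\gamma(s)\le\gamma(t)$ for $s<t$; its $\tau$-length is $\inf\sum_i\tau(\gamma(t_i),\gamma(t_{i+1}))$ over all partitions of $[a,b]$; it is *$\tau$-realizing* if its $\tau$-length equals $\tau(\gamma(a),\gamma(b))$. A *geodesic segment* $[x,y]$ is the image of a $\tau$-realizing curve from $x$ to $y$. A *timelike triangle* $\Delta(x,y,z)$ in $U\subseteq X$ consists of points $x\ll y\ll z$ and geodesic segments $[x,y],[y,z],[x,z]$ contained in $U$. For $K\in\mathbb R$ let $M_K$ be the two-dimensional simply connected Lorentzian model space of constant curvature $K$ (the Minkowski plane for $K=0$, the universal cover of scaled de Sitter space for $K>0$, resp. of scaled anti-de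 Sitter space for $K<0$), with time separation $\bar\tau$. The triangle $\Delta(x,y,z)$ satisfies the *size bound* for $K$ if $K\ge 0$, or $K<0$ and $\tau(x,z)<\pi/\sqrt{-K}$. In that case it has a *comparison triangle* $\Delta(\bar x,\bar y,\bar z)$ in $M_K$, i.e. a timelike geodesic triangle with $\bar\tau(\bar x,\bar y)=\tau(x,y)$, $\bar\tau(\bar y,\bar z)=\tau(y,z)$, $\bar\tau(\bar x,\bar z)=\tau(x,z)$, unique up to isometry. The point corresponding to a point $a$ on a side $[u,v]$ is the point $\bar a\in[\bar u,\bar v]$ with $\bar\tau(\bar u,\bar a)=\tau(u,a)$. The triangle *satisfies the timelike curvature bound from above by $K$* if $\tau(a,b)\ge\bar\tau(\bar a,\bar b)$ for all points $a,b$ on its sides and all corresponding points $\bar a,\bar b$. **Corollary (Remaining constellations of the gluing lemma).** Let $X$ be a Lorentzian pre-length space, and let $U\subseteq X$ be such that $\tau|_{U\times U}$ is finite and continuous and any $u,v\in U$ with $u\ll v$ are joined by a $\tau$-realizing curve contained in $U$. Let $K\in\mathbb R$ and let $\Delta(x,y,z)$ be a timelike triangle in $U$ satisfying the size bound for $K$.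 1. Let $p$ be a point on $[x,y]$ with $x\ll p\ll y$. Let $[x,p]$ and $[p,y]$ be the two parts into which $p$ divides $[x,y]$, and let $[p,z]$ be a geodesic segment in $U$. If the timelike triangles $\Delta(x,p,z)$ and $\Delta(p,y,z)$, with the sides $[x,p],[p,z],[x,z]$ and $[p,y],[y,z],[p,z]$ respectively, satisfy the timelike curvature bound from above by $K$, then so does $\Delta(x,y,z)$. 2. Let $p$ be a point on $[y,z]$ with $y\ll p\ll z$. Let $[y,p]$ and $[p,z]$ be the two parts into which $p$ divides $[y,z]$, and let $[x,p]$ be a geodesic segment in $U$. If the timelike triangles $\Delta(x,y,p)$ and $\Delta(x,p,z)$, with the sides $[x,y],[y,p],[x,p]$ and $[x,p],[p,z],[x,z]$ respectively, satisfy the timelike curvature bound from above by $K$, then so does $\Delta(x,y,z)$. -/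

import Mathlib

open Set
open scoped ENNReal

/-- A Lorentzian pre-length space `(X, d, ≪, ≤, τ)`: `causal` is the relation `≤`, `chron` is the
relation `≪`, and `tau` is the time separation `τ : X × X → [0, ∞]`. The distance `d` may take the
value `∞`. -/
class LorentzianPreLengthSpace (X : Type*) [EMetricSpace X] where
  causal : X → X → Prop
  chron : X → X → Prop
  tau : X → X → ℝ≥0∞
  causal_refl : ∀ x, causal x x
  causal_trans : ∀ x y z, causal x y → causal y z → causal x z
  chron_trans : ∀ x y z, chron x y → chron y z → chron x z
  causal_of_chron : ∀ x y, chron x y → causal x y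
  tau_lsc : LowerSemicontinuous fun q : X × X => tau q.1 q.2
  tau_reverse_triangle : ∀ x y z, causal x y → causal y z → tau x y + tau y z ≤ tau x z
  tau_pos_iff : ∀ x y, 0 < tau x y ↔ chron x y

namespace LorentzianPreLengthSpace

section Curves

variable {X : Type*} [EMetricSpace X] [LorentzianPreLengthSpace X]

/-- `γ : [a, b] → X` is a future-directed causal curve. -/
def IsCausalCurve (γ : ℝ → X) (a b : ℝ) : Prop :=
  LocallyLipschitzOn (Icc a b) γ ∧
    ∀ s ∈ Icc a b, ∀ t ∈ Icc a b, s < t → causal (γ s) (γ t)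

/-- The `τ`-length of `γ : [a, b] → X`: the infimum of `∑ τ(γ(tᵢ), γ(tᵢ₊₁))` over all partitions
`a = t₀ < t₁ < ⋯ < tₙ₊₁ = b`. -/
noncomputable def tauLength (γ : ℝ → X) (a b : ℝ) : ℝ≥0∞ :=
  ⨅ (n : ℕ) (t : Fin (n + 2) → ℝ) (_ : StrictMono t ∧ t 0 = a ∧ t (Fin.last (n + 1)) = b),
    ∑ i : Fin (n + 1), tau (γ (t i.castSucc)) (γ (t i.succ))

/-- `γ : [a, b] → X` is a `τ`-realizing causal curve from `x` to `y`. -/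
def IsRealizer (γ : ℝ → X) (a b : ℝ) (x y : X) : Prop :=
  a < b ∧ IsCausalCurve γ a b ∧ γ a = x ∧ γ b = y ∧ tauLength γ a b = tau x y

/-- `S` is a geodesic segment from `x` to `y` contained in `U`: the image of a `τ`-realizing
causal curve. -/
def IsSegment (U : Set X) (x y : X) (S : Set X) : Prop :=
  S ⊆ U ∧ ∃ (γ : ℝ → X) (a b : ℝ), IsRealizer γ a b x y ∧ γ '' Icc a b = S

/-- The geodesic segment `S` from `x` to `y` passes through `p`, and `p` divides it into the part
`S₁` from `x` to `p` and the part `S₂` from `p` to `y`. -/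
def IsSubdivision (x p y : X) (S S₁ S₂ : Set X) : Prop :=
  ∃ (γ : ℝ → X) (a t b : ℝ), IsRealizer γ a b x y ∧ a ≤ t ∧ t ≤ b ∧ γ t = p ∧
    γ '' Icc a b = S ∧ γ '' Icc a t = S₁ ∧ γ '' Icc t b = S₂

/-- `τ` is finite and continuous on `U × U`. -/
def TauFiniteContinuousOn (U : Set X) : Prop :=
  (∀ x ∈ U, ∀ y ∈ U, tau x y ≠ ∞) ∧ ContinuousOn (fun q : X × X => tau q.1 q.2) (U ×ˢ U)

/-- Any two points `x ≪ y` of `U` are joined by a `τ`-realizing causal curve contained in `U`. -/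
def HasRealizers (U : Set X) : Prop :=
  ∀ x ∈ U, ∀ y ∈ U, chron x y → ∃ S, IsSegment U x y S

/-- `Δ(x, y, z)`, with sides `[x, y] = sxy`, `[y, z] = syz`, `[x, z] = sxz`, is a timelike triangle
in `U`. -/
def IsTimelikeTriangle (U : Set X) (x y z : X) (sxy syz sxz : Set X) : Prop :=
  chron x y ∧ chron y z ∧
    IsSegment U x y sxy ∧ IsSegment U y z syz ∧ IsSegment U x z sxz

end Curves

/-! The two-dimensional simply connected Lorentzian model space `M_K` of constant curvature `K`, in
global coordinates `(t, s) ∈ ℝ × ℝ`, time-oriented by `∂/∂t`. The metric is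
* `K > 0` (universal cover of scaled de Sitter space): `(1 / K) (-dt² + cosh² t ds²)`;
* `K = 0` (Minkowski plane): `-dt² + ds²`;
* `K < 0` (universal cover of scaled anti-de Sitter space): `(1 / |K|) (-cosh² s dt² + ds²)`. -/

section Model

/-- The function `K ⟨p, q⟩`, where `⟨·, ·⟩` is the ambient inner product of the hyperquadric
`-X₀² + X₁² + X₂² = 1 / K`, parametrized by
`(t, s) ↦ (1 / √K) (sinh t, cosh t cos s, cosh t sin s)`. -/
noncomputable def dSProd (p q : ℝ × ℝ) : ℝ :=
  Real.cosh p.1 * Real.cosh q.1 * Real.cos (q.2 - p.2) - Real.sinh p.1 * Real.sinh q.1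

/-- The function `K ⟨p, q⟩`, where `⟨·, ·⟩` is the ambient inner product of the hyperquadric
`-X₀² - X₁² + X₂² = 1 / K` (with `K < 0`), parametrized by
`(t, s) ↦ (1 / √|K|) (cosh s cos t, cosh s sin t, sinh s)`. -/
noncomputable def adSProd (p q : ℝ × ℝ) : ℝ :=
  Real.cosh p.2 * Real.cosh q.2 * Real.cos (q.1 - p.1) - Real.sinh p.2 * Real.sinh q.2

/-- The causal relation of `M_K`. -/
def modelCausal (K : ℝ) (p q : ℝ × ℝ) : Prop :=
  (0 < K ∧ p.1 ≤ q.1 ∧ |q.2 - p.2| ≤ Real.pi ∧ 1 ≤ dSProd p q) ∨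
  (K = 0 ∧ |q.2 - p.2| ≤ q.1 - p.1) ∨
  (K < 0 ∧ p.1 ≤ q.1 ∧ (q.1 - p.1 ≤ Real.pi → adSProd p q ≤ 1))

open Classical in
/-- The time separation of `M_K`, i.e. the supremum of the lengths of the future-directed causal
curves from `p` to `q` (and `0` if there are none). For `K < 0` it is infinite exactly between points
joined by causal curves of arbitrarily great length. -/
noncomputable def modelTau (K : ℝ) (p q : ℝ × ℝ) : ℝ≥0∞ :=
  if modelCausal K p q then
    if 0 < K then ENNReal.ofReal (Real.arcosh (dSProd p q) / √K)
    else if K = 0 then ENNReal.ofReal (√((q.1 - p.1) ^ 2 - (q.2 - p.2) ^ 2))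
    else if q.1 - p.1 ≤ Real.pi ∧ -1 ≤ adSProd p q then
      ENNReal.ofReal (Real.arccos (adSProd p q) / √(-K))
    else ∞
  else 0

/-- The geodesic segment from `p` to `q` in `M_K`, for `p ≪ q` with time separation less than
`π / √(-K)` in case `K < 0`: the points lying causally between `p` and `q` on which the reverse
triangle inequality is an equality. -/
def modelSegment (K : ℝ) (p q : ℝ × ℝ) : Set (ℝ × ℝ) :=
  {r | modelCausal K p r ∧ modelCausal K r q ∧
    modelTau K p r + modelTau K r q = modelTau K p q}

/-- The size bound for `M_K` on a timelike triangle whose longest side has length `ℓ`. -/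
def SizeBound (K : ℝ) (ℓ : ℝ≥0∞) : Prop :=
  K < 0 → ℓ < ENNReal.ofReal (Real.pi / √(-K))

end Model

section Comparison

variable {X : Type*} [EMetricSpace X] [LorentzianPreLengthSpace X]

/-- `Δ(x', y', z')` in `M_K` is a comparison triangle for the timelike triangle `Δ(x, y, z)`. -/
def IsComparisonTriangle (K : ℝ) (x y z : X) (x' y' z' : ℝ × ℝ) : Prop :=
  modelTau K x' y' = tau x y ∧ modelTau K y' z' = tau y z ∧ modelTau K x' z' = tau x z

/-- `a'` on the segment `[u', v']` of `M_K` corresponds to the point `a` on the side `S = [u, v]`. -/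
def CorrespondsOnSide (K : ℝ) (u : X) (S : Set X) (u' v' : ℝ × ℝ) (a : X) (a' : ℝ × ℝ) : Prop :=
  a ∈ S ∧ a' ∈ modelSegment K u' v' ∧ modelTau K u' a' = tau u a

/-- `a` is a point on the triangle `Δ(x, y, z)` with sides `sxy`, `syz`, `sxz`, and `a'` is a
corresponding point on the comparison triangle `Δ(x', y', z')`. -/
def IsComparisonPoint (K : ℝ) (x y : X) (sxy syz sxz : Set X) (x' y' z' : ℝ × ℝ)
    (a : X) (a' : ℝ × ℝ) : Prop :=
  CorrespondsOnSide K x sxy x' y' a a' ∨ CorrespondsOnSide K y syz y' z' a a' ∨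
    CorrespondsOnSide K x sxz x' z' a a'

/-- The timelike triangle `Δ(x, y, z)` with sides `sxy`, `syz`, `sxz` satisfies the timelike
curvature bound from above by `K`: `τ(a, b) ≥ τ'(a', b')` for all points `a, b` on the triangle and
corresponding points `a', b'` on its comparison triangle. (Under the size bound a comparison
triangle exists and is unique up to isometry.) -/
def BoundAbove (K : ℝ) (x y z : X) (sxy syz sxz : Set X) : Prop :=
  ∀ x' y' z' : ℝ × ℝ, IsComparisonTriangle K x y z x' y' z' →
    ∀ (a b : X) (a' b' : ℝ × ℝ),
      IsComparisonPoint K x y sxy syz sxz x' y' z' a a' →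
      IsComparisonPoint K x y sxy syz sxz x' y' z' b b' →
      modelTau K a' b' ≤ tau a b

end Comparison

end LorentzianPreLengthSpace

/-! Glue comparison triangles of Δ(x, p, z) and Δ(p, y, z) in M_K along the common side [p, z], the
"axis", with x and y on opposite sides of it. Straightening the broken line through x, p, y turns
this figure into a comparison triangle of Δ(x, y, z). Two facts carry the proof.

Angle at p. If the straight line from x to y in the glued figure crossed the axis at some q beyond
p, the curvature bounds and the reverse triangle inequality through q would make τ(x, y) at least
the glued distance. That distance is larger than τ(x, p) + τ(p, y), which equals τ(x, y) because p
lies on [x, y]. Hence the line does not cross there (`Glue.slope_le`), and straightening does not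
increase the distance from p to z (`Glue.straightened_le`).

Pairs of points. Let b lie on the first triangle and a on the second. If the glued line from b to a
crosses the axis at q, the path through q shows that the time separation is at least the glued
distance, which dominates the straightened one. If it passes before p, the path through p suffices
(`Glue.le_mdSum`). Both cases are joined in `Glue.le_or_le`. Pairs inside one small triangle need
only its curvature bound and the monotonicity under straightening.

The computations are uniform in K because lengths are replaced by modified distances F = `md K` τ,
extended to all pairs of model points by the signed function `world`. Along a timelike geodesic F''
= 1 + K F. So F is determined by its value f and slope g at p (`ray`), and its value at a dividing
point is affine in the values at the ends, with weights depending on lengths only (Stewart's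
theorem, `IsOnSegment.world_eq`). The glued figure itself is never built: a point is recorded by f,
g and a height H ≥ 0 over the axis, H² = g² - f (2 + K f), and two points on opposite sides have
glued signed distance f₁ + f₂ + K f₁ f₂ - g₁ g₂ - H₁ H₂. The crossing point is found by the
intermediate value theorem (`exists_crossing`).

Since `world` is symmetric, the estimates bound it by τ(b, a) or by τ(a, b);
`IsTriangle.not_reverse` excludes the wrong order. The second assertion is the first one for the
reversed time orientation. -/

namespace LorentzianPreLengthSpace

/-! ### Generalized trigonometric functions, uniform in the curvature. -/

section Trigonometry

/-- The generalized sine of curvature `K`: `sn'' = K sn`, `sn 0 = 0`, `sn' 0 = 1`. -/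
noncomputable def sn (K t : ℝ) : ℝ :=
  if 0 < K then Real.sinh (√K * t) / √K
  else if K = 0 then t else Real.sin (√(-K) * t) / √(-K)

/-- The modified distance of curvature `K`: `md'' = 1 + K md`, `md 0 = md' 0 = 0`. -/
noncomputable def md (K t : ℝ) : ℝ :=
  if 0 < K then (Real.cosh (√K * t) - 1) / K
  else if K = 0 then t ^ 2 / 2 else (Real.cos (√(-K) * t) - 1) / K

/-- `t` is less than the timelike diameter of the model space of curvature `K`. -/
def InRange (K t : ℝ) : Prop := K < 0 → √(-K) * t < Real.pi

variable {K : ℝ}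

theorem InRange.mono {s t : ℝ} (h : InRange K t) (hst : s ≤ t) : InRange K s := fun hK =>
  (mul_le_mul_of_nonneg_left hst (Real.sqrt_nonneg _)).trans_lt (h hK)

@[simp] theorem sn_zero : sn K 0 = 0 := by simp [sn]

@[simp] theorem md_zero : md K 0 = 0 := by simp [md]

@[simp] theorem sn_neg (t : ℝ) : sn K (-t) = -sn K t := by
  unfold sn
  split_ifs <;> simp [neg_div]

@[simp] theorem md_neg (t : ℝ) : md K (-t) = md K t := by
  unfold md
  split_ifs <;> simp

/-- The factor 1 + K `md` is the derivative of `sn`; in these terms the addition theorems have one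
form for all signs of K. -/
theorem sn_add (s t : ℝ) :
    sn K (s + t) = sn K s * (1 + K * md K t) + (1 + K * md K s) * sn K t := by
  unfold sn md
  split_ifs with h h0
  · have h1 := Real.sqrt_pos.2 h
    rw [mul_add, Real.sinh_add]
    field_simp
    ring
  · subst h0; ring
  · have h1 : 0 < √(-K) := Real.sqrt_pos.2 (by
      rcases lt_trichotomy K 0 with h2 | h2 | h2 <;> first | linarith | contradiction)
    rw [mul_add, Real.sin_add]
    field_simp
    ring

theorem md_add (s t : ℝ) :
    md K (s + t) = md K s + md K t + K * md K s * md K t + sn K s * sn K t := by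
  unfold sn md
  split_ifs with h h0
  · have h1 := Real.sqrt_pos.2 h
    have h2 := Real.sq_sqrt h.le
    rw [mul_add, Real.cosh_add]
    have : Real.sinh (√K * s) / √K * (Real.sinh (√K * t) / √K)
        = Real.sinh (√K * s) * Real.sinh (√K * t) / K := by
      rw [div_mul_div_comm, ← sq, h2]
    rw [this]
    field_simp
    ring
  · subst h0; ring
  · have hK : K < 0 := lt_of_le_of_ne (not_lt.1 h) h0
    have h1 : 0 < √(-K) := Real.sqrt_pos.2 (by linarith)
    have h2 := Real.sq_sqrt (show 0 ≤ -K by linarith)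
    rw [mul_add, Real.cos_add]
    have : Real.sin (√(-K) * s) / √(-K) * (Real.sin (√(-K) * t) / √(-K))
        = Real.sin (√(-K) * s) * Real.sin (√(-K) * t) / (-K) := by
      rw [div_mul_div_comm, ← sq, h2]
    rw [this]
    field_simp
    ring

theorem sn_sub (s t : ℝ) :
    sn K (s - t) = sn K s * (1 + K * md K t) - (1 + K * md K s) * sn K t := by
  rw [sub_eq_add_neg, sn_add, md_neg, sn_neg]; ring

theorem md_sub (s t : ℝ) :
    md K (s - t) = md K s + md K t + K * md K s * md K t - sn K s * sn K t := by
  rw [sub_eq_add_neg, md_add, md_neg, sn_neg]; ring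

theorem sn_sq (t : ℝ) : sn K t ^ 2 = 2 * md K t + K * md K t ^ 2 := by
  have h := md_sub (K := K) t t
  rw [sub_self, md_zero] at h
  linear_combination h

theorem sn_pos {t : ℝ} (ht : 0 < t) (h : InRange K t) : 0 < sn K t := by
  unfold sn
  split_ifs with hK h0
  · exact div_pos (Real.sinh_pos_iff.2 (mul_pos (Real.sqrt_pos.2 hK) ht)) (Real.sqrt_pos.2 hK)
  · exact ht
  · have hK' : K < 0 := lt_of_le_of_ne (not_lt.1 hK) h0
    have h1 : 0 < √(-K) := Real.sqrt_pos.2 (by linarith)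
    exact div_pos (Real.sin_pos_of_pos_of_lt_pi (mul_pos h1 ht) (h hK')) h1

theorem sn_nonneg {t : ℝ} (ht : 0 ≤ t) (h : InRange K t) : 0 ≤ sn K t := by
  rcases ht.eq_or_lt with rfl | ht
  · simp
  · exact (sn_pos ht h).le

/-- The difference of the two values is 2 sn((t + s)/2) sn((t - s)/2), and both factors are
positive. -/
theorem md_lt {s t : ℝ} (hs : 0 ≤ s) (hst : s < t) (ht : K < 0 → √(-K) * t ≤ Real.pi) :
    md K s < md K t := by
  have hr : InRange K ((t + s) / 2) := fun hK => by
    have h1 : 0 < √(-K) := Real.sqrt_pos.2 (by linarith)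
    have := ht hK
    nlinarith
  have h1 := sn_pos (by linarith) hr
  have h2 := sn_pos (K := K) (t := (t - s) / 2) (by linarith) (hr.mono (by linarith))
  have e1 := md_add (K := K) ((t + s) / 2) ((t - s) / 2)
  have e2 := md_sub (K := K) ((t + s) / 2) ((t - s) / 2)
  rw [show (t + s) / 2 + (t - s) / 2 = t by ring] at e1
  rw [show (t + s) / 2 - (t - s) / 2 = s by ring] at e2
  nlinarith

theorem md_le {s t : ℝ} (hs : 0 ≤ s) (hst : s ≤ t) (ht : K < 0 → √(-K) * t ≤ Real.pi) :
    md K s ≤ md K t := by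
  rcases hst.eq_or_lt with rfl | h
  · rfl
  · exact (md_lt hs h ht).le

theorem le_of_md_le {s t : ℝ} (ht : 0 ≤ t) (hs : K < 0 → √(-K) * s ≤ Real.pi)
    (h : md K s ≤ md K t) : s ≤ t := by
  by_contra hlt
  exact absurd (md_lt ht (not_le.1 hlt) hs) (not_lt.2 h)

theorem md_nonneg {t : ℝ} (ht : 0 ≤ t) (h : InRange K t) : 0 ≤ md K t := by
  simpa using md_le (K := K) le_rfl ht fun hK => (h hK).le

theorem md_pos {t : ℝ} (ht : 0 < t) (h : InRange K t) : 0 < md K t := by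
  simpa using md_lt (K := K) le_rfl ht fun hK => (h hK).le

/-- For K ≠ 0 the quantity is 1 + cosh or 1 + cos, which vanishes only at the timelike diameter. Its
positivity gives F (2 + K F) the sign of F. -/
theorem two_add_mul_md_pos {t : ℝ} (h : InRange K |t|) :
    0 < 2 + K * md K t := by
  unfold md
  split_ifs with hK h0
  · have := Real.one_le_cosh (√K * t)
    field_simp
    linarith
  · subst h0; norm_num
  · have hK' : K < 0 := lt_of_le_of_ne (not_lt.1 hK) h0
    have h1 : 0 < √(-K) := Real.sqrt_pos.2 (by linarith)
    have h2 : Real.cos Real.pi < Real.cos (√(-K) * |t|) :=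
      Real.cos_lt_cos_of_nonneg_of_le_pi (by positivity) le_rfl (h hK')
    rw [Real.cos_pi, ← abs_of_pos h1, ← abs_mul, Real.cos_abs] at h2
    rw [mul_div_cancel₀ _ h0]
    linarith

theorem continuous_sn : Continuous (sn K) := by
  unfold sn
  split_ifs <;> fun_prop

theorem continuous_md : Continuous (md K) := by
  unfold md
  split_ifs <;> fun_prop

end Trigonometry

/-! ### Law of cosines, causality and Stewart's theorem in the model space. -/

section ModelGeometry

/-- The signed modified distance of `M_K`: it equals `md K (τ(p, q))` for causally related points. -/
noncomputable def world (K : ℝ) (p q : ℝ × ℝ) : ℝ :=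
  if 0 < K then (dSProd p q - 1) / K
  else if K = 0 then ((q.1 - p.1) ^ 2 - (q.2 - p.2) ^ 2) / 2 else (adSProd p q - 1) / K

/-- The time component at `b` of the chord from `a` to `b`. -/
noncomputable def tm (K : ℝ) (b a : ℝ × ℝ) : ℝ :=
  if 0 < K then (Real.sinh b.1 * Real.cosh a.1 * Real.cos (b.2 - a.2)
    - Real.sinh a.1 * Real.cosh b.1) / √K
  else if K = 0 then b.1 - a.1 else Real.cosh a.2 * Real.sin (b.1 - a.1) / √(-K)

/-- The space component at `b` of the chord from `a` to `b`. -/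
noncomputable def sp (K : ℝ) (b a : ℝ × ℝ) : ℝ :=
  if 0 < K then Real.cosh a.1 * Real.sin (b.2 - a.2) / √K
  else if K = 0 then b.2 - a.2
  else (Real.sinh b.2 * Real.cosh a.2 * Real.cos (b.1 - a.1)
    - Real.sinh a.2 * Real.cosh b.2) / √(-K)

/-- `p` lies in the causal past of `q` at finite time separation. -/
def Rel (K : ℝ) (p q : ℝ × ℝ) : Prop :=
  modelCausal K p q ∧ (K < 0 → q.1 - p.1 ≤ Real.pi ∧ -1 ≤ adSProd p q)

variable {K : ℝ}

theorem world_comm (p q : ℝ × ℝ) : world K p q = world K q p := by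
  unfold world dSProd adSProd
  split_ifs
  · rw [← neg_sub p.2 q.2, Real.cos_neg]; ring
  · ring
  · rw [← neg_sub p.1 q.1, Real.cos_neg]; ring

theorem world_self (p : ℝ × ℝ) : world K p p = 0 := by
  unfold world dSProd adSProd
  split_ifs
  · have := Real.cosh_sq p.1
    rw [sub_self, Real.cos_zero]
    rw [show Real.cosh p.1 * Real.cosh p.1 * 1 - Real.sinh p.1 * Real.sinh p.1 - 1 = 0 by
      linear_combination this]
    simp
  · ring
  · have := Real.cosh_sq p.2
    rw [sub_self, Real.cos_zero]
    rw [show Real.cosh p.2 * Real.cosh p.2 * 1 - Real.sinh p.2 * Real.sinh p.2 - 1 = 0 by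
      linear_combination this]
    simp

/-- Expansion of the ambient inner product in the orthonormal frame at b consisting of the normal
and the two coordinate directions. -/
theorem prod_tangent (a b c θ φ : ℝ) :
    Real.cosh a * Real.cosh c * Real.cos (θ + φ) - Real.sinh a * Real.sinh c =
      (Real.cosh a * Real.cosh b * Real.cos θ - Real.sinh a * Real.sinh b) *
        (Real.cosh b * Real.cosh c * Real.cos φ - Real.sinh b * Real.sinh c)
      - (Real.sinh b * Real.cosh a * Real.cos θ - Real.sinh a * Real.cosh b) *
        (Real.sinh b * Real.cosh c * Real.cos φ - Real.sinh c * Real.cosh b)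
      - Real.cosh a * Real.sin θ * (Real.cosh c * Real.sin φ) := by
  rw [Real.cos_add]
  linear_combination (Real.sinh a * Real.sinh c
    - Real.cosh a * Real.cosh c * Real.cos θ * Real.cos φ) * Real.cosh_sq b

/-- The law of cosines at `b`. -/
theorem world_tangent (a b c : ℝ × ℝ) :
    world K a c = world K a b + world K b c + K * world K a b * world K b c
      + sp K b a * sp K b c - tm K b a * tm K b c := by
  unfold world sp tm dSProd adSProd
  split_ifs with h h0
  · have h1 := Real.sqrt_pos.2 h
    have h2 := Real.sq_sqrt h.le
    have := prod_tangent a.1 b.1 c.1 (b.2 - a.2) (c.2 - b.2)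
    rw [show b.2 - a.2 + (c.2 - b.2) = c.2 - a.2 by ring] at this
    rw [this, show b.2 - c.2 = -(c.2 - b.2) by ring, Real.sin_neg, Real.cos_neg]
    rw [div_mul_div_comm, div_mul_div_comm, ← sq, h2]
    field_simp
    ring
  · subst h0; ring
  · have hK : K < 0 := lt_of_le_of_ne (not_lt.1 h) h0
    have h1 : 0 < √(-K) := Real.sqrt_pos.2 (by linarith)
    have h2 := Real.sq_sqrt (show 0 ≤ -K by linarith)
    have := prod_tangent a.2 b.2 c.2 (b.1 - a.1) (c.1 - b.1)
    rw [show b.1 - a.1 + (c.1 - b.1) = c.1 - a.1 by ring] at this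
    rw [this, show b.1 - c.1 = -(c.1 - b.1) by ring, Real.sin_neg, Real.cos_neg]
    rw [div_mul_div_comm, div_mul_div_comm, ← sq, h2]
    field_simp
    ring

theorem tm_sq_sub_sp_sq (a b : ℝ × ℝ) :
    tm K b a ^ 2 - sp K b a ^ 2 = 2 * world K a b + K * world K a b ^ 2 := by
  have := world_tangent (K := K) a b a
  rw [world_self, world_comm b a] at this
  linear_combination this

theorem modelCausal.fst_le {p q : ℝ × ℝ} (h : modelCausal K p q) : p.1 ≤ q.1 := by
  rcases h with h | h | h
  · exact h.2.1
  · linarith [abs_nonneg (q.2 - p.2), h.2]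
  · exact h.2.1

theorem Rel.world_nonneg {p q : ℝ × ℝ} (h : Rel K p q) : 0 ≤ world K p q := by
  unfold world
  split_ifs with hK h0
  · rcases h.1 with h | h | h
    · exact div_nonneg (by linarith [h.2.2.2]) hK.le
    · linarith [h.1]
    · linarith [h.1]
  · rcases h.1 with h | h | h
    · linarith [h.1]
    · have := h.2
      have := abs_le.1 this
      nlinarith
    · linarith [h.1]
  · have hK' : K < 0 := lt_of_le_of_ne (not_lt.1 hK) h0
    rcases h.1 with h1 | h1 | h1
    · linarith [h1.1]
    · linarith [h1.1]
    · exact div_nonneg_of_nonpos (by linarith [h1.2.2 (h.2 hK').1]) hK'.le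

theorem Rel.two_add_nonneg {p q : ℝ × ℝ} (h : Rel K p q) : 0 ≤ 2 + K * world K p q := by
  rcases le_or_gt 0 K with hK | hK
  · have := h.world_nonneg
    positivity
  · have := (h.2 hK).2
    unfold world
    rw [if_neg hK.not_gt, if_neg hK.ne, mul_div_cancel₀ _ hK.ne]
    linarith

theorem Rel.abs_sp_le_abs_tm {a b : ℝ × ℝ} (h : Rel K a b) : |sp K b a| ≤ |tm K b a| := by
  rw [← sq_le_sq]
  have h1 := tm_sq_sub_sp_sq (K := K) a b
  have h2 := h.world_nonneg
  have h3 := h.two_add_nonneg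
  nlinarith

/-- The expression is affine in P, so only an end of the interval for P matters: P = 1 if sinh b ≥
0, and P = cosh (b - a) otherwise, where it equals cosh b sinh (b - a). -/
theorem sinh_mul_sub_nonneg {a b P : ℝ} (hab : a ≤ b) (h1 : 1 ≤ P)
    (h2 : P ≤ Real.cosh a * Real.cosh b - Real.sinh a * Real.sinh b) :
    0 ≤ Real.sinh b * P - Real.sinh a := by
  have hs := Real.sinh_le_sinh.2 hab
  rcases le_or_gt 0 (Real.sinh b) with hb | hb
  · nlinarith
  · have h3 : 0 ≤ Real.sinh (b - a) := Real.sinh_nonneg_iff.2 (by linarith)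
    rw [Real.sinh_sub] at h3
    have h4 := Real.cosh_pos b
    have h5 := Real.cosh_sq b
    have h6 : Real.sinh b * (Real.cosh a * Real.cosh b - Real.sinh a * Real.sinh b) - Real.sinh a
        = Real.cosh b * (Real.sinh b * Real.cosh a - Real.cosh b * Real.sinh a) := by
      linear_combination (Real.sinh a) * h5
    nlinarith [mul_nonneg h4.le h3, mul_nonneg_of_nonpos_of_nonpos hb.le (sub_nonpos.2 h2)]

theorem Rel.tm_nonneg {a b : ℝ × ℝ} (h : Rel K a b) : 0 ≤ tm K b a := by
  unfold tm
  split_ifs with hK h0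
  · rcases h.1 with h | h | h
    · refine div_nonneg ?_ (Real.sqrt_nonneg _)
      have h1 := h.2.2.2
      have h2 : dSProd a b ≤ Real.cosh a.1 * Real.cosh b.1 - Real.sinh a.1 * Real.sinh b.1 := by
        unfold dSProd
        nlinarith [Real.cos_le_one (b.2 - a.2),
          mul_pos (Real.cosh_pos a.1) (Real.cosh_pos b.1)]
      have h3 := sinh_mul_sub_nonneg h.2.1 h1 h2
      unfold dSProd at h3
      have h4 := Real.cosh_pos b.1
      -- Multiplied by cosh b, the numerator of the time component becomes sinh b · `dSProd` - sinh
      -- a.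
      refine nonneg_of_mul_nonneg_left (b := Real.cosh b.1) ?_ h4
      refine h3.trans_eq ?_
      linear_combination (Real.sinh a.1) * Real.cosh_sq b.1
    · linarith [h.1]
    · linarith [h.1]
  · linarith [h.1.fst_le]
  · have hK' : K < 0 := lt_of_le_of_ne (not_lt.1 hK) h0
    have h1 := (h.2 hK').1
    have h2 := h.1.fst_le
    have h3 := Real.sin_nonneg_of_nonneg_of_le_pi (x := b.1 - a.1) (by linarith) h1
    have h4 := Real.cosh_pos a.2
    positivity

theorem Rel.tm_nonpos {a b : ℝ × ℝ} (h : Rel K b a) : tm K b a ≤ 0 := by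
  unfold tm
  split_ifs with hK h0
  · rcases h.1 with h | h | h
    · refine div_nonpos_of_nonpos_of_nonneg ?_ (Real.sqrt_nonneg _)
      have h1 := h.2.2.2
      -- Negating the time coordinates reduces the past case to the same inequality.
      have h2 : dSProd b a ≤ Real.cosh (-a.1) * Real.cosh (-b.1)
          - Real.sinh (-a.1) * Real.sinh (-b.1) := by
        unfold dSProd
        simp only [Real.cosh_neg, Real.sinh_neg]
        nlinarith [Real.cos_le_one (a.2 - b.2),
          mul_pos (Real.cosh_pos a.1) (Real.cosh_pos b.1)]
      have h3 := sinh_mul_sub_nonneg (neg_le_neg h.2.1) h1 h2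
      unfold dSProd at h3
      rw [Real.sinh_neg, Real.sinh_neg, ← neg_sub b.2 a.2, Real.cos_neg] at h3
      have h4 := Real.cosh_pos b.1
      refine nonpos_of_mul_nonpos_left (b := Real.cosh b.1) ?_ h4
      rw [← neg_nonneg]
      refine h3.trans_eq ?_
      linear_combination -(Real.sinh a.1) * Real.cosh_sq b.1
    · linarith [h.1]
    · linarith [h.1]
  · linarith [h.1.fst_le]
  · have hK' : K < 0 := lt_of_le_of_ne (not_lt.1 hK) h0
    have h1 := (h.2 hK').1
    have h2 := h.1.fst_le
    have h3 := Real.sin_nonneg_of_nonneg_of_le_pi (x := a.1 - b.1) (by linarith) h1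
    have h4 := Real.cosh_pos a.2
    rw [← neg_sub a.1 b.1, Real.sin_neg]
    have : 0 ≤ Real.cosh a.2 * Real.sin (a.1 - b.1) / √(-K) := by positivity
    rw [mul_neg, neg_div]
    linarith

theorem Rel.abs_sp_le {a b : ℝ × ℝ} (h : Rel K a b) : |sp K b a| ≤ tm K b a := by
  simpa [abs_of_nonneg h.tm_nonneg] using h.abs_sp_le_abs_tm

theorem Rel.abs_sp_le_neg {a b : ℝ × ℝ} (h : Rel K b a) : |sp K b a| ≤ -tm K b a := by
  have h1 : |sp K b a| ≤ |tm K b a| := by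
    rw [← sq_le_sq]
    have h1 := tm_sq_sub_sp_sq (K := K) a b
    have h2 := h.world_nonneg
    have h3 := h.two_add_nonneg
    rw [world_comm] at h2 h3
    nlinarith
  simpa [abs_of_nonpos h.tm_nonpos] using h1

/-- Reverse Cauchy–Schwarz for future-directed vectors of the Minkowski plane. -/
theorem reverse_cauchy_schwarz {t₁ s₁ t₂ s₂ n₁ n₂ : ℝ} (h₁ : |s₁| ≤ t₁) (h₂ : |s₂| ≤ t₂)
    (e₁ : n₁ ^ 2 = t₁ ^ 2 - s₁ ^ 2) (e₂ : n₂ ^ 2 = t₂ ^ 2 - s₂ ^ 2) :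
    n₁ * n₂ ≤ t₁ * t₂ - s₁ * s₂ := by
  have h3 : s₁ * s₂ ≤ t₁ * t₂ :=
    (le_abs_self _).trans ((abs_mul s₁ s₂).trans_le
      (mul_le_mul h₁ h₂ (abs_nonneg _) ((abs_nonneg _).trans h₁)))
  refine abs_le_of_sq_le_sq' ?_ (by linarith) |>.2
  have : (n₁ * n₂) ^ 2 = (t₁ ^ 2 - s₁ ^ 2) * (t₂ ^ 2 - s₂ ^ 2) := by rw [mul_pow, e₁, e₂]
  nlinarith [sq_nonneg (t₁ * s₂ - s₁ * t₂)]

section Hinge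

variable {a b c : ℝ × ℝ} {s t : ℝ}

theorem sn_sq_eq (h : world K a b = md K s) : sn K s ^ 2 = tm K b a ^ 2 - sp K b a ^ 2 := by
  rw [tm_sq_sub_sp_sq, h, sn_sq]

/-- The reverse triangle inequality of `M_K`. -/
theorem md_add_le_world (hab : Rel K a b) (hbc : Rel K b c) (hs : world K a b = md K s)
    (ht : world K b c = md K t) :
    md K (s + t) ≤ world K a c := by
  have := reverse_cauchy_schwarz (n₁ := sn K s) (n₂ := sn K t) (s₂ := -sp K b c) (t₂ := -tm K b c) hab.abs_sp_le
    (by rw [abs_neg]; exact hbc.abs_sp_le_neg)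
    (sn_sq_eq hs) (by rw [neg_sq, neg_sq]; exact sn_sq_eq (by rw [world_comm]; exact ht))
  rw [world_tangent a b c, hs, ht, md_add]
  linarith

/-- The chords at b now lie in the same time cone, so reverse Cauchy–Schwarz enters with the sign
opposite to that in `md_add_le_world`. -/
theorem world_le_md_sub_past (hab : Rel K a b) (hcb : Rel K c b) (hs : world K a b = md K s)
    (ht : world K c b = md K t) :
    world K a c ≤ md K (s - t) := by
  have := reverse_cauchy_schwarz hab.abs_sp_le hcb.abs_sp_le (sn_sq_eq hs) (sn_sq_eq ht)
  rw [world_tangent a b c, hs, world_comm b c, ht, md_sub]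
  linarith

theorem world_le_md_sub_future (hba : Rel K b a) (hbc : Rel K b c) (hs : world K b a = md K s)
    (ht : world K b c = md K t) :
    world K a c ≤ md K (s - t) := by
  rw [world_comm] at hs
  have ht' := ht
  rw [world_comm] at ht'
  have := reverse_cauchy_schwarz (n₁ := sn K s) (n₂ := sn K t) (s₁ := -sp K b a) (t₁ := -tm K b a) (s₂ := -sp K b c)
    (t₂ := -tm K b c)
    (by rw [abs_neg]; exact hba.abs_sp_le_neg) (by rw [abs_neg]; exact hbc.abs_sp_le_neg)
    (by rw [neg_sq, neg_sq]; exact sn_sq_eq hs) (by rw [neg_sq, neg_sq]; exact sn_sq_eq ht')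
  rw [world_tangent a b c, hs, ht, md_sub]
  linarith

/-- The chords at b lie in opposite time cones, which fixes the sign of their product. This is the
tool for excluding a reversed causal order when only values of `world` are known. -/
theorem hinge_nonneg (hab : Rel K a b) (hbc : Rel K b c) :
    world K a b + world K b c + K * world K a b * world K b c ≤ world K a c := by
  have h1 := abs_le.1 hab.abs_sp_le
  have h2 := abs_le.1 hbc.abs_sp_le_neg
  rw [world_tangent a b c]
  nlinarith

theorem hinge_nonpos_future (hba : Rel K b a) (hbc : Rel K b c) :
    world K a c ≤ world K a b + world K b c + K * world K a b * world K b c := by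
  have h1 := abs_le.1 hba.abs_sp_le_neg
  have h2 := abs_le.1 hbc.abs_sp_le_neg
  rw [world_tangent a b c]
  nlinarith

end Hinge

theorem modelTau_eq_ofReal {p q : ℝ × ℝ} (h : Rel K p q) {l : ℝ} (hl : 0 ≤ l)
    (hl' : K < 0 → √(-K) * l ≤ Real.pi) (hw : world K p q = md K l) :
    modelTau K p q = ENNReal.ofReal l := by
  unfold modelTau
  unfold world md at hw
  rw [if_pos h.1]
  split_ifs at hw ⊢ with hK h0 h1
  · rw [div_left_inj' hK.ne', sub_left_inj] at hw
    have := Real.sqrt_pos.2 hK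
    rw [hw, Real.arcosh_cosh (by positivity), mul_div_cancel_left₀ _ this.ne']
  · rw [show (q.1 - p.1) ^ 2 - (q.2 - p.2) ^ 2 = l ^ 2 by linarith, Real.sqrt_sq hl]
  · have hK' : K < 0 := lt_of_le_of_ne (not_lt.1 hK) h0
    have h2 : 0 < √(-K) := Real.sqrt_pos.2 (by linarith)
    rw [div_left_inj' h0, sub_left_inj] at hw
    rw [hw, Real.arccos_cos (by positivity) (hl' hK'), mul_div_cancel_left₀ _ h2.ne']
  · have hK' : K < 0 := lt_of_le_of_ne (not_lt.1 hK) h0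
    exact absurd (h.2 hK') h1

theorem Rel.exists_md_eq {p q : ℝ × ℝ} (h : Rel K p q) :
    ∃ l, 0 ≤ l ∧ (K < 0 → √(-K) * l ≤ Real.pi) ∧ world K p q = md K l := by
  have h1 := h.world_nonneg
  have h2 := h.two_add_nonneg
  unfold md
  rcases lt_trichotomy K 0 with hK | hK | hK
  · have h3 : 0 < √(-K) := Real.sqrt_pos.2 (by linarith)
    refine ⟨Real.arccos (1 + K * world K p q) / √(-K),
      div_nonneg (Real.arccos_nonneg _) h3.le, fun _ => ?_, ?_⟩
    · rw [mul_div_cancel₀ _ h3.ne']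
      exact Real.arccos_le_pi _
    · rw [if_neg hK.not_gt, if_neg hK.ne, mul_div_cancel₀ _ h3.ne',
        Real.cos_arccos (by linarith) (by nlinarith)]
      field_simp [hK.ne]
      ring
  · subst hK
    refine ⟨√(2 * world 0 p q), Real.sqrt_nonneg _, fun h => absurd h (lt_irrefl _), ?_⟩
    rw [if_neg (lt_irrefl _), if_pos rfl, Real.sq_sqrt (by positivity)]
    ring
  · have h3 : 0 < √K := Real.sqrt_pos.2 hK
    have h4 : 1 ≤ 1 + K * world K p q := by nlinarith
    refine ⟨Real.arcosh (1 + K * world K p q) / √K,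
      div_nonneg (Real.arcosh_nonneg h4) h3.le, fun h => absurd h hK.not_gt, ?_⟩
    rw [if_pos hK, mul_div_cancel₀ _ h3.ne', Real.cosh_arcosh h4]
    field_simp
    ring

theorem rel_of_modelCausal_of_ne_top {p q : ℝ × ℝ} (h : modelCausal K p q)
    (ht : modelTau K p q ≠ ∞) : Rel K p q := by
  refine ⟨h, fun hK => ?_⟩
  by_contra hn
  apply ht
  unfold modelTau
  rw [if_pos h, if_neg hK.not_gt, if_neg hK.ne, if_neg hn]

theorem modelCausal_of_modelTau_ne_zero {p q : ℝ × ℝ} (h : modelTau K p q ≠ 0) :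
    modelCausal K p q := by
  by_contra hn
  exact h (by unfold modelTau; rw [if_neg hn])

theorem world_eq_md_of_modelTau {p q : ℝ × ℝ} (h : Rel K p q) {l : ℝ} (hl : 0 ≤ l)
    (ht : modelTau K p q = ENNReal.ofReal l) : world K p q = md K l := by
  obtain ⟨m, hm, hm', hw⟩ := h.exists_md_eq
  rw [modelTau_eq_ofReal h hm hm' hw, ENNReal.ofReal_eq_ofReal_iff hm hl] at ht
  rw [hw, ht]

/-- The slices of constant time coordinate contain no chronologically related points. -/
theorem world_nonpos_of_fst_eq {p q : ℝ × ℝ} (h : q.1 = p.1) :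
    world K p q ≤ 0 := by
  unfold world dSProd adSProd
  rw [h]
  split_ifs with hK h0
  · refine div_nonpos_of_nonpos_of_nonneg ?_ hK.le
    nlinarith [Real.cosh_sq p.1, Real.cos_le_one (q.2 - p.2), sq_nonneg (Real.cosh p.1)]
  · nlinarith [sq_nonneg (q.2 - p.2)]
  · refine div_nonpos_of_nonneg_of_nonpos ?_ (not_lt.1 hK)
    rw [sub_self, Real.cos_zero, mul_one, ← Real.cosh_sub]
    linarith [Real.one_le_cosh (p.2 - q.2)]

/-- The weight of the initial point in Stewart's theorem. -/
noncomputable def lCoef (K L t : ℝ) : ℝ := sn K (L - t) / sn K L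

/-- The weight of the end point in Stewart's theorem. -/
noncomputable def rCoef (K L t : ℝ) : ℝ := sn K t / sn K L

/-- The constant term in Stewart's theorem. -/
noncomputable def cCoef (K L t : ℝ) : ℝ := rCoef K L t * md K L - md K t

section Coefficients

variable {L t : ℝ}

theorem lCoef_nonneg (hL : InRange K L) (h0 : 0 ≤ t) (h : t ≤ L) : 0 ≤ lCoef K L t :=
  div_nonneg (sn_nonneg (by linarith) (hL.mono (by linarith))) (sn_nonneg (by linarith) hL)

theorem rCoef_nonneg (hL : InRange K L) (h0 : 0 ≤ t) (h : t ≤ L) : 0 ≤ rCoef K L t :=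
  div_nonneg (sn_nonneg h0 (hL.mono h)) (sn_nonneg (by linarith) hL)

/-- For K ≠ 0 this is Stewart's formula applied to the constant solution -1/K of F'' = 1 + K F. -/
theorem coef_add (hL : sn K L ≠ 0) :
    lCoef K L t + rCoef K L t + K * cCoef K L t = 1 := by
  unfold cCoef lCoef rCoef
  rw [sn_sub]
  field_simp
  ring

theorem rCoef_mul_sub : rCoef K L t * md K L - cCoef K L t = md K t := by
  unfold cCoef; ring

theorem lCoef_mul_sub (hL : sn K L ≠ 0) :
    lCoef K L t * md K L - cCoef K L t = md K (L - t) := by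
  unfold cCoef lCoef rCoef
  rw [sn_sub, md_sub]
  field_simp
  linear_combination sn K t * sn_sq (K := K) L

/-- Stewart's formula applied twice to `world` of the dividing point with itself, which is 0. This
is the constraint that a combination of the end points must satisfy to be a point of M_K. -/
theorem coef_quadratic (hL : sn K L ≠ 0) :
    2 * cCoef K L t - K * cCoef K L t ^ 2 = 2 * lCoef K L t * rCoef K L t * md K L := by
  have h1 : lCoef K L t * md K t + rCoef K L t * md K (L - t) = cCoef K L t := by
    unfold cCoef lCoef rCoef
    rw [sn_sub, md_sub]
    field_simp
    linear_combination -sn K L * sn_sq (K := K) t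
  have h2 := coef_add (K := K) (t := t) hL
  rw [← lCoef_mul_sub hL, ← rCoef_mul_sub (L := L)] at h1
  linear_combination -h1 - cCoef K L t * h2

end Coefficients

/-- `a` is the point at distance `t` from `u` on the geodesic segment of length `L` from `u`
to `v`. -/
structure IsOnSegment (K : ℝ) (u v : ℝ × ℝ) (L t : ℝ) (a : ℝ × ℝ) : Prop where
  rel_left : Rel K u a
  rel_right : Rel K a v
  world_left : world K u a = md K t
  world_right : world K a v = md K (L - t)

/-- Stewart's theorem in `M_K`. -/
theorem IsOnSegment.world_eq {u v a : ℝ × ℝ} {L t : ℝ} (h : IsOnSegment K u v L t a)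
    (huv : world K u v = md K L) (hL : sn K L ≠ 0) (o : ℝ × ℝ) :
    world K a o = lCoef K L t * world K u o + rCoef K L t * world K v o - cCoef K L t := by
  have h1 := sn_sq_eq (K := K) (a := a) (b := u) (by rw [world_comm]; exact h.world_left)
  have h2 := sn_sq_eq (K := K) (a := v) (b := u) (by rw [world_comm]; exact huv)
  have h3 := world_tangent (K := K) a u v
  rw [world_comm a u, h.world_left, huv, h.world_right, md_sub] at h3
  -- Since a lies on the segment, reverse Cauchy–Schwarz at u is an equality, so the chords to a and
  -- to v are parallel.
  have h4 : (tm K u a * sp K u v - sp K u a * tm K u v) ^ 2 = 0 := by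
    linear_combination sn K L ^ 2 * h1 + (tm K u a ^ 2 - sp K u a ^ 2) * h2
      + (sn K t * sn K L + tm K u a * tm K u v - sp K u a * sp K u v) * h3
  have h5 : tm K u a * sp K u v - sp K u a * tm K u v = 0 := pow_eq_zero_iff (two_ne_zero) |>.1 h4
  -- Parallelism and the lengths show that the chord to a is sn t / sn L times the chord to v.
  have h6 : tm K u a * sn K L = sn K t * tm K u v := by
    apply mul_right_cancel₀ hL
    linear_combination tm K u a * h2 - sp K u v * h5 + tm K u v * h3
  have h7 : sp K u a * sn K L = sn K t * sp K u v := by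
    apply mul_right_cancel₀ hL
    linear_combination sp K u a * h2 - tm K u v * h5 + sp K u v * h3
  have h8 := world_tangent (K := K) a u o
  have h9 := world_tangent (K := K) v u o
  rw [world_comm a u, h.world_left] at h8
  rw [world_comm v u, huv] at h9
  unfold cCoef lCoef rCoef
  rw [sn_sub]
  field_simp
  linear_combination sn K L * h8 - sn K t * h9 + sp K u o * h7 - tm K u o * h6

end ModelGeometry

/-! ### Existence of comparison points and comparison triangles. -/

section Existence

variable {K : ℝ}

/-- A neighbourhood of the future of the origin in which causality is decided by `world`. -/
def Near (K : ℝ) (a : ℝ × ℝ) : Prop :=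
  (0 < K → |a.2| < Real.pi / 2) ∧ (K < 0 → 0 ≤ a.1 ∧ a.1 ≤ Real.pi)

/-- Within `Near` the spatial difference stays below π for K > 0, and the time difference is at most
π for K < 0, so positivity of `world` leaves only the order of the time coordinates to decide. -/
theorem Near.modelCausal_or {a b : ℝ × ℝ} (ha : Near K a) (hb : Near K b)
    (h : 0 < world K a b) : modelCausal K a b ∨ modelCausal K b a := by
  have h' := h
  rw [world_comm] at h'
  unfold world at h h'
  unfold modelCausal
  split_ifs at h h' with hK h0
  · rw [lt_div_iff₀ hK] at h h'
    have h1 := abs_lt.1 (ha.1 hK)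
    have h2 := abs_lt.1 (hb.1 hK)
    rcases le_total a.1 b.1 with h3 | h3
    · exact Or.inl (Or.inl ⟨hK, h3, abs_le.2 ⟨by linarith, by linarith⟩, by linarith⟩)
    · exact Or.inr (Or.inl ⟨hK, h3, abs_le.2 ⟨by linarith, by linarith⟩, by linarith⟩)
  · have h1 : (b.2 - a.2) ^ 2 ≤ (b.1 - a.1) ^ 2 := by linarith
    have h2 := sq_le_sq.1 h1
    rcases le_total a.1 b.1 with h3 | h3
    · rw [abs_of_nonneg (sub_nonneg.2 h3)] at h2
      exact Or.inl (Or.inr (Or.inl ⟨h0, h2⟩))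
    · rw [abs_of_nonpos (sub_nonpos.2 h3), abs_sub_comm] at h2
      exact Or.inr (Or.inr (Or.inl ⟨h0, by linarith⟩))
  · have hK' : K < 0 := lt_of_le_of_ne (not_lt.1 hK) h0
    rw [lt_div_iff_of_neg hK'] at h h'
    rcases le_total a.1 b.1 with h3 | h3
    · exact Or.inl (Or.inr (Or.inr ⟨hK', h3, fun _ => by linarith⟩))
    · exact Or.inr (Or.inr (Or.inr ⟨hK', h3, fun _ => by linarith⟩))

theorem rel_of_modelCausal {a b : ℝ × ℝ} (hab : modelCausal K a b)
    (ht : K < 0 → b.1 - a.1 ≤ Real.pi) (h2 : 0 ≤ 2 + K * world K a b) : Rel K a b := by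
  refine ⟨hab, fun hK => ⟨ht hK, ?_⟩⟩
  unfold world at h2
  rw [if_neg hK.not_gt, if_neg hK.ne, mul_div_cancel₀ _ hK.ne] at h2
  linarith

theorem Near.rel_or {a b : ℝ × ℝ} (ha : Near K a) (hb : Near K b)
    (h : 0 < world K a b) (h2 : 0 ≤ 2 + K * world K a b) : Rel K a b ∨ Rel K b a := by
  rcases ha.modelCausal_or hb h with h' | h'
  · exact Or.inl (rel_of_modelCausal h'
      (fun hK => by linarith [(ha.2 hK).1, (hb.2 hK).2]) h2)
  · exact Or.inr (rel_of_modelCausal h'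
      (fun hK => by linarith [(hb.2 hK).1, (ha.2 hK).2]) (by rwa [world_comm]))

theorem Near.rel_or_of_eq_md {a b : ℝ × ℝ} (ha : Near K a) (hb : Near K b) {t : ℝ}
    (ht : 0 < t) (hr : InRange K t) (h : world K a b = md K t) : Rel K a b ∨ Rel K b a :=
  ha.rel_or hb (by rw [h]; exact md_pos ht hr)
    (by rw [h]; exact (two_add_mul_md_pos (by rwa [abs_of_pos ht])).le)

theorem Rel.refl (a : ℝ × ℝ) : Rel K a a := by
  have h := world_self (K := K) a
  unfold world at h
  refine rel_of_modelCausal ?_ (fun _ => by simpa using Real.pi_pos.le) (by simp [world_self])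
  unfold modelCausal
  split_ifs at h with hK h0
  · rw [div_eq_zero_iff, or_iff_left hK.ne'] at h
    exact Or.inl ⟨hK, le_rfl, by simpa using Real.pi_pos.le, by linarith⟩
  · exact Or.inr (Or.inl ⟨h0, by simp⟩)
  · rw [div_eq_zero_iff, or_iff_left h0] at h
    exact Or.inr (Or.inr ⟨lt_of_le_of_ne (not_lt.1 hK) h0, le_rfl, fun _ => by linarith⟩)

theorem near_origin : Near K (0, 0) :=
  ⟨fun _ => by simpa using Real.pi_pos, fun _ => ⟨le_rfl, Real.pi_pos.le⟩⟩

theorem Near.world_origin {a : ℝ × ℝ} (ha : Near K a) (hK : 0 < K) :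
    0 < 1 + K * world K (0, 0) a := by
  have h := Real.cos_pos_of_mem_Ioo (abs_lt.1 (ha.1 hK))
  unfold world dSProd
  rw [if_pos hK, mul_div_cancel₀ _ hK.ne']
  have := Real.cosh_pos a.1
  simp only [Real.cosh_zero, Real.sinh_zero, sub_zero]
  ring_nf
  positivity

theorem Near.tm_origin {a : ℝ × ℝ} (ha : Near K a) (hK : K < 0) : tm K (0, 0) a ≤ 0 := by
  obtain ⟨h1, h2⟩ := ha.2 hK
  have h3 := Real.sin_nonneg_of_nonneg_of_le_pi h1 h2
  have := Real.cosh_pos a.2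
  unfold tm
  rw [if_neg hK.not_gt, if_neg hK.ne]
  simp only [zero_sub, Real.sin_neg, mul_neg, neg_div]
  exact neg_nonpos.2 (by positivity)

/-- Normal coordinates at the origin are onto. -/
theorem exists_near (f T S : ℝ) (h : T ^ 2 - S ^ 2 = 2 * f + K * f ^ 2)
    (hp : 0 < K → 0 < 1 + K * f) (hn : K < 0 → T ≤ 0) :
    ∃ a, Near K a ∧ world K (0, 0) a = f ∧ tm K (0, 0) a = T ∧ sp K (0, 0) a = S := by
  rcases lt_trichotomy K 0 with hK | hK | hK
  · have hk : 0 < √(-K) := Real.sqrt_pos.2 (by linarith)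
    have hk2 := Real.sq_sqrt (show 0 ≤ -K by linarith)
    set k := √(-K) with hkd
    -- The space component fixes s; the constraint `h` puts the normalized pair of 1 + K f and -k T
    -- on the unit circle, and T ≤ 0 selects t in [0, π].
    set s := Real.arsinh (-S * k) with hs
    have hss : Real.sinh s = -S * k := Real.sinh_arsinh _
    have hc := Real.cosh_pos s
    have hc2 : Real.cosh s ^ 2 = 1 + S ^ 2 * k ^ 2 := by rw [Real.cosh_sq, hss]; ring
    have hx : ((1 + K * f) / Real.cosh s) ^ 2 + (-(k * T) / Real.cosh s) ^ 2 = 1 := by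
      rw [div_pow, div_pow, ← add_div, div_eq_one_iff_eq (by positivity), hc2]
      linear_combination -K * h + (T ^ 2 - S ^ 2) * hk2
    set t := Real.arccos ((1 + K * f) / Real.cosh s) with ht
    have hct : Real.cos t = (1 + K * f) / Real.cosh s :=
      Real.cos_arccos (by nlinarith [sq_nonneg (-(k * T) / Real.cosh s)])
        (by nlinarith [sq_nonneg (-(k * T) / Real.cosh s)])
    have hst : Real.sin t = -(k * T) / Real.cosh s := by
      have h0 : 0 ≤ -(k * T) / Real.cosh s := div_nonneg (by nlinarith [hn hK]) hc.le
      rw [ht, Real.sin_arccos, ← Real.sqrt_sq h0]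
      congr 1
      linarith
    refine ⟨(t, s), ⟨fun h => absurd h hK.not_gt,
      fun _ => ⟨Real.arccos_nonneg _, Real.arccos_le_pi _⟩⟩, ?_, ?_, ?_⟩
    · unfold world adSProd
      rw [if_neg hK.not_gt, if_neg hK.ne]
      simp only [Real.cosh_zero, Real.sinh_zero, sub_zero, hct]
      field_simp [hK.ne]
      ring
    · unfold tm
      rw [← hkd, if_neg hK.not_gt, if_neg hK.ne]
      simp only [zero_sub, Real.sin_neg, hst]
      field_simp
    · unfold sp
      rw [← hkd, if_neg hK.not_gt, if_neg hK.ne]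
      simp only [Real.cosh_zero, Real.sinh_zero, hss]
      field_simp
      ring
  · subst hK
    refine ⟨(-T, -S), ⟨fun h => absurd h (lt_irrefl _), fun h => absurd h (lt_irrefl _)⟩,
      ?_, ?_, ?_⟩
    · simp only [world, lt_irrefl, if_false, if_true]
      linarith
    · simp [tm]
    · simp [sp]
  · have hk : 0 < √K := Real.sqrt_pos.2 hK
    have hk2 := Real.sq_sqrt hK.le
    set k := √K with hkd
    set t := Real.arsinh (-T * k) with ht
    have hst : Real.sinh t = -T * k := Real.sinh_arsinh _
    have hc := Real.cosh_pos t
    have hc2 : Real.cosh t ^ 2 = 1 + T ^ 2 * k ^ 2 := by rw [Real.cosh_sq, hst]; ring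
    have hx : ((1 + K * f) / Real.cosh t) ^ 2 + (-(k * S) / Real.cosh t) ^ 2 = 1 := by
      rw [div_pow, div_pow, ← add_div, div_eq_one_iff_eq (by positivity), hc2]
      linear_combination -K * h + (S ^ 2 - T ^ 2) * hk2
    -- This sign makes cos s positive, so that s is recovered by arcsin within (-π/2, π/2).
    have hpos : 0 < (1 + K * f) / Real.cosh t := div_pos (hp hK) hc
    have hlt : (-(k * S) / Real.cosh t) ^ 2 < 1 := by nlinarith
    obtain ⟨hl1, hl2⟩ := abs_lt.1 ((sq_lt_one_iff_abs_lt_one _).1 hlt)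
    set s := Real.arcsin (-(k * S) / Real.cosh t) with hs
    have hss : Real.sin s = -(k * S) / Real.cosh t := Real.sin_arcsin hl1.le hl2.le
    have hcs : Real.cos s = (1 + K * f) / Real.cosh t := by
      rw [hs, Real.cos_arcsin, ← Real.sqrt_sq hpos.le]
      congr 1
      linarith
    refine ⟨(t, s), ⟨fun _ => abs_lt.2 ⟨Real.neg_pi_div_two_lt_arcsin.2 hl1,
      Real.arcsin_lt_pi_div_two.2 hl2⟩, fun h => absurd h hK.not_gt⟩, ?_, ?_, ?_⟩
    · unfold world dSProd
      rw [if_pos hK]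
      simp only [Real.cosh_zero, Real.sinh_zero, sub_zero, hcs]
      field_simp
      ring
    · unfold tm
      rw [← hkd, if_pos hK]
      simp only [Real.cosh_zero, Real.sinh_zero, hst]
      field_simp
      ring
    · unfold sp
      rw [← hkd, if_pos hK]
      simp only [zero_sub, Real.sin_neg, hss]
      field_simp

theorem exists_isOnSegment {u v : ℝ × ℝ} (hu : Near K u) (hv : Near K v) (huv : Rel K u v)
    {L t : ℝ} (hL : 0 < L) (hr : InRange K L) (hw : world K u v = md K L) (ht : 0 ≤ t)
    (htL : t ≤ L) : ∃ a, Near K a ∧ IsOnSegment K u v L t a := by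
  rcases ht.eq_or_lt with rfl | ht
  · exact ⟨u, hu, Rel.refl u, huv, by rw [world_self, md_zero], by rw [hw, sub_zero]⟩
  rcases htL.eq_or_lt with rfl | htL
  · exact ⟨v, hv, huv, Rel.refl v, hw, by rw [world_self, sub_self, md_zero]⟩
  have hsL := sn_pos hL hr
  have hst := sn_pos ht (hr.mono htL.le)
  have hsLt := sn_pos (sub_pos.2 htL) (hr.mono (by linarith))
  have hl0 : 0 < lCoef K L t := div_pos hsLt hsL
  have hm0 : 0 < rCoef K L t := div_pos hst hsL
  have e1 := coef_add (K := K) (t := t) hsL.ne'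
  have e2 := coef_quadratic (K := K) (t := t) hsL.ne'
  have e3 := lCoef_mul_sub (K := K) (t := t) hsL.ne'
  have e4 := rCoef_mul_sub (K := K) (L := L) (t := t)
  set l := lCoef K L t
  set m := rCoef K L t
  set k := cCoef K L t
  set fu := world K (0, 0) u with hfu
  set fv := world K (0, 0) v with hfv
  have hq := world_tangent (K := K) u (0, 0) v
  rw [hw, world_comm u, ← hfu, ← hfv] at hq
  have hqu := tm_sq_sub_sp_sq (K := K) u (0, 0)
  have hqv := tm_sq_sub_sp_sq (K := K) v (0, 0)
  rw [world_comm, ← hfu] at hqu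
  rw [world_comm, ← hfv] at hqv
  -- The normal coordinates at the origin are prescribed as Stewart's combination of those of u and
  -- v; the compatibility condition is `coef_quadratic`.
  obtain ⟨a, ha, hf, hT, hS⟩ := exists_near (K := K) (l * fu + m * fv - k)
    (l * tm K (0, 0) u + m * tm K (0, 0) v) (l * sp K (0, 0) u + m * sp K (0, 0) v)
    (by
      have h3 : K * k = 1 - l - m := by linarith
      linear_combination l ^ 2 * hqu + m ^ 2 * hqv + 2 * l * m * hq + e2
        + 2 * (l * fu + m * fv) * e1)
    (fun hK => by
      have h1 := hu.world_origin hK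
      have h2 := hv.world_origin hK
      have : 1 + K * (l * fu + m * fv - k) = l * (1 + K * fu) + m * (1 + K * fv) := by
        linear_combination -e1
      rw [this]
      positivity)
    (fun hK => by nlinarith [hu.tm_origin hK, hv.tm_origin hK])
  have hua : world K u a = md K t := by
    have h1 := world_tangent (K := K) u (0, 0) a
    rw [hf, hT, hS, world_comm u (0, 0), ← hfu] at h1
    linear_combination h1 + e4 - m * hq - l * hqu - fu * e1
  have hav : world K a v = md K (L - t) := by
    have h1 := world_tangent (K := K) a (0, 0) v
    rw [hT, hS, world_comm a (0, 0), hf, ← hfv] at h1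
    linear_combination h1 + e3 - l * hq - m * hqv - fv * e1
  have hru : InRange K t := hr.mono htL.le
  have hrv : InRange K (L - t) := hr.mono (by linarith)
  refine ⟨a, ha, ?_, ?_, hua, hav⟩
  -- If a preceded u, the hinge at u would give sn L sn t ≤ 0.
  · rcases hu.rel_or_of_eq_md ha ht hru hua with h | h
    · exact h
    · have := hinge_nonneg h huv
      rw [world_comm a u, hua, hw, hav, md_sub] at this
      nlinarith
  · rcases ha.rel_or_of_eq_md hv (sub_pos.2 htL) hrv hav with h | h
    · exact h
    · have := hinge_nonneg huv h
      have h5 := md_sub (K := K) L (L - t)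
      rw [sub_sub_cancel] at h5
      rw [world_comm v a, hua, hw, hav] at this
      nlinarith

theorem Near.rel_origin {a : ℝ × ℝ} (ha : Near K a) (ht : tm K (0, 0) a < 0) {l : ℝ} (hl : 0 < l)
    (hr : InRange K l) (hw : world K (0, 0) a = md K l) : Rel K (0, 0) a := by
  rcases near_origin.rel_or_of_eq_md ha hl hr hw with h | h
  · exact h
  · exact absurd h.tm_nonneg (not_le.2 ht)

/-- Existence of comparison triangles. -/
theorem exists_triangle {L₁ L₂ L₃ : ℝ} (h₁ : 0 < L₁) (h₂ : 0 < L₂) (h : L₁ + L₂ ≤ L₃)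
    (hr : InRange K L₃) : ∃ x y z : ℝ × ℝ, Near K x ∧ Near K y ∧ Near K z ∧
      Rel K x y ∧ Rel K y z ∧ Rel K x z ∧
      world K x y = md K L₁ ∧ world K y z = md K L₂ ∧ world K x z = md K L₃ := by
  have h₃ : 0 < L₃ := by linarith
  have hr₁ : InRange K L₁ := hr.mono (by linarith)
  have hr₂ : InRange K L₂ := hr.mono (by linarith)
  have s₁ := sn_pos h₁ hr₁
  have s₂ := sn_pos h₂ hr₂
  have s₃ := sn_pos h₃ hr
  -- With x at the origin, z is placed on the time axis.
  obtain ⟨z, hz, hzf, hzT, hzS⟩ := exists_near (K := K) (md K L₃) (-sn K L₃) 0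
    (by rw [← sn_sq]; ring) (fun hK => by have := md_pos h₃ hr; positivity) (fun _ => by linarith)
  have hxz := hz.rel_origin (by rw [hzT]; linarith) h₃ hr hzf
  -- The law of cosines at x forces the time component of y; the bound T ≥ sn L₁ below expresses L₂
  -- ≤ L₃ - L₁ and leaves room for a real space component.
  set T := (md K L₁ + md K L₃ + K * md K L₁ * md K L₃ - md K L₂) / sn K L₃ with hT
  have hTs : T * sn K L₃ = md K L₁ + md K L₃ + K * md K L₁ * md K L₃ - md K L₂ :=
    div_mul_cancel₀ _ s₃.ne'
  have hT1 : sn K L₁ ≤ T := by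
    have := md_le h₂.le (show L₂ ≤ L₃ - L₁ by linarith)
      (fun hK => (hr.mono (show L₃ - L₁ ≤ L₃ by linarith) hK).le)
    rw [md_sub] at this
    rw [hT, le_div_iff₀ s₃]
    linarith
  have hq : 0 ≤ T ^ 2 - sn K L₁ ^ 2 := by nlinarith
  obtain ⟨y, hy, hyf, hyT, -⟩ := exists_near (K := K) (md K L₁) (-T) (√(T ^ 2 - sn K L₁ ^ 2))
    (by rw [Real.sq_sqrt hq, ← sn_sq]; ring)
    (fun hK => by have := md_pos h₁ hr₁; positivity) (fun _ => by linarith)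
  have hxy := hy.rel_origin (by rw [hyT]; linarith) h₁ hr₁ hyf
  have hyz : world K y z = md K L₂ := by
    rw [world_tangent y (0, 0) z, hzf, hzT, hzS, hyT, world_comm y (0, 0), hyf]
    linear_combination -hTs
  refine ⟨(0, 0), y, z, near_origin, hy, hz, hxy, ?_, hxz, hyf, hyz, hzf⟩
  rcases hy.rel_or_of_eq_md hz h₂ hr₂ hyz with h' | h'
  · exact h'
  · have h1 := hinge_nonneg hxz h'
    have h2 := md_le h₁.le (show L₁ ≤ L₃ - L₂ by linarith)
      (fun hK => (hr.mono (show L₃ - L₂ ≤ L₃ by linarith) hK).le)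
    rw [md_sub] at h2
    rw [hzf, hyf, world_comm z y, hyz] at h1
    nlinarith

end Existence

/-! ### Crossing the axis, and straightening a corner. -/

section Crossing

open Filter Topology

variable {K : ℝ}

/-- The solution of `F'' = 1 + K F` with `F 0 = f` and `F' 0 = g`. -/
noncomputable def ray (K f g r : ℝ) : ℝ := f + md K r + K * f * md K r + g * sn K r

/-- The derivative of `ray`. -/
noncomputable def raySlope (K f g r : ℝ) : ℝ := g * (1 + K * md K r) + (1 + K * f) * sn K r

/-- The modified distance `md K (l₁ + l₂)` for `F₁ = md K l₁` and `F₂ = md K l₂`. -/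
noncomputable def mdSum (K F₁ F₂ : ℝ) : ℝ :=
  F₁ + F₂ + K * F₁ * F₂ + √(F₁ * (2 + K * F₁)) * √(F₂ * (2 + K * F₂))

@[simp] theorem ray_zero (f g : ℝ) : ray K f g 0 = f := by simp [ray]

@[simp] theorem raySlope_zero (f g : ℝ) : raySlope K f g 0 = g := by simp [raySlope]

/-- Conservation of the squared height over the axis, whichever axis point serves as base. -/
theorem raySlope_sq (f g r : ℝ) :
    raySlope K f g r ^ 2 - ray K f g r * (2 + K * ray K f g r) = g ^ 2 - f * (2 + K * f) := by
  unfold ray raySlope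
  linear_combination ((1 + K * f) ^ 2 - K * g ^ 2) * sn_sq (K := K) r

/-- Polarization of `raySlope_sq`: the glued distance does not depend on the base point chosen on
the axis. -/
theorem ray_pairing (f₁ g₁ f₂ g₂ r : ℝ) :
    ray K f₁ g₁ r + ray K f₂ g₂ r + K * ray K f₁ g₁ r * ray K f₂ g₂ r
      - raySlope K f₁ g₁ r * raySlope K f₂ g₂ r = f₁ + f₂ + K * f₁ * f₂ - g₁ * g₂ := by
  unfold ray raySlope
  linear_combination (K * g₁ * g₂ - (1 + K * f₁) * (1 + K * f₂)) * sn_sq (K := K) r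

theorem ray_add (f g r s : ℝ) :
    ray K f g (r + s) = ray K (ray K f g r) (raySlope K f g r) s := by
  unfold ray raySlope
  rw [md_add, sn_add]
  ring

theorem raySlope_add (f g r s : ℝ) :
    raySlope K f g (r + s) = raySlope K (ray K f g r) (raySlope K f g r) s := by
  unfold ray raySlope
  rw [md_add, sn_add]
  ring

theorem continuous_ray (f g : ℝ) : Continuous (ray K f g) := by
  have h1 := continuous_sn (K := K)
  have h2 := continuous_md (K := K)
  unfold ray
  fun_prop

theorem continuous_raySlope (f g : ℝ) : Continuous (raySlope K f g) := by
  have h1 := continuous_sn (K := K)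
  have h2 := continuous_md (K := K)
  unfold raySlope
  fun_prop

theorem mdSum_comm (F₁ F₂ : ℝ) : mdSum K F₁ F₂ = mdSum K F₂ F₁ := by
  unfold mdSum; ring

theorem mdSum_md {s t : ℝ} (hs : 0 ≤ sn K s) (ht : 0 ≤ sn K t) :
    mdSum K (md K s) (md K t) = md K (s + t) := by
  unfold mdSum
  rw [md_add, show md K s * (2 + K * md K s) = sn K s ^ 2 by rw [sn_sq]; ring,
    show md K t * (2 + K * md K t) = sn K t ^ 2 by rw [sn_sq]; ring,
    Real.sqrt_sq hs, Real.sqrt_sq ht]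

/-- The first point lies on the axis at r₀, where its slope vanishes and the required strict signs
fail. Moving r slightly to the suitable side of r₀ restores them, at a cost δ by continuity. -/
theorem exists_crossing_of_vertex {d f₁ g₁ f₂ g₂ r₀ N δ : ℝ} (hr : InRange K d)
    (h0 : 0 ≤ r₀) (hd : r₀ ≤ d) (hF : ray K f₁ g₁ r₀ = 0) (hF' : raySlope K f₁ g₁ r₀ = 0)
    (hN : ray K f₂ g₂ r₀ = N) (hN0 : 0 < N) (hδ : 0 < δ)
    (h : raySlope K f₂ g₂ r₀ < 0 ∧ r₀ < d ∨ 0 < raySlope K f₂ g₂ r₀ ∧ 0 < r₀) :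
    ∃ r, 0 ≤ r ∧ r ≤ d ∧ 0 < ray K f₁ g₁ r ∧ 0 < ray K f₂ g₂ r ∧
      raySlope K f₁ g₁ r * raySlope K f₂ g₂ r < 0 ∧
      N - δ < mdSum K (ray K f₁ g₁ r) (ray K f₂ g₂ r) := by
  have e1 : ∀ r, ray K f₁ g₁ r = md K (r - r₀) := fun r => by
    have := ray_add (K := K) f₁ g₁ r₀ (r - r₀)
    rw [add_sub_cancel, hF, hF'] at this
    rw [this]; simp [ray]
  have e2 : ∀ r, raySlope K f₁ g₁ r = sn K (r - r₀) := fun r => by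
    have := raySlope_add (K := K) f₁ g₁ r₀ (r - r₀)
    rw [add_sub_cancel, hF, hF'] at this
    rw [this]; simp [raySlope]
  have c1 := continuous_ray (K := K) f₁ g₁
  have c2 := continuous_ray (K := K) f₂ g₂
  have c3 := continuous_raySlope (K := K) f₂ g₂
  have c4 : Continuous fun r => mdSum K (ray K f₁ g₁ r) (ray K f₂ g₂ r) := by
    unfold mdSum; fun_prop
  have n1 : ∀ᶠ r in 𝓝 r₀, 0 < ray K f₂ g₂ r :=
    c2.continuousAt.eventually (lt_mem_nhds (by rw [hN]; exact hN0))
  have n2 : ∀ᶠ r in 𝓝 r₀, N - δ < mdSum K (ray K f₁ g₁ r) (ray K f₂ g₂ r) :=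
    c4.continuousAt.eventually (lt_mem_nhds (by
      change _ < mdSum K (ray K f₁ g₁ r₀) (ray K f₂ g₂ r₀)
      rw [hF, hN]; simp [mdSum, hδ]))
  rcases h with ⟨h1, h2⟩ | ⟨h1, h2⟩
  · have n3 : ∀ᶠ r in 𝓝 r₀, raySlope K f₂ g₂ r < 0 := c3.continuousAt.eventually (gt_mem_nhds h1)
    obtain ⟨r, ⟨⟨m1, m2⟩, m3⟩, m4, m5⟩ := (((n1.and n2).and n3).filter_mono
      nhdsWithin_le_nhds |>.and (Ioo_mem_nhdsGT h2)).exists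
    have hr' : InRange K (r - r₀) := hr.mono (by linarith)
    refine ⟨r, by linarith, m5.le, ?_, m1, ?_, m2⟩
    · rw [e1]; exact md_pos (sub_pos.2 m4) hr'
    · rw [e2]; exact mul_neg_of_pos_of_neg (sn_pos (sub_pos.2 m4) hr') m3
  · have n3 : ∀ᶠ r in 𝓝 r₀, 0 < raySlope K f₂ g₂ r := c3.continuousAt.eventually (lt_mem_nhds h1)
    obtain ⟨r, ⟨⟨m1, m2⟩, m3⟩, m4, m5⟩ := (((n1.and n2).and n3).filter_mono
      nhdsWithin_le_nhds |>.and (Ioo_mem_nhdsLT h2)).exists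
    have hr' : InRange K (r₀ - r) := hr.mono (by linarith)
    refine ⟨r, m4.le, by linarith, ?_, m1, ?_, m2⟩
    · rw [e1, ← neg_sub, md_neg]; exact md_pos (sub_pos.2 m5) hr'
    · rw [e2, ← neg_sub, sn_neg]
      exact mul_neg_of_neg_of_pos (neg_neg_of_pos (sn_pos (sub_pos.2 m5) hr')) m3

/-- N is the glued signed distance of two points on opposite sides of the axis. The line joining
them meets the axis where G₁ H₂ + G₂ H₁ = 0, and there the two partial lengths add up to the whole.
The end conditions at 0 and d let the intermediate value theorem find this r; the loss δ is needed
only when a point lies on the axis itself. -/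
theorem exists_crossing {d f₁ g₁ H₁ f₂ g₂ H₂ N δ : ℝ} (hd : 0 < d) (hr : InRange K d)
    (hH₁ : 0 ≤ H₁) (hH₂ : 0 ≤ H₂) (e₁ : H₁ ^ 2 = g₁ ^ 2 - f₁ * (2 + K * f₁))
    (e₂ : H₂ ^ 2 = g₂ ^ 2 - f₂ * (2 + K * f₂))
    (p₁ : ∀ r, 0 ≤ r → r ≤ d → 0 < 2 + K * ray K f₁ g₁ r)
    (p₂ : ∀ r, 0 ≤ r → r ≤ d → 0 < 2 + K * ray K f₂ g₂ r)
    (q₁ : 0 ≤ raySlope K f₁ g₁ d) (q₂ : 0 ≤ raySlope K f₂ g₂ d) (hg : g₂ ≤ 0)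
    (hL : g₁ * H₂ + g₂ * H₁ ≤ 0) (hs : g₂ < 0 ∨ g₁ ≤ 0)
    (hN : N = f₁ + f₂ + K * f₁ * f₂ - g₁ * g₂ - H₁ * H₂) (hN0 : 0 < N) (hδ : 0 < δ) :
    ∃ r, 0 ≤ r ∧ r ≤ d ∧ 0 < ray K f₁ g₁ r ∧ 0 < ray K f₂ g₂ r ∧
      raySlope K f₁ g₁ r * raySlope K f₂ g₂ r < 0 ∧
      N - δ < mdSum K (ray K f₁ g₁ r) (ray K f₂ g₂ r) := by
  have ivt : ∀ φ : ℝ → ℝ, Continuous φ → φ 0 ≤ 0 → 0 ≤ φ d → ∃ r, 0 ≤ r ∧ r ≤ d ∧ φ r = 0 := by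
    intro φ hφ h0 h1
    obtain ⟨r, hr, h⟩ := intermediate_value_Icc hd.le hφ.continuousOn ⟨h0, h1⟩
    exact ⟨r, hr.1, hr.2, h⟩
  have c₁ := continuous_raySlope (K := K) f₁ g₁
  have c₂ := continuous_raySlope (K := K) f₂ g₂
  have s₁ := raySlope_sq (K := K) f₁ g₁
  have s₂ := raySlope_sq (K := K) f₂ g₂
  have pr := ray_pairing (K := K) f₁ g₁ f₂ g₂
  rcases hH₁.eq_or_lt with rfl | hH₁
  · rcases le_or_gt g₁ 0 with hg₁ | hg₁
    -- A point of height 0 whose slope vanishes at r is the axis point with parameter r.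
    · obtain ⟨r, h0, h1, h2⟩ := ivt _ c₁ (by simpa using hg₁) q₁
      have h3 := s₁ r
      have hF : ray K f₁ g₁ r = 0 := by
        have h4 : ray K f₁ g₁ r * (2 + K * ray K f₁ g₁ r) = 0 := by rw [h2] at h3; linarith
        exact (mul_eq_zero.1 h4).resolve_right (p₁ r h0 h1).ne'
      have hN' : ray K f₂ g₂ r = N := by
        have h4 := pr r
        rw [hF, h2] at h4
        linarith
      have h5 : 0 < raySlope K f₂ g₂ r ^ 2 := by
        have := s₂ r
        have := p₂ r h0 h1
        rw [hN'] at *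
        nlinarith [mul_pos hN0 this]
      refine exists_crossing_of_vertex hr h0 h1 hF h2 hN' hN0 hδ ?_
      rcases lt_or_gt_of_ne ((sq_pos_iff).1 h5) with h6 | h6
      · refine Or.inl ⟨h6, lt_of_le_of_ne h1 ?_⟩
        rintro rfl
        exact absurd h6 (not_lt.2 q₂)
      · refine Or.inr ⟨h6, lt_of_le_of_ne h0 ?_⟩
        rintro rfl
        rw [raySlope_zero] at h6
        exact absurd h6 (not_lt.2 hg)
    -- Both points lie on the line of the axis, one before p and the other after it, so p itself
    -- lies between them.
    · have hH : H₂ = 0 := by nlinarith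
      have hg₂ : g₂ < 0 := hs.resolve_right (not_le.2 hg₁)
      subst hH
      have k₁ : f₁ * (2 + K * f₁) = g₁ ^ 2 := by linarith
      have k₂ : f₂ * (2 + K * f₂) = g₂ ^ 2 := by linarith
      have u₁ := p₁ 0 le_rfl hd.le
      have u₂ := p₂ 0 le_rfl hd.le
      rw [ray_zero] at u₁ u₂
      refine ⟨0, le_rfl, hd.le, ?_, ?_, ?_, ?_⟩
      · rw [ray_zero]
        exact pos_of_mul_pos_left (by rw [k₁]; positivity) u₁.le
      · rw [ray_zero]
        exact pos_of_mul_pos_left (by rw [k₂]; exact sq_pos_of_neg hg₂) u₂.le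
      · simpa using mul_neg_of_pos_of_neg hg₁ hg₂
      · unfold mdSum
        rw [ray_zero, ray_zero, k₁, k₂, Real.sqrt_sq hg₁.le, ← neg_sq g₂,
          Real.sqrt_sq (by linarith)]
        linarith
  rcases hH₂.eq_or_lt with rfl | hH₂
  · obtain ⟨r, h0, h1, h2⟩ := ivt _ c₂ (by simpa using hg) q₂
    have h3 := s₂ r
    have hF : ray K f₂ g₂ r = 0 := by
      have h4 : ray K f₂ g₂ r * (2 + K * ray K f₂ g₂ r) = 0 := by rw [h2] at h3; linarith
      exact (mul_eq_zero.1 h4).resolve_right (p₂ r h0 h1).ne'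
    have hN' : ray K f₁ g₁ r = N := by
      have h4 := pr r
      rw [hF, h2] at h4
      linarith
    have h5 : 0 < raySlope K f₁ g₁ r ^ 2 := by
      have := s₁ r
      have := p₁ r h0 h1
      rw [hN'] at *
      nlinarith [mul_pos hN0 this]
    obtain ⟨r', i1, i2, i3, i4, i5, i6⟩ :=
      exists_crossing_of_vertex (f₁ := f₂) (g₁ := g₂) (f₂ := f₁) (g₂ := g₁) hr h0 h1 hF h2 hN' hN0 hδ (by
        rcases lt_or_gt_of_ne ((sq_pos_iff).1 h5) with h6 | h6
        · refine Or.inl ⟨h6, lt_of_le_of_ne h1 ?_⟩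
          rintro rfl
          exact absurd h6 (not_lt.2 q₁)
        · refine Or.inr ⟨h6, lt_of_le_of_ne h0 ?_⟩
          rintro rfl
          rw [raySlope_zero] at h6 h2
          rcases hs with hs | hs <;> linarith)
    exact ⟨r', i1, i2, i4, i3, by rwa [mul_comm], by rwa [mdSum_comm]⟩
  · obtain ⟨r, h0, h1, h2⟩ := ivt (fun r => raySlope K f₁ g₁ r * H₂ + raySlope K f₂ g₂ r * H₁)
      (by fun_prop) (by simpa using hL) (by positivity)
    have h2 : raySlope K f₁ g₁ r * H₂ = -(raySlope K f₂ g₂ r * H₁) := by linarith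
    have t₁ := s₁ r
    have t₂ := s₂ r
    have pr := pr r
    have u₁ := p₁ r h0 h1
    have u₂ := p₂ r h0 h1
    set F₁ := ray K f₁ g₁ r
    set F₂ := ray K f₂ g₂ r
    set G₁ := raySlope K f₁ g₁ r
    set G₂ := raySlope K f₂ g₂ r
    set A := F₁ * (2 + K * F₁) with hA
    set B := F₂ * (2 + K * F₂) with hB
    have hA' : A = G₁ ^ 2 - H₁ ^ 2 := by linarith
    have hB' : B = G₂ ^ 2 - H₂ ^ 2 := by linarith
    -- At the crossing the chords to the two points are antiparallel, with ratio H₂ / H₁.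
    have hG : G₂ = -(G₁ * (H₂ / H₁)) := by field_simp; linarith
    have hBA : B = A * (H₂ / H₁) ^ 2 := by rw [hB', hA', hG]; field_simp
    have hN' : N = F₁ + F₂ + K * F₁ * F₂ + A * (H₂ / H₁) := by
      rw [hN, ← pr, hA', hG]; field_simp; ring
    have hH : 0 < H₂ / H₁ := div_pos hH₂ hH₁
    -- Otherwise F₁ and F₂ are nonpositive, and 2 (F₁ + F₂ + K F₁ F₂) = F₁ (2 + K F₂) + F₂ (2 + K
    -- F₁) would make N ≤ 0.
    have hA0 : 0 < A := by
      by_contra hn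
      have hA0 := not_lt.1 hn
      have hB0 : B ≤ 0 := by rw [hBA]; exact mul_nonpos_of_nonpos_of_nonneg hA0 (sq_nonneg _)
      have v₁ : F₁ ≤ 0 := by
        by_contra h
        exact absurd (mul_pos (not_le.1 h) u₁) hn
      have v₂ : F₂ ≤ 0 := by
        by_contra h
        exact absurd (mul_pos (not_le.1 h) u₂) (not_lt.2 hB0)
      have w1 := mul_nonpos_of_nonpos_of_nonneg v₁ u₂.le
      have w2 := mul_nonpos_of_nonpos_of_nonneg v₂ u₁.le
      have w3 := mul_nonpos_of_nonpos_of_nonneg hA0 hH.le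
      nlinarith
    have hB0 : 0 < B := by rw [hBA]; positivity
    have hG1 : 0 < G₁ ^ 2 := by nlinarith
    refine ⟨r, h0, h1, pos_of_mul_pos_left hA0 u₁.le, pos_of_mul_pos_left hB0 u₂.le, ?_, ?_⟩
    · change G₁ * G₂ < 0
      rw [hG]
      have := mul_pos hG1 hH
      linarith
    · unfold mdSum
      rw [← hA, ← hB, hBA, Real.sqrt_mul hA0.le, Real.sqrt_sq hH.le, ← mul_assoc,
        Real.mul_self_sqrt hA0.le]
      linarith

/-- Straightening a corner: `A`, `B` are future-directed vectors of the Minkowski plane with norms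
`nA`, `nB`, and the time components are changed by `-m'` and `m`. -/
theorem corner_le {A₀ A₁ B₀ B₁ m m' nA nB nX nY : ℝ} (hA1 : 0 ≤ A₁) (hB1 : 0 ≤ B₁)
    (hY : A₁ ≤ A₀ - m') (hm : 0 ≤ m) (hm' : 0 ≤ m')
    (hL : A₀ * B₁ ≤ B₀ * A₁) (hnA : 0 ≤ nA) (hnB : 0 ≤ nB) (hnX : 0 ≤ nX)
    (eA : nA ^ 2 = A₀ ^ 2 - A₁ ^ 2) (eB : nB ^ 2 = B₀ ^ 2 - B₁ ^ 2)
    (eX : nX ^ 2 = (B₀ + m) ^ 2 - B₁ ^ 2) (eY : nY ^ 2 = (A₀ - m') ^ 2 - A₁ ^ 2) :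
    A₀ * B₀ - A₁ * B₁ - nA * nB ≤ (A₀ - m') * (B₀ + m) - A₁ * B₁ - nX * nY := by
  have hA0 : A₁ ≤ A₀ := by linarith
  have a1 : nA ≤ A₀ := abs_le_of_sq_le_sq' (by nlinarith) (by linarith) |>.2
  have a2 : nA * B₀ ≤ A₀ * nB := by
    refine abs_le_of_sq_le_sq' ?_ (mul_nonneg (by linarith) hnB) |>.2
    rw [mul_pow, mul_pow, eA, eB]
    have : (A₀ * B₁) ^ 2 ≤ (B₀ * A₁) ^ 2 :=
      pow_le_pow_left₀ (mul_nonneg (by linarith) hB1) hL 2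
    linarith
  -- The comparison passes through A₀ (B₀ + m) - nA nX: this step lengthens B by m, the next one
  -- shortens A by m'.
  have s1 : nA * nX ≤ nA * nB + m * A₀ := by
    refine abs_le_of_sq_le_sq' ?_ (by
      have := mul_nonneg hnA hnB
      have := mul_nonneg hm (show 0 ≤ A₀ by linarith)
      linarith) |>.2
    have h1 := mul_le_mul_of_nonneg_left a2 (mul_nonneg hm hnA)
    have h2 := mul_le_mul_of_nonneg_left (pow_le_pow_left₀ hnA a1 2) (sq_nonneg m)
    have h3 : (nA * nX) ^ 2 = nA ^ 2 * (nB ^ 2 + 2 * m * B₀ + m ^ 2) := by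
      rw [mul_pow, eX, eB]; ring
    nlinarith
  -- When nA = 0 the vector A is null, A₀ = A₁, and no room is left for m'.
  have s2 : m' * (B₀ + m) + nX * nY ≤ nA * nX := by
    rcases hnA.eq_or_lt with h | h
    · rw [← h] at eA
      have e : A₀ = A₁ := by nlinarith
      have e' : m' = 0 := by linarith
      subst e'
      rw [e, sub_zero, sub_self] at eY
      have : nY = 0 := by simpa using eY
      rw [this, ← h]; simp
    · have a3 : nA * (B₀ + m) ≤ nX * A₀ := by
        refine abs_le_of_sq_le_sq' ?_ (mul_nonneg hnX (by linarith)) |>.2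
        rw [mul_pow, mul_pow, eA, eX]
        have : (A₀ * B₁) ^ 2 ≤ ((B₀ + m) * A₁) ^ 2 :=
          pow_le_pow_left₀ (mul_nonneg (by linarith) hB1) (by nlinarith) 2
        linarith
      have a4 : nA * nY ≤ A₀ * (A₀ - m') - A₁ * A₁ :=
        reverse_cauchy_schwarz (by rwa [abs_of_nonneg hA1]) (by rwa [abs_of_nonneg hA1]) eA eY
      refine le_of_mul_le_mul_left ?_ h
      have h1 := mul_le_mul_of_nonneg_left a3 hm'
      have h2 := mul_le_mul_of_nonneg_left a4 hnX
      nlinarith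
  nlinarith

end Crossing

/-! ### Sides of triangles: additivity of the time separation along realizers. -/

section Sides

variable {X : Type*} [EMetricSpace X] [LorentzianPreLengthSpace X] {U : Set X}

/-- `S ⊆ U` is the image of a curve from `u` to `v` along which `tau` is additive. -/
def IsSide (U : Set X) (u v : X) (S : Set X) : Prop :=
  S ⊆ U ∧ ∃ (γ : ℝ → X) (a b : ℝ), a ≤ b ∧ ContinuousOn γ (Icc a b) ∧ γ a = u ∧ γ b = v ∧
    γ '' Icc a b = S ∧ (∀ s t, a ≤ s → s ≤ t → t ≤ b → causal (γ s) (γ t)) ∧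
    ∀ r s t, a ≤ r → r ≤ s → s ≤ t → t ≤ b →
      tau (γ r) (γ s) + tau (γ s) (γ t) = tau (γ r) (γ t)

theorem TauFiniteContinuousOn.tau_self (hU : TauFiniteContinuousOn U) {x : X} (hx : x ∈ U) :
    tau x x = 0 := by
  have h := tau_reverse_triangle x x x (causal_refl x) (causal_refl x)
  have h' := hU.1 x hx x hx
  by_contra h0
  exact absurd h (not_le.2 (ENNReal.lt_add_right h' h0))

theorem tauLength_le {γ : ℝ → X} {a b : ℝ} {n : ℕ} (t : Fin (n + 2) → ℝ) (ht : StrictMono t)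
    (h0 : t 0 = a) (h1 : t (Fin.last (n + 1)) = b) :
    tauLength γ a b ≤ ∑ i : Fin (n + 1), tau (γ (t i.castSucc)) (γ (t i.succ)) :=
  iInf_le_of_le n (iInf_le_of_le t (iInf_le_of_le ⟨ht, h0, h1⟩ le_rfl))

theorem IsRealizer.causal_of_le {γ : ℝ → X} {a b : ℝ} {x y : X} (h : IsRealizer γ a b x y)
    {s t : ℝ} (hs : a ≤ s) (hst : s ≤ t) (ht : t ≤ b) : causal (γ s) (γ t) := by
  rcases hst.eq_or_lt with rfl | hlt
  · exact causal_refl _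
  · exact h.2.1.2 s ⟨hs, hst.trans ht⟩ t ⟨hs.trans hst, ht⟩ hlt

/-- The partition through r, s, t bounds the length. Partitions are strictly increasing, so
coincidences with a or b are treated separately, using that τ vanishes on the diagonal. -/
theorem IsRealizer.tau_le (hU : TauFiniteContinuousOn U) {γ : ℝ → X} {a b : ℝ} {x y : X}
    (h : IsRealizer γ a b x y) (hγ : γ '' Icc a b ⊆ U) {r s t : ℝ} (har : a ≤ r) (hrs : r < s)
    (hst : s < t) (htb : t ≤ b) :
    tau x y ≤ tau (γ a) (γ r) + tau (γ r) (γ s) + tau (γ s) (γ t) + tau (γ t) (γ b) := by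
  have self : ∀ u ∈ Icc a b, tau (γ u) (γ u) = 0 := fun u hu =>
    hU.tau_self (hγ (mem_image_of_mem γ hu))
  rw [← h.2.2.2.2]
  rcases har.eq_or_lt with rfl | har <;> rcases htb.eq_or_lt with rfl | htb
  · refine (tauLength_le (n := 1) ![a, s, t] ?_ rfl rfl).trans (le_of_eq ?_)
    · rw [Fin.strictMono_iff_lt_succ]
      intro i
      fin_cases i <;> simpa
    · rw [self a ⟨le_rfl, by linarith⟩, self t ⟨by linarith, le_rfl⟩]
      simp [Fin.sum_univ_succ]
  · refine (tauLength_le (n := 2) ![a, s, t, b] ?_ rfl rfl).trans (le_of_eq ?_)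
    · rw [Fin.strictMono_iff_lt_succ]
      intro i
      fin_cases i <;> simpa
    · rw [self a ⟨le_rfl, by linarith⟩]
      simp [Fin.sum_univ_succ, add_assoc]
  · refine (tauLength_le (n := 2) ![a, r, s, t] ?_ rfl rfl).trans (le_of_eq ?_)
    · rw [Fin.strictMono_iff_lt_succ]
      intro i
      fin_cases i <;> simpa
    · rw [self t ⟨by linarith, le_rfl⟩]
      simp [Fin.sum_univ_succ, add_assoc]
  · refine (tauLength_le (n := 3) ![a, r, s, t, b] ?_ rfl rfl).trans (le_of_eq ?_)
    · rw [Fin.strictMono_iff_lt_succ]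
      intro i
      fin_cases i <;> simpa
    · simp [Fin.sum_univ_succ, add_assoc]

/-- The reverse triangle inequality gives one direction. For the other, the partition sum bounds
τ(x, y), which itself dominates the sum over the coarser partition omitting s; the finite outer
terms then cancel. -/
theorem IsRealizer.tau_add (hU : TauFiniteContinuousOn U) {γ : ℝ → X} {a b : ℝ} {x y : X}
    (h : IsRealizer γ a b x y) (hγ : γ '' Icc a b ⊆ U) {r s t : ℝ} (har : a ≤ r) (hrs : r ≤ s)
    (hst : s ≤ t) (htb : t ≤ b) : tau (γ r) (γ s) + tau (γ s) (γ t) = tau (γ r) (γ t) := by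
  have mem : ∀ u ∈ Icc a b, γ u ∈ U := fun u hu => hγ (mem_image_of_mem γ hu)
  rcases hrs.eq_or_lt with rfl | hrs
  · rw [hU.tau_self (mem r ⟨har, by linarith⟩), zero_add]
  rcases hst.eq_or_lt with rfl | hst
  · rw [hU.tau_self (mem s ⟨by linarith, htb⟩), add_zero]
  refine le_antisymm (tau_reverse_triangle _ _ _ (h.causal_of_le har hrs.le (by linarith))
    (h.causal_of_le (by linarith) hst.le htb)) ?_
  have h1 := h.tau_le hU hγ har hrs hst htb
  have h2 := tau_reverse_triangle _ _ _ (h.causal_of_le le_rfl har (by linarith))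
    (h.causal_of_le har (by linarith : r ≤ t) htb)
  have h3 := tau_reverse_triangle _ _ _ (h.causal_of_le le_rfl (by linarith : a ≤ t) htb)
    (h.causal_of_le (by linarith) htb le_rfl)
  rw [← h.2.2.1, ← h.2.2.2.1] at h1
  have h4 := (add_le_add_left h2 (tau (γ t) (γ b))).trans (h3.trans h1)
  have f1 : tau (γ t) (γ b) ≠ ∞ := hU.1 _ (mem t ⟨by linarith, htb⟩) _ (mem b ⟨by linarith, le_rfl⟩)
  have f2 : tau (γ a) (γ r) ≠ ∞ := hU.1 _ (mem a ⟨le_rfl, by linarith⟩) _ (mem r ⟨har, by linarith⟩)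
  have h5 := (ENNReal.add_le_add_iff_right f1).1 h4
  rw [add_assoc (tau (γ a) (γ r))] at h5
  exact (ENNReal.add_le_add_iff_left f2).1 h5

theorem IsRealizer.isSide (hU : TauFiniteContinuousOn U) {γ : ℝ → X} {a b c d : ℝ} {x y : X}
    (h : IsRealizer γ a b x y) (hγ : γ '' Icc a b ⊆ U) (hac : a ≤ c) (hcd : c ≤ d) (hdb : d ≤ b) :
    IsSide U (γ c) (γ d) (γ '' Icc c d) :=
  ⟨(image_mono (Icc_subset_Icc hac hdb)).trans hγ, γ, c, d, hcd,
    h.2.1.1.continuousOn.mono (Icc_subset_Icc hac hdb), rfl, rfl, rfl,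
    fun _ _ h1 h2 h3 => h.causal_of_le (hac.trans h1) h2 (h3.trans hdb),
    fun _ _ _ h1 h2 h3 h4 => h.tau_add hU hγ (hac.trans h1) h2 h3 (h4.trans hdb)⟩

theorem IsSegment.isSide (hU : TauFiniteContinuousOn U) {u v : X} {S : Set X}
    (h : IsSegment U u v S) : IsSide U u v S := by
  obtain ⟨hS, γ, a, b, hγ, rfl⟩ := h
  have := hγ.isSide hU hS le_rfl hγ.1.le le_rfl
  rwa [hγ.2.2.1, hγ.2.2.2.1] at this

theorem IsSubdivision.isSide (hU : TauFiniteContinuousOn U) {x p y : X} {S S₁ S₂ : Set X}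
    (h : IsSubdivision x p y S S₁ S₂) (hS : S ⊆ U) :
    IsSide U x p S₁ ∧ IsSide U p y S₂ ∧ S = S₁ ∪ S₂ ∧ tau x p + tau p y = tau x y ∧
      ∀ a ∈ S₂, tau x p + tau p a = tau x a := by
  obtain ⟨γ, a, t, b, hγ, hat, htb, rfl, rfl, rfl, rfl⟩ := h
  have h1 := hγ.isSide hU hS le_rfl hat htb
  have h2 := hγ.isSide hU hS hat htb le_rfl
  rw [hγ.2.2.1] at h1
  rw [hγ.2.2.2.1] at h2
  refine ⟨h1, h2, ?_, ?_, ?_⟩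
  · rw [← image_union, Icc_union_Icc_eq_Icc hat htb]
  · have := hγ.tau_add hU hS le_rfl hat htb le_rfl
    rwa [hγ.2.2.1, hγ.2.2.2.1] at this
  · rintro _ ⟨s, hs, rfl⟩
    have := hγ.tau_add hU hS le_rfl hat hs.1 hs.2
    rwa [hγ.2.2.1] at this

namespace IsSide

variable {u v : X} {S : Set X}

theorem left_mem (h : IsSide U u v S) : u ∈ S := by
  obtain ⟨_, γ, a, b, hab, -, rfl, -, rfl, -⟩ := h
  exact mem_image_of_mem γ ⟨le_rfl, hab⟩

theorem right_mem (h : IsSide U u v S) : v ∈ S := by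
  obtain ⟨_, γ, a, b, hab, -, -, rfl, rfl, -⟩ := h
  exact mem_image_of_mem γ ⟨hab, le_rfl⟩

theorem causal_left (h : IsSide U u v S) {a : X} (ha : a ∈ S) : causal u a := by
  obtain ⟨_, γ, c, d, hcd, -, rfl, -, rfl, hc, -⟩ := h
  obtain ⟨s, hs, rfl⟩ := ha
  exact hc c s le_rfl hs.1 hs.2

theorem causal_right (h : IsSide U u v S) {a : X} (ha : a ∈ S) : causal a v := by
  obtain ⟨_, γ, c, d, hcd, -, -, rfl, rfl, hc, -⟩ := h
  obtain ⟨s, hs, rfl⟩ := ha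
  exact hc s d hs.1 hs.2 le_rfl

theorem tau_add (h : IsSide U u v S) {a : X} (ha : a ∈ S) : tau u a + tau a v = tau u v := by
  obtain ⟨_, γ, c, d, hcd, -, rfl, rfl, rfl, -, hc⟩ := h
  obtain ⟨s, hs, rfl⟩ := ha
  exact hc c s d le_rfl hs.1 hs.2 le_rfl

theorem tau_add_or (h : IsSide U u v S) {a b : X} (ha : a ∈ S) (hb : b ∈ S) :
    tau u a + tau a b = tau u b ∨ tau u b + tau b a = tau u a := by
  obtain ⟨_, γ, c, d, hcd, -, rfl, rfl, rfl, -, hc⟩ := h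
  obtain ⟨s, hs, rfl⟩ := ha
  obtain ⟨t, ht, rfl⟩ := hb
  rcases le_total s t with hst | hst
  · exact Or.inl (hc c s t le_rfl hs.1 hst ht.2)
  · exact Or.inr (hc c t s le_rfl ht.1 hst hs.2)

/-- Continuity of τ on U is what realizes an axis parameter found in the model by an actual point of
the side. -/
theorem exists_toReal_tau_eq (hU : TauFiniteContinuousOn U) (h : IsSide U u v S) {r : ℝ}
    (h0 : 0 ≤ r) (hr : r ≤ (tau u v).toReal) : ∃ q ∈ S, (tau u q).toReal = r := by
  have hu := h.1 h.left_mem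
  obtain ⟨hS, γ, c, d, hcd, hγ, rfl, rfl, rfl, -, -⟩ := h
  have hm : ∀ s ∈ Icc c d, γ s ∈ U := fun s hs => hS (mem_image_of_mem γ hs)
  have h1 : ContinuousOn (fun s => tau (γ c) (γ s)) (Icc c d) :=
    hU.2.comp (f := fun s => (γ c, γ s)) (continuousOn_const.prodMk hγ) fun s hs => ⟨hu, hm s hs⟩
  have h2 : ContinuousOn (fun s => (tau (γ c) (γ s)).toReal) (Icc c d) :=
    ENNReal.continuousOn_toReal.comp h1 fun s hs => hU.1 _ hu _ (hm s hs)
  obtain ⟨s, hs, hs'⟩ := intermediate_value_Icc hcd h2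
    ⟨by simpa [hU.tau_self hu] using h0, hr⟩
  exact ⟨γ s, mem_image_of_mem γ hs, hs'⟩

end IsSide

end Sides

/-! ### No two points of a model triangle are antipodal. -/

section ModelTriangle

variable {K : ℝ}

/-- A timelike geodesic triangle of `M_K` with side lengths `L₁`, `L₂`, `L₃`. -/
structure IsModelTriangle (K L₁ L₂ L₃ : ℝ) (x y z : ℝ × ℝ) : Prop where
  pos₁ : 0 < L₁
  pos₂ : 0 < L₂
  add_le : L₁ + L₂ ≤ L₃
  inRange : InRange K L₃
  rel₁ : Rel K x y
  rel₂ : Rel K y z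
  rel₃ : Rel K x z
  world₁ : world K x y = md K L₁
  world₂ : world K y z = md K L₂
  world₃ : world K x z = md K L₃

/-- `a` lies on one of the sides of the model triangle `x, y, z`. -/
def IsOnTriangle (K L₁ L₂ L₃ : ℝ) (x y z a : ℝ × ℝ) : Prop :=
  (∃ t, 0 ≤ t ∧ t ≤ L₁ ∧ IsOnSegment K x y L₁ t a) ∨
  (∃ t, 0 ≤ t ∧ t ≤ L₂ ∧ IsOnSegment K y z L₂ t a) ∨
    ∃ t, 0 ≤ t ∧ t ≤ L₃ ∧ IsOnSegment K x z L₃ t a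

theorem Rel.of_neg {a b : ℝ × ℝ} (hK : K < 0) (h : a.1 ≤ b.1) (h' : b.1 - a.1 ≤ Real.pi)
    (h0 : 0 ≤ world K a b) (h2 : 0 ≤ 2 + K * world K a b) : Rel K a b := by
  refine rel_of_modelCausal (Or.inr (Or.inr ⟨hK, h, fun _ => ?_⟩)) (fun _ => h') h2
  unfold world at h0
  rw [if_neg hK.not_gt, if_neg hK.ne] at h0
  rw [← sub_nonpos, ← div_mul_cancel₀ (adSProd a b - 1) hK.ne]
  exact mul_nonpos_of_nonneg_of_nonpos h0 hK.le

namespace IsModelTriangle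

variable {L₁ L₂ L₃ : ℝ} {x y z a b : ℝ × ℝ}

theorem inRange₁ (h : IsModelTriangle K L₁ L₂ L₃ x y z) : InRange K L₁ :=
  h.inRange.mono (by linarith [h.add_le, h.pos₂])

theorem inRange₂ (h : IsModelTriangle K L₁ L₂ L₃ x y z) : InRange K L₂ :=
  h.inRange.mono (by linarith [h.add_le, h.pos₁])

theorem pos₃ (h : IsModelTriangle K L₁ L₂ L₃ x y z) : 0 < L₃ := by
  linarith [h.add_le, h.pos₁, h.pos₂]

/-- On the side [y, z] the distance from x is bounded below through y and above through z, hence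
stays within [0, L₃]. -/
theorem rel_apex (h : IsModelTriangle K L₁ L₂ L₃ x y z) (hK : K < 0)
    (ha : IsOnTriangle K L₁ L₂ L₃ x y z a) :
    Rel K x a ∧ ∃ s, 0 ≤ s ∧ s ≤ L₃ ∧ world K x a = md K s := by
  rcases ha with ⟨t, h0, h1, h2⟩ | ⟨t, h0, h1, h2⟩ | ⟨t, h0, h1, h2⟩
  · exact ⟨h2.rel_left, t, h0, by linarith [h.add_le, h.pos₂], h2.world_left⟩
  · have r1 : InRange K (L₂ - t) := h.inRange₂.mono (by linarith)
    have w1 := md_add_le_world h.rel₁ h2.rel_left h.world₁ h2.world_left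
    have w2 := world_le_md_sub_past h.rel₃ h2.rel_right h.world₃ h2.world_right
    have r2 : InRange K (L₁ + t) := h.inRange.mono (by linarith [h.add_le])
    have r3 : InRange K (L₃ - (L₂ - t)) := h.inRange.mono (by linarith)
    have p0 : 0 ≤ world K x a := (md_nonneg (by linarith [h.pos₁]) r2).trans w1
    have p1 : 0 < 2 + K * world K x a := by
      have := two_add_mul_md_pos (K := K) (t := L₃ - (L₂ - t))
        (by rwa [abs_of_nonneg (by linarith [h.add_le, h.pos₁])])
      nlinarith
    have hR : Rel K x a := Rel.of_neg hK (h.rel₁.1.fst_le.trans h2.rel_left.1.fst_le)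
      (by linarith [h2.rel_right.1.fst_le, (h.rel₃.2 hK).1]) p0 p1.le
    obtain ⟨s, s0, s1, s2⟩ := hR.exists_md_eq
    refine ⟨hR, s, s0, ?_, s2⟩
    rw [s2] at w2
    linarith [le_of_md_le (by linarith [h.add_le, h.pos₁]) s1 w2]
  · exact ⟨h2.rel_left, t, h0, h1, h2.world_left⟩

/-- By Stewart's theorem 1 + K `world` is linear along a segment with nonnegative weights: the
constant term is absorbed by `coef_add`. -/
theorem one_add_nonneg {u v o : ℝ × ℝ} {L t : ℝ} (hL : 0 < L) (hr : InRange K L)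
    (huv : world K u v = md K L) (h0 : 0 ≤ t) (h1 : t ≤ L) (h : IsOnSegment K u v L t a)
    (hu : 0 ≤ 1 + K * world K u o) (hv : 0 ≤ 1 + K * world K v o) :
    0 ≤ 1 + K * world K a o := by
  have hs := (sn_pos hL hr).ne'
  have e := coef_add (K := K) (t := t) hs
  rw [h.world_eq huv hs]
  have : 1 + K * (lCoef K L t * world K u o + rCoef K L t * world K v o - cCoef K L t)
      = lCoef K L t * (1 + K * world K u o) + rCoef K L t * (1 + K * world K v o) := by
    linear_combination -e
  rw [this]
  exact add_nonneg (mul_nonneg (lCoef_nonneg hr h0 h1) hu) (mul_nonneg (rCoef_nonneg hr h0 h1) hv)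

theorem one_add_nonneg_of_vertices (h : IsModelTriangle K L₁ L₂ L₃ x y z)
    {o : ℝ × ℝ} (hx : 0 ≤ 1 + K * world K x o) (hy : 0 ≤ 1 + K * world K y o)
    (hz : 0 ≤ 1 + K * world K z o) (ha : IsOnTriangle K L₁ L₂ L₃ x y z a) :
    0 ≤ 1 + K * world K a o := by
  rcases ha with ⟨t, h0, h1, h2⟩ | ⟨t, h0, h1, h2⟩ | ⟨t, h0, h1, h2⟩
  · exact one_add_nonneg h.pos₁ h.inRange₁ h.world₁ h0 h1 h2 hx hy
  · exact one_add_nonneg h.pos₂ h.inRange₂ h.world₂ h0 h1 h2 hy hz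
  · exact one_add_nonneg h.pos₃ h.inRange h.world₃ h0 h1 h2 hx hz

/-- For K < 0, both points lie in the future of x at distances s, t ≤ L₃, so `world` is at most `md`
at s - t, which is in range. For K ≥ 0, even 1 + K `world` is nonnegative, and this is reduced to
pairs of vertices. -/
theorem two_add_pos (h : IsModelTriangle K L₁ L₂ L₃ x y z)
    (ha : IsOnTriangle K L₁ L₂ L₃ x y z a) (hb : IsOnTriangle K L₁ L₂ L₃ x y z b) :
    0 < 2 + K * world K a b := by
  rcases lt_or_ge K 0 with hK | hK
  · obtain ⟨r1, s, s0, s1, s2⟩ := h.rel_apex hK ha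
    obtain ⟨r2, t, t0, t1, t2⟩ := h.rel_apex hK hb
    have w := world_le_md_sub_future r1 r2 s2 t2
    have := two_add_mul_md_pos (K := K) (t := s - t)
      (h.inRange.mono (abs_le.2 ⟨by linarith, by linarith⟩))
    nlinarith
  · have m1 : 0 ≤ K * md K L₁ := mul_nonneg hK (md_nonneg h.pos₁.le h.inRange₁)
    have m2 : 0 ≤ K * md K L₂ := mul_nonneg hK (md_nonneg h.pos₂.le h.inRange₂)
    have m3 : 0 ≤ K * md K L₃ := mul_nonneg hK (md_nonneg h.pos₃.le h.inRange)
    have e0 : ∀ o, 0 ≤ 1 + K * world K o o := fun o => by rw [world_self]; norm_num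
    have e1 : 0 ≤ 1 + K * world K x y := by rw [h.world₁]; linarith
    have e2 : 0 ≤ 1 + K * world K y z := by rw [h.world₂]; linarith
    have e3 : 0 ≤ 1 + K * world K x z := by rw [h.world₃]; linarith
    have e1' := e1
    have e2' := e2
    have e3' := e3
    rw [world_comm] at e1' e2' e3'
    have vx := h.one_add_nonneg_of_vertices (e0 x) e1' e3' hb
    have vy := h.one_add_nonneg_of_vertices e1 (e0 y) e2' hb
    have vz := h.one_add_nonneg_of_vertices e3 e2 (e0 z) hb
    rw [world_comm] at vx vy vz
    linarith [h.one_add_nonneg_of_vertices vx vy vz ha]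

end IsModelTriangle

end ModelTriangle

/-! ### Translation between triangles in X and numerical model triangles. -/

section Triangles

variable {X : Type*} [EMetricSpace X] [LorentzianPreLengthSpace X] {U : Set X} {K : ℝ}

/-- The time separation as a real number. -/
noncomputable def tauR (a b : X) : ℝ := (tau a b).toReal

theorem tauR_nonneg (a b : X) : 0 ≤ tauR a b := ENNReal.toReal_nonneg

theorem TauFiniteContinuousOn.ofReal_tauR (hU : TauFiniteContinuousOn U) {a b : X} (ha : a ∈ U)
    (hb : b ∈ U) : ENNReal.ofReal (tauR a b) = tau a b := ENNReal.ofReal_toReal (hU.1 a ha b hb)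

theorem chron_of_tauR_pos {a b : X} (h : 0 < tauR a b) : chron a b :=
  (tau_pos_iff a b).1 (ENNReal.toReal_pos_iff.1 h).1

theorem TauFiniteContinuousOn.tauR_pos (hU : TauFiniteContinuousOn U) {a b : X} (ha : a ∈ U)
    (hb : b ∈ U) (h : chron a b) : 0 < tauR a b :=
  ENNReal.toReal_pos ((tau_pos_iff a b).2 h).ne' (hU.1 a ha b hb)

theorem TauFiniteContinuousOn.tauR_add_le (hU : TauFiniteContinuousOn U) {a b c : X} (ha : a ∈ U)
    (hb : b ∈ U) (hc : c ∈ U) (hab : causal a b) (hbc : causal b c) :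
    tauR a b + tauR b c ≤ tauR a c := by
  unfold tauR
  rw [← ENNReal.toReal_add (hU.1 a ha b hb) (hU.1 b hb c hc)]
  exact ENNReal.toReal_mono (hU.1 a ha c hc) (tau_reverse_triangle a b c hab hbc)

theorem TauFiniteContinuousOn.tauR_le (hU : TauFiniteContinuousOn U) {x a b z : X} (hx : x ∈ U)
    (ha : a ∈ U) (hb : b ∈ U) (hz : z ∈ U) (hxa : causal x a) (hbz : causal b z) :
    tauR a b ≤ tauR x z := by
  rcases (tauR_nonneg a b).eq_or_lt with h | h
  · rw [← h]; exact tauR_nonneg _ _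
  · have hab := causal_of_chron a b (chron_of_tauR_pos h)
    have h1 := hU.tauR_add_le hx ha hb hxa hab
    have h2 := hU.tauR_add_le hx hb hz (causal_trans _ _ _ hxa hab) hbz
    linarith [tauR_nonneg x a, tauR_nonneg b z]

theorem IsSide.tauR_add (hU : TauFiniteContinuousOn U) {u v a : X} {S : Set X}
    (h : IsSide U u v S) (ha : a ∈ S) : tauR u a + tauR a v = tauR u v := by
  have hu := h.1 h.left_mem
  have hv := h.1 h.right_mem
  have ha' := h.1 ha
  unfold tauR
  rw [← ENNReal.toReal_add (hU.1 u hu a ha') (hU.1 a ha' v hv), h.tau_add ha]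

theorem IsSide.tauR_le (hU : TauFiniteContinuousOn U) {u v a : X} {S : Set X}
    (h : IsSide U u v S) (ha : a ∈ S) : tauR u a ≤ tauR u v := by
  linarith [h.tauR_add hU ha, tauR_nonneg a v]

theorem IsSide.correspondsOnSide (hU : TauFiniteContinuousOn U) {u v a : X} {S : Set X}
    (h : IsSide U u v S) (hr : InRange K (tauR u v)) {u' v' a' : ℝ × ℝ} (huv : Rel K u' v')
    (hw : world K u' v' = md K (tauR u v)) (ha : a ∈ S)
    (ha' : IsOnSegment K u' v' (tauR u v) (tauR u a) a') :
    CorrespondsOnSide K u S u' v' a a' := by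
  have h1 := h.tauR_le hU ha
  have h2 := tauR_nonneg u a
  have e1 := modelTau_eq_ofReal ha'.rel_left h2 (fun hK => (hr.mono h1 hK).le) ha'.world_left
  have e2 := modelTau_eq_ofReal ha'.rel_right (sub_nonneg.2 h1)
    (fun hK => (hr.mono (sub_le_self _ h2) hK).le) ha'.world_right
  have e3 := modelTau_eq_ofReal huv (h2.trans h1) (fun hK => (hr hK).le) hw
  refine ⟨ha, ⟨ha'.rel_left.1, ha'.rel_right.1, ?_⟩, ?_⟩
  · rw [e1, e2, e3, ← ENNReal.ofReal_add h2 (sub_nonneg.2 h1), add_sub_cancel]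
  · rw [e1, hU.ofReal_tauR (h.1 h.left_mem) (h.1 ha)]

/-- Additivity on the side and on the model segment, with finite terms cancelled, determines the
distance to the far end as well. -/
theorem IsSide.isOnSegment (hU : TauFiniteContinuousOn U) {u v a : X} {S : Set X}
    (h : IsSide U u v S) {u' v' a' : ℝ × ℝ} (hw : modelTau K u' v' = tau u v)
    (ha : CorrespondsOnSide K u S u' v' a a') :
    IsOnSegment K u' v' (tauR u v) (tauR u a) a' := by
  obtain ⟨haS, ⟨c1, c2, c3⟩, c4⟩ := ha
  have hu := h.1 h.left_mem
  have hv := h.1 h.right_mem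
  have haU := h.1 haS
  have f0 := hU.1 u hu a haU
  have h1 := h.tauR_add hU haS
  have c5 : modelTau K a' v' = tau a v := by
    rw [c4, hw, ← h.tau_add haS] at c3
    exact (ENNReal.add_right_inj f0).1 c3
  have r1 : Rel K u' a' := rel_of_modelCausal_of_ne_top c1 (by rwa [c4])
  have r2 : Rel K a' v' := rel_of_modelCausal_of_ne_top c2 (by rw [c5]; exact hU.1 a haU v hv)
  refine ⟨r1, r2, world_eq_md_of_modelTau r1 (tauR_nonneg _ _) ?_,
    world_eq_md_of_modelTau r2 (by linarith [tauR_nonneg a v]) ?_⟩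
  · rw [c4, hU.ofReal_tauR hu haU]
  · rw [c5, ← h1, add_sub_cancel_left, hU.ofReal_tauR haU hv]

/-- A timelike triangle with additive sides satisfying the size bound. -/
structure IsTriangle (U : Set X) (K : ℝ) (x y z : X) (sxy syz sxz : Set X) : Prop where
  finite : TauFiniteContinuousOn U
  chron₁ : chron x y
  chron₂ : chron y z
  side₁ : IsSide U x y sxy
  side₂ : IsSide U y z syz
  side₃ : IsSide U x z sxz
  inRange : InRange K (tauR x z)

namespace IsTriangle

variable {x y z : X} {sxy syz sxz : Set X} {x' y' z' a' : ℝ × ℝ} {a : X}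

theorem mem_x (h : IsTriangle U K x y z sxy syz sxz) : x ∈ U := h.side₁.1 h.side₁.left_mem

theorem mem_y (h : IsTriangle U K x y z sxy syz sxz) : y ∈ U := h.side₁.1 h.side₁.right_mem

theorem mem_z (h : IsTriangle U K x y z sxy syz sxz) : z ∈ U := h.side₂.1 h.side₂.right_mem

theorem pos₁ (h : IsTriangle U K x y z sxy syz sxz) : 0 < tauR x y :=
  h.finite.tauR_pos h.mem_x h.mem_y h.chron₁

theorem pos₂ (h : IsTriangle U K x y z sxy syz sxz) : 0 < tauR y z :=
  h.finite.tauR_pos h.mem_y h.mem_z h.chron₂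

theorem add_le (h : IsTriangle U K x y z sxy syz sxz) : tauR x y + tauR y z ≤ tauR x z :=
  h.finite.tauR_add_le h.mem_x h.mem_y h.mem_z (causal_of_chron _ _ h.chron₁)
    (causal_of_chron _ _ h.chron₂)

theorem pos₃ (h : IsTriangle U K x y z sxy syz sxz) : 0 < tauR x z := by
  linarith [h.pos₁, h.pos₂, h.add_le]

/-- `a'` is a point of the model triangle corresponding to the point `a` of the triangle. -/
def Matches (_ : IsTriangle U K x y z sxy syz sxz) (x' y' z' : ℝ × ℝ) (a : X) (a' : ℝ × ℝ) :
    Prop :=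
  (a ∈ sxy ∧ IsOnSegment K x' y' (tauR x y) (tauR x a) a') ∨
  (a ∈ syz ∧ IsOnSegment K y' z' (tauR y z) (tauR y a) a') ∨
    (a ∈ sxz ∧ IsOnSegment K x' z' (tauR x z) (tauR x a) a')

theorem Matches.isOnTriangle {h : IsTriangle U K x y z sxy syz sxz}
    (ha : h.Matches x' y' z' a a') :
    IsOnTriangle K (tauR x y) (tauR y z) (tauR x z) x' y' z' a' := by
  rcases ha with ⟨ha, ha'⟩ | ⟨ha, ha'⟩ | ⟨ha, ha'⟩
  · exact Or.inl ⟨_, tauR_nonneg _ _, h.side₁.tauR_le h.finite ha, ha'⟩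
  · exact Or.inr (Or.inl ⟨_, tauR_nonneg _ _, h.side₂.tauR_le h.finite ha, ha'⟩)
  · exact Or.inr (Or.inr ⟨_, tauR_nonneg _ _, h.side₃.tauR_le h.finite ha, ha'⟩)

theorem Matches.causal_left {h : IsTriangle U K x y z sxy syz sxz}
    (ha : h.Matches x' y' z' a a') : causal x a := by
  rcases ha with ⟨ha, -⟩ | ⟨ha, -⟩ | ⟨ha, -⟩
  · exact h.side₁.causal_left ha
  · exact causal_trans _ _ _ (causal_of_chron _ _ h.chron₁) (h.side₂.causal_left ha)
  · exact h.side₃.causal_left ha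

theorem Matches.causal_right {h : IsTriangle U K x y z sxy syz sxz}
    (ha : h.Matches x' y' z' a a') : causal a z := by
  rcases ha with ⟨ha, -⟩ | ⟨ha, -⟩ | ⟨ha, -⟩
  · exact causal_trans _ _ _ (h.side₁.causal_right ha) (causal_of_chron _ _ h.chron₂)
  · exact h.side₂.causal_right ha
  · exact h.side₃.causal_right ha

theorem Matches.mem {h : IsTriangle U K x y z sxy syz sxz}
    (ha : h.Matches x' y' z' a a') : a ∈ U := by
  rcases ha with ⟨ha, -⟩ | ⟨ha, -⟩ | ⟨ha, -⟩
  · exact h.side₁.1 ha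
  · exact h.side₂.1 ha
  · exact h.side₃.1 ha

theorem isComparisonTriangle (h : IsTriangle U K x y z sxy syz sxz)
    (hm : IsModelTriangle K (tauR x y) (tauR y z) (tauR x z) x' y' z') :
    IsComparisonTriangle K x y z x' y' z' := by
  refine ⟨?_, ?_, ?_⟩
  · rw [modelTau_eq_ofReal hm.rel₁ hm.pos₁.le (fun hK => (hm.inRange₁ hK).le) hm.world₁,
      h.finite.ofReal_tauR h.mem_x h.mem_y]
  · rw [modelTau_eq_ofReal hm.rel₂ hm.pos₂.le (fun hK => (hm.inRange₂ hK).le) hm.world₂,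
      h.finite.ofReal_tauR h.mem_y h.mem_z]
  · rw [modelTau_eq_ofReal hm.rel₃ hm.pos₃.le (fun hK => (hm.inRange hK).le) hm.world₃,
      h.finite.ofReal_tauR h.mem_x h.mem_z]

theorem isModelTriangle (h : IsTriangle U K x y z sxy syz sxz)
    (hc : IsComparisonTriangle K x y z x' y' z') :
    IsModelTriangle K (tauR x y) (tauR y z) (tauR x z) x' y' z' := by
  have key : ∀ {u v : X} {u' v' : ℝ × ℝ}, u ∈ U → v ∈ U → 0 < tauR u v →
      modelTau K u' v' = tau u v → Rel K u' v' ∧ world K u' v' = md K (tauR u v) := by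
    intro u v u' v' hu hv hpos hm
    have hR : Rel K u' v' := rel_of_modelCausal_of_ne_top
      (modelCausal_of_modelTau_ne_zero
        (by rw [hm]; exact (ENNReal.toReal_pos_iff.1 hpos).1.ne'))
      (by rw [hm]; exact h.finite.1 u hu v hv)
    exact ⟨hR, world_eq_md_of_modelTau hR hpos.le (by rw [hm, h.finite.ofReal_tauR hu hv])⟩
  have h1 := key h.mem_x h.mem_y h.pos₁ hc.1
  have h2 := key h.mem_y h.mem_z h.pos₂ hc.2.1
  have h3 := key h.mem_x h.mem_z h.pos₃ hc.2.2
  exact ⟨h.pos₁, h.pos₂, h.add_le, h.inRange, h1.1, h2.1, h3.1, h1.2, h2.2, h3.2⟩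

theorem Matches.isComparisonPoint {h : IsTriangle U K x y z sxy syz sxz}
    (ha : h.Matches x' y' z' a a')
    (hm : IsModelTriangle K (tauR x y) (tauR y z) (tauR x z) x' y' z') :
    IsComparisonPoint K x y sxy syz sxz x' y' z' a a' := by
  rcases ha with ⟨ha, ha'⟩ | ⟨ha, ha'⟩ | ⟨ha, ha'⟩
  · exact Or.inl (h.side₁.correspondsOnSide h.finite hm.inRange₁ hm.rel₁ hm.world₁ ha ha')
  · exact Or.inr (Or.inl
      (h.side₂.correspondsOnSide h.finite hm.inRange₂ hm.rel₂ hm.world₂ ha ha'))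
  · exact Or.inr (Or.inr
      (h.side₃.correspondsOnSide h.finite hm.inRange hm.rel₃ hm.world₃ ha ha'))

theorem matches_of_isComparisonPoint (h : IsTriangle U K x y z sxy syz sxz)
    (hc : IsComparisonTriangle K x y z x' y' z')
    (ha : IsComparisonPoint K x y sxy syz sxz x' y' z' a a') : h.Matches x' y' z' a a' := by
  rcases ha with ha | ha | ha
  · exact Or.inl ⟨ha.1, h.side₁.isOnSegment h.finite hc.1 ha⟩
  · exact Or.inr (Or.inl ⟨ha.1, h.side₂.isOnSegment h.finite hc.2.1 ha⟩)
  · exact Or.inr (Or.inr ⟨ha.1, h.side₃.isOnSegment h.finite hc.2.2 ha⟩)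

end IsTriangle

/-- `F` is the modified distance of a length not exceeding `τ(a, b)`. -/
def MdLe (K F : ℝ) (a b : X) : Prop := ∃ l, 0 ≤ l ∧ md K l = F ∧ l ≤ tauR a b

theorem MdLe.le {F : ℝ} {a b : X} (h : MdLe K F a b) (hr : InRange K (tauR a b)) :
    F ≤ md K (tauR a b) := by
  obtain ⟨l, h0, rfl, h1⟩ := h
  exact md_le h0 h1 fun hK => (hr hK).le

theorem MdLe.tauR_pos {F : ℝ} {a b : X} (h : MdLe K F a b) (hF : 0 < F) : 0 < tauR a b := by
  obtain ⟨l, h0, rfl, h1⟩ := h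
  rcases h0.eq_or_lt with rfl | h0
  · simp at hF
  · linarith

namespace IsTriangle

variable {x y z : X} {sxy syz sxz : Set X} {x' y' z' a' b' : ℝ × ℝ} {a b : X}

/-- The form in which a curvature bound enters the estimates. -/
theorem mdLe (h : IsTriangle U K x y z sxy syz sxz) (hB : BoundAbove K x y z sxy syz sxz)
    (hm : IsModelTriangle K (tauR x y) (tauR y z) (tauR x z) x' y' z')
    (ha : h.Matches x' y' z' a a') (hb : h.Matches x' y' z' b b') (hR : Rel K a' b') :
    MdLe K (world K a' b') a b := by
  obtain ⟨l, h0, h1, h2⟩ := hR.exists_md_eq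
  have h3 := hB x' y' z' (h.isComparisonTriangle hm) a b a' b'
    (ha.isComparisonPoint hm) (hb.isComparisonPoint hm)
  rw [modelTau_eq_ofReal hR h0 h1 h2] at h3
  exact ⟨l, h0, h2.symm, (ENNReal.ofReal_le_iff_le_toReal (h.finite.1 a ha.mem b hb.mem)).1 h3⟩

theorem exists_model (h : IsTriangle U K x y z sxy syz sxz) :
    ∃ x' y' z' : ℝ × ℝ, Near K x' ∧ Near K y' ∧ Near K z' ∧
      IsModelTriangle K (tauR x y) (tauR y z) (tauR x z) x' y' z' := by
  obtain ⟨x', y', z', n1, n2, n3, r1, r2, r3, w1, w2, w3⟩ :=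
    exists_triangle h.pos₁ h.pos₂ h.add_le h.inRange
  exact ⟨x', y', z', n1, n2, n3, h.pos₁, h.pos₂, h.add_le, h.inRange, r1, r2, r3, w1, w2, w3⟩

end IsTriangle

end Triangles

/-! ### Numerical geometry of the glued and the straightened figure. -/

section Glue

variable {K : ℝ}

/-- Numerical data of two comparison triangles, with sides `a, d, c` and `b, e, d`, glued along the
side of length `d`. -/
structure Glue (K a b c d e gx gy Hx Hy : ℝ) : Prop where
  ha : 0 < a
  hb : 0 < b
  hd : 0 < d
  he : 0 < e
  hac : a + d ≤ c
  hbe : b + e ≤ d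
  hr : InRange K c
  egx : gx * sn K d = md K c - md K a - md K d - K * md K a * md K d
  egy : gy * sn K d = md K e - md K b - md K d - K * md K b * md K d
  Hx0 : 0 ≤ Hx
  Hy0 : 0 ≤ Hy
  Hx2 : Hx ^ 2 = gx ^ 2 - md K a * (2 + K * md K a)
  Hy2 : Hy ^ 2 = gy ^ 2 - md K b * (2 + K * md K b)

/-- The coordinates of an end point of the common side. -/
def IsAxisEnd (K d fe ge : ℝ) : Prop := (fe = 0 ∧ ge = 0) ∨ (fe = md K d ∧ ge = -sn K d)

/-- The coordinates `f`, `g` of a point between a vertex with coordinates `f₀`, `g₀` and an end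
point of the common side. -/
structure Combo (K d f₀ g₀ l m k fe ge f g : ℝ) : Prop where
  hl : 0 ≤ l
  hm : 0 ≤ m
  sum : l + m + K * k = 1
  quad : 2 * k - K * k ^ 2 = 2 * l * m * (f₀ + fe + K * f₀ * fe - g₀ * ge)
  axisEnd : IsAxisEnd K d fe ge
  hf : f = l * f₀ + m * fe - k
  hg : g = l * g₀ + m * ge

theorem raySlope_mul_sn (f g d : ℝ) : raySlope K f g d * sn K d =
    ray K f g d + md K d + K * ray K f g d * md K d - f := by
  unfold raySlope ray
  linear_combination (1 + K * f) * sn_sq (K := K) d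

theorem ray_eq_of_mul_sn {f g d w : ℝ} (h : g * sn K d = w - f - md K d - K * f * md K d) :
    ray K f g d = w := by
  unfold ray; linarith

namespace IsAxisEnd

variable {d fe ge : ℝ}

theorem nonpos (h : IsAxisEnd K d fe ge) (hd : 0 ≤ sn K d) : ge ≤ 0 := by
  rcases h with ⟨-, rfl⟩ | ⟨-, rfl⟩
  · rfl
  · linarith

theorem sq_eq (h : IsAxisEnd K d fe ge) : ge ^ 2 = fe * (2 + K * fe) := by
  rcases h with ⟨rfl, rfl⟩ | ⟨rfl, rfl⟩
  · simp
  · rw [neg_sq, sn_sq]; ring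

theorem raySlope_nonneg (h : IsAxisEnd K d fe ge) (hd : 0 ≤ sn K d) :
    0 ≤ raySlope K fe ge d := by
  rcases h with ⟨rfl, rfl⟩ | ⟨rfl, rfl⟩
  · simpa [raySlope] using hd
  · unfold raySlope
    exact le_of_eq (by ring)

end IsAxisEnd

namespace Combo

variable {d f₀ g₀ l m k fe ge f g : ℝ}

theorem raySlope_nonneg (h : Combo K d f₀ g₀ l m k fe ge f g) (hd : 0 ≤ sn K d)
    (h0 : 0 ≤ raySlope K f₀ g₀ d) : 0 ≤ raySlope K f g d := by
  have h1 := h.axisEnd.raySlope_nonneg hd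
  have : raySlope K f g d = l * raySlope K f₀ g₀ d + m * raySlope K fe ge d := by
    rw [h.hf, h.hg]
    unfold raySlope
    linear_combination -sn K d * h.sum
  rw [this]
  exact add_nonneg (mul_nonneg h.hl h0) (mul_nonneg h.hm h1)

/-- The bilinear expansion of the glued distance. -/
theorem pairing {f₀' g₀' l' m' k' fe' ge' f' g' : ℝ} (h : Combo K d f₀ g₀ l m k fe ge f g)
    (h' : Combo K d f₀' g₀' l' m' k' fe' ge' f' g') :
    f + f' + K * f * f' - g * g' =
      l * (l' * (f₀ + f₀' + K * f₀ * f₀' - g₀ * g₀') + m' * (f₀ + fe' + K * f₀ * fe' - g₀ * ge')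
        - k') +
      m * (l' * (fe + f₀' + K * fe * f₀' - ge * g₀') + m' * (fe + fe' + K * fe * fe' - ge * ge')
        - k') - k := by
  rw [h.hf, h.hg, h'.hf, h'.hg]
  linear_combination -(l * f₀ + m * fe) * h'.sum - (l' * f₀' + m' * fe' - k') * h.sum

/-- End points of the axis have height 0, so the height of the combination is l times that of the
vertex. -/
theorem height_sq (h : Combo K d f₀ g₀ l m k fe ge f g) {H₀ : ℝ}
    (h0 : H₀ ^ 2 = g₀ ^ 2 - f₀ * (2 + K * f₀)) :
    (l * H₀) ^ 2 = g ^ 2 - f * (2 + K * f) := by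
  have h1 := h.pairing h
  linear_combination l ^ 2 * h0 + h1 - m ^ 2 * h.axisEnd.sq_eq - h.quad - k * h.sum

end Combo

/-- The addition theorem applied to md (a + d) ≤ md c. -/
theorem sn_le_of_add_le {a c d g : ℝ} (ha : 0 < a) (hd : 0 < d) (h : a + d ≤ c)
    (hr : InRange K c) (hg : g * sn K d = md K c - md K a - md K d - K * md K a * md K d) :
    sn K a ≤ g := by
  refine le_of_mul_le_mul_right ?_ (sn_pos hd (hr.mono (by linarith)))
  have := md_le (by linarith) h fun hK => (hr hK).le
  rw [md_add] at this
  linarith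

theorem le_neg_sn_of_add_le {b d e g : ℝ} (hb : 0 < b) (he : 0 < e) (h : b + e ≤ d)
    (hr : InRange K d) (hg : g * sn K d = md K e - md K b - md K d - K * md K b * md K d) :
    g ≤ -sn K b := by
  refine le_of_mul_le_mul_right ?_ (sn_pos (by linarith) hr)
  have := md_le he.le (show e ≤ d - b by linarith)
    fun hK => (hr.mono (show d - b ≤ d by linarith) hK).le
  rw [md_sub] at this
  linarith

/-- If the joining line passes before p, the first point has slope greater than its height, so its
chord at p is timelike. -/
theorem raySlope_gt_height {g₁ H₁ g₂ H₂ : ℝ} (hH₁ : 0 ≤ H₁) (hH₂ : 0 ≤ H₂)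
    (hH₂g : H₂ ≤ -g₂) (h : 0 < g₁ * H₂ + g₂ * H₁) : H₁ < g₁ := by
  have h1 := mul_le_mul_of_nonneg_right hH₂g hH₁
  exact lt_of_mul_lt_mul_right (a := H₂) (by linarith) hH₂

theorem pos_of_height_lt {f g H : ℝ} (hH : 0 ≤ H) (h : H < g)
    (e : H ^ 2 = g ^ 2 - f * (2 + K * f)) (p : 0 < 2 + K * f) : 0 < f := by
  have := pow_lt_pow_left₀ h hH two_ne_zero
  exact pos_of_mul_pos_left (b := 2 + K * f) (by linarith) p.le

namespace Glue

variable {a b c d e gx gy Hx Hy : ℝ}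

theorem hc (h : Glue K a b c d e gx gy Hx Hy) : 0 < c := by linarith [h.ha, h.hd, h.hac]

theorem sd (h : Glue K a b c d e gx gy Hx Hy) : 0 < sn K d :=
  sn_pos h.hd (h.hr.mono (by linarith [h.ha, h.hac]))

theorem sa (h : Glue K a b c d e gx gy Hx Hy) : 0 < sn K a :=
  sn_pos h.ha (h.hr.mono (by linarith [h.hd, h.hac]))

theorem sb (h : Glue K a b c d e gx gy Hx Hy) : 0 < sn K b :=
  sn_pos h.hb (h.hr.mono (by linarith [h.ha, h.hac, h.he, h.hbe]))

theorem sc (h : Glue K a b c d e gx gy Hx Hy) : 0 < sn K c := sn_pos h.hc h.hr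

theorem se (h : Glue K a b c d e gx gy Hx Hy) : 0 < sn K e :=
  sn_pos h.he (h.hr.mono (by linarith [h.ha, h.hac, h.hb, h.hbe]))

theorem sn_le_gx (h : Glue K a b c d e gx gy Hx Hy) : sn K a ≤ gx :=
  sn_le_of_add_le h.ha h.hd h.hac h.hr h.egx

theorem gy_le (h : Glue K a b c d e gx gy Hx Hy) : gy ≤ -sn K b :=
  le_neg_sn_of_add_le h.hb h.he h.hbe (h.hr.mono (by linarith [h.ha, h.hac])) h.egy

/-- From a ≤ c - d, the slope at z is at least sn c. This gives the sign at the far end in the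
intermediate value argument. -/
theorem raySlope_x (h : Glue K a b c d e gx gy Hx Hy) : 0 ≤ raySlope K (md K a) gx d := by
  refine nonneg_of_mul_nonneg_left ?_ h.sd
  rw [raySlope_mul_sn, ray_eq_of_mul_sn h.egx]
  have := md_le h.ha.le (show a ≤ c - d by linarith [h.hac])
    fun hK => (h.hr.mono (show c - d ≤ c by linarith [h.hd]) hK).le
  rw [md_sub] at this
  nlinarith [mul_pos h.sc h.sd]

theorem raySlope_y (h : Glue K a b c d e gx gy Hx Hy) : 0 ≤ raySlope K (md K b) gy d := by
  refine nonneg_of_mul_nonneg_left ?_ h.sd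
  rw [raySlope_mul_sn, ray_eq_of_mul_sn h.egy]
  have := md_le h.hb.le (show b ≤ d - e by linarith [h.hbe])
    fun hK => (h.hr.mono (show d - e ≤ c by linarith [h.ha, h.he, h.hac]) hK).le
  rw [md_sub] at this
  nlinarith [mul_pos h.se h.sd]

theorem Hx_le (h : Glue K a b c d e gx gy Hx Hy) : Hx ≤ gx := by
  refine abs_le_of_sq_le_sq' ?_ (h.sa.le.trans h.sn_le_gx) |>.2
  have := h.Hx2
  have := sn_sq (K := K) a
  nlinarith [sq_nonneg (sn K a)]

theorem Hy_le (h : Glue K a b c d e gx gy Hx Hy) : Hy ≤ -gy := by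
  refine abs_le_of_sq_le_sq' ?_ (by linarith [h.gy_le, h.sb]) |>.2
  have := h.Hy2
  have := sn_sq (K := K) b
  nlinarith [sq_nonneg (sn K b)]

theorem exists_of_le {a b c d e : ℝ} (ha : 0 < a) (hb : 0 < b) (hd : 0 < d) (he : 0 < e)
    (hac : a + d ≤ c) (hbe : b + e ≤ d) (hr : InRange K c) :
    ∃ gx gy Hx Hy, Glue K a b c d e gx gy Hx Hy := by
  have hrd : InRange K d := hr.mono (by linarith)
  have hs := (sn_pos hd hrd).ne'
  have hx := sn_le_of_add_le ha hd hac hr (div_mul_cancel₀ _ hs)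
  have hy := le_neg_sn_of_add_le hb he hbe hrd (div_mul_cancel₀ _ hs)
  have sa := sn_nonneg ha.le (hr.mono (by linarith))
  have sb := sn_nonneg hb.le (hr.mono (by linarith))
  refine ⟨_, _, _, _, ha, hb, hd, he, hac, hbe, hr, div_mul_cancel₀ _ hs, div_mul_cancel₀ _ hs,
    Real.sqrt_nonneg _, Real.sqrt_nonneg _, Real.sq_sqrt ?_, Real.sq_sqrt ?_⟩
  · have := pow_le_pow_left₀ sa hx 2
    rw [sn_sq] at this
    linarith
  · have := pow_le_pow_left₀ sb (le_neg_of_le_neg hy) 2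
    rw [sn_sq, neg_sq] at this
    linarith

/-- In the glued figure the distance from `x` to `y` is at least `a + b`. -/
theorem sn_mul_sn_le (h : Glue K a b c d e gx gy Hx Hy) :
    sn K a * sn K b ≤ -gx * gy - Hx * Hy := by
  have := reverse_cauchy_schwarz (n₁ := sn K a) (n₂ := sn K b) (t₁ := gx) (t₂ := -gy) (s₁ := Hx)
    (s₂ := Hy) (by rw [abs_of_nonneg h.Hx0]; exact h.Hx_le)
    (by rw [abs_of_nonneg h.Hy0]; exact h.Hy_le)
    (by rw [h.Hx2, sn_sq]; ring) (by rw [neg_sq, h.Hy2, sn_sq]; ring)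
  linarith

/-- The angle condition at the common vertex, from `a + b` bounding the glued distance. -/
theorem slope_le (h : Glue K a b c d e gx gy Hx Hy)
    (hor : gx * Hy + gy * Hx ≤ 0 →
      md K a + md K b + K * md K a * md K b - gx * gy - Hx * Hy ≤ md K (a + b)) :
    gx * sn K b ≤ -gy * sn K a := by
  have ex : sn K a ^ 2 = gx ^ 2 - Hx ^ 2 := by rw [h.Hx2, sn_sq]; ring
  have ey : sn K b ^ 2 = gy ^ 2 - Hy ^ 2 := by rw [h.Hy2, sn_sq]; ring
  have hgx := h.sa.le.trans h.sn_le_gx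
  have hgy : 0 ≤ -gy := by linarith [h.gy_le, h.sb]
  -- If the line crossed the axis beyond p, the upper bound a + b and the lower bound `sn_mul_sn_le`
  -- would agree; equality in reverse Cauchy–Schwarz forces gx Hy + gy Hx = 0.
  have hL : 0 ≤ gx * Hy + gy * Hx := by
    by_contra hn
    have h1 := hor (not_le.1 hn).le
    rw [md_add] at h1
    have h2 : (-gx * gy - Hx * Hy) ^ 2 ≤ (sn K a * sn K b) ^ 2 :=
      pow_le_pow_left₀ ((mul_pos h.sa h.sb).le.trans h.sn_mul_sn_le) (by linarith) 2
    rw [mul_pow, ex, ey] at h2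
    nlinarith
  refine abs_le_of_sq_le_sq' ?_ (mul_nonneg hgy h.sa.le) |>.2
  rw [mul_pow, mul_pow, ex, ey]
  have : (-gy * Hx) ^ 2 ≤ (gx * Hy) ^ 2 :=
    pow_le_pow_left₀ (mul_nonneg hgy h.Hx0) (by linarith) 2
  nlinarith

/-- The point at distance `a` from `x` on the straightened side is at distance at most `d` from
`z`. -/
theorem straightened_le (h : Glue K a b c d e gx gy Hx Hy) (hab : a + b ≤ c)
    (hs : gx * sn K b ≤ -gy * sn K a) :
    lCoef K (a + b) a * md K c + rCoef K (a + b) a * md K e - cCoef K (a + b) a ≤ md K d := by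
  have hpos : 0 < sn K (a + b) := sn_pos (by linarith [h.ha, h.hb]) (h.hr.mono hab)
  refine le_of_mul_le_mul_right ?_ hpos
  have ec : md K c = md K a + md K d + K * md K a * md K d + gx * sn K d := by linarith [h.egx]
  have ee : md K e = md K b + md K d + K * md K b * md K d + gy * sn K d := by linarith [h.egy]
  have h1 := mul_le_mul_of_nonneg_right hs h.sd.le
  -- The deviation from md d is governed by exactly the angle defect gx sn b + gy sn a, nonpositive
  -- by `hs`.
  have h2 : (lCoef K (a + b) a * md K c + rCoef K (a + b) a * md K e - cCoef K (a + b) a) *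
      sn K (a + b) = md K d * sn K (a + b) + (gx * sn K b + gy * sn K a) * sn K d := by
    have hne := hpos.ne'
    unfold cCoef lCoef rCoef
    rw [add_sub_cancel_left]
    field_simp
    rw [ec, ee, md_add, sn_add]
    linear_combination -sn K b * sn_sq (K := K) a
  rw [h2]
  nlinarith

/-- The distance in the straightened triangle is bounded by the length of the path through the
common vertex. -/
theorem le_mdSum (h : Glue K a b c d e gx gy Hx Hy)
    {f₁ g₁ l₁ m₁ k₁ fe₁ ge₁ f₂ g₂ l₂ m₂ k₂ fe₂ ge₂ : ℝ}
    (C₁ : Combo K d (md K a) gx l₁ m₁ k₁ fe₁ ge₁ f₁ g₁)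
    (C₂ : Combo K d (md K b) gy l₂ m₂ k₂ fe₂ ge₂ f₂ g₂)
    (hf₁ : 0 ≤ f₁ * (2 + K * f₁)) (hf₂ : 0 ≤ f₂ * (2 + K * f₂))
    (hL : 0 ≤ g₁ * (l₂ * Hy) + g₂ * (l₁ * Hx)) :
    f₁ + f₂ + K * f₁ * f₂ - g₁ * g₂ - (l₁ * Hx) * (l₂ * Hy)
      - l₁ * l₂ * (-gx * gy - Hx * Hy - sn K a * sn K b) ≤ mdSum K f₁ f₂ := by
  have mg₁ := mul_nonneg C₁.hm (neg_nonneg.2 (C₁.axisEnd.nonpos h.sd.le))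
  have mg₂ := mul_nonneg C₂.hm (neg_nonneg.2 (C₂.axisEnd.nonpos h.sd.le))
  have e₁ := C₁.height_sq h.Hx2
  have e₂ := C₂.height_sq h.Hy2
  have hH₂ : l₂ * Hy ≤ -g₂ - -(m₂ * ge₂) := by
    have := mul_le_mul_of_nonneg_left h.Hy_le C₂.hl
    rw [C₂.hg]; linarith
  -- The vectors at p towards the two points are stripped of their axis components; what remains are
  -- l₁ and l₂ times the vectors towards x and y, with norms l₁ sn a and l₂ sn b.
  have hc := corner_le (A₀ := -g₂) (A₁ := l₂ * Hy) (B₀ := g₁) (B₁ := l₁ * Hx) (m := -(m₁ * ge₁))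
    (m' := -(m₂ * ge₂)) (nA := √(f₂ * (2 + K * f₂))) (nB := √(f₁ * (2 + K * f₁)))
    (nX := l₁ * sn K a) (nY := l₂ * sn K b) (mul_nonneg C₂.hl h.Hy0) (mul_nonneg C₁.hl h.Hx0)
    hH₂ (by linarith) (by linarith) (by linarith) (Real.sqrt_nonneg _) (Real.sqrt_nonneg _)
    (mul_nonneg C₁.hl h.sa.le)
    (by rw [Real.sq_sqrt hf₂, e₂]; ring) (by rw [Real.sq_sqrt hf₁, e₁]; ring)
    (by rw [C₁.hg, mul_pow, mul_pow, sn_sq]; linear_combination l₁ ^ 2 * h.Hx2)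
    (by rw [C₂.hg, mul_pow, mul_pow, sn_sq]; linear_combination l₂ ^ 2 * h.Hy2)
  have h3 : (-g₂ - -(m₂ * ge₂)) * (g₁ + -(m₁ * ge₁)) = l₁ * l₂ * (-gx * gy) := by
    rw [C₁.hg, C₂.hg]; ring
  rw [h3] at hc
  unfold mdSum
  linarith

end Glue

end Glue

/-! ### Lower bounds for time separations through points of the common side. -/

section Sees

variable {X : Type*} [EMetricSpace X] [LorentzianPreLengthSpace X] {U : Set X} {K : ℝ}

/-- The time separations between `b` and the points of the side `S` from `p` of length `d` are
bounded below by the comparison distances `ray K f g`. -/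
def Sees (K d : ℝ) (p : X) (S : Set X) (b : X) (f g : ℝ) : Prop :=
  ∀ q ∈ S, tauR p q < d → 0 < ray K f g (tauR p q) →
    (0 < raySlope K f g (tauR p q) → MdLe K (ray K f g (tauR p q)) b q) ∧
    (raySlope K f g (tauR p q) < 0 → MdLe K (ray K f g (tauR p q)) q b)

/-- Stewart's theorem rewritten as an initial value problem at p. -/
theorem IsOnSegment.world_eq_ray {p z b q : ℝ × ℝ} {d r f g : ℝ}
    (hq : IsOnSegment K p z d r q) (hw : world K p z = md K d) (hs : sn K d ≠ 0)
    (hf : world K b p = f)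
    (hg : g * sn K d = world K b z - f - md K d - K * f * md K d) :
    world K b q = ray K f g r := by
  rw [world_comm, hq.world_eq hw hs, world_comm p b, world_comm z b, hf]
  unfold ray cCoef lCoef rCoef
  rw [sn_sub]
  field_simp
  linear_combination -sn K r * hg

/-- A positive modified distance means that b' and q' are causally related; the slope at q' decides
the order, because the wrong one contradicts the hinge inequality at q' with z'. Strictness r < d
makes the segment from q' to z' nondegenerate. -/
theorem sees_of_model {p : X} {S : Set X} {b : X} {p' z' b' : ℝ × ℝ} {d f g : ℝ}
    (hp : Near K p') (hz : Near K z') (hb : Near K b') (hpz : Rel K p' z')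
    (hw : world K p' z' = md K d) (hd : 0 < d) (hr : InRange K d)
    (hpos : ∀ r q', 0 ≤ r → r ≤ d → IsOnSegment K p' z' d r q' → 0 < 2 + K * world K b' q')
    (hM : ∀ q ∈ S, ∀ q', IsOnSegment K p' z' d (tauR p q) q' →
      (Rel K b' q' → MdLe K (world K b' q') b q) ∧ (Rel K q' b' → MdLe K (world K q' b') q b))
    (hf : world K b' p' = f)
    (hg : g * sn K d = world K b' z' - f - md K d - K * f * md K d) :
    Sees K d p S b f g ∧ ∀ r, 0 ≤ r → r ≤ d → 0 < 2 + K * ray K f g r := by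
  have hs := (sn_pos hd hr).ne'
  refine ⟨fun q hq hqd hF => ?_, fun r h0 h1 => ?_⟩
  · set r := tauR p q with hrdef
    have h0 : 0 ≤ r := tauR_nonneg _ _
    obtain ⟨q', hq', hS⟩ := exists_isOnSegment hp hz hpz hd hr hw h0 hqd.le
    have e := hS.world_eq_ray hw hs hf hg
    have hM' := hM q hq q' hS
    have hsd := sn_pos (sub_pos.2 hqd) (hr.mono (show d - r ≤ d by linarith))
    have e1 := ray_add (K := K) f g r (d - r)
    rw [add_sub_cancel, ray_eq_of_mul_sn hg] at e1
    unfold ray at e1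
    rw [show f + md K r + K * f * md K r + g * sn K r = ray K f g r from rfl] at e1
    have hor := hb.rel_or hq' (by rwa [e]) (hpos r q' h0 hqd.le hS).le
    rw [world_comm q' b', e] at hM'
    refine ⟨fun hG => ?_, fun hG => ?_⟩
    · rcases hor with h | h
      · exact hM'.1 h
      · have := hinge_nonpos_future h hS.rel_right
        rw [hS.world_right, e] at this
        nlinarith [mul_pos hG hsd]
    · rcases hor with h | h
      · have := hinge_nonneg h hS.rel_right
        rw [hS.world_right, e] at this
        nlinarith [mul_pos (neg_pos.2 hG) hsd]
      · exact hM'.2 h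
  · obtain ⟨q', hq', hS⟩ := exists_isOnSegment hp hz hpz hd hr hw h0 h1
    rw [← hS.world_eq_ray hw hs hf hg]
    exact hpos r q' h0 h1 hS

/-- Concatenation of two lower bounds through an intermediate point. -/
theorem MdLe.mdSum_le (hU : TauFiniteContinuousOn U) {a q b : X} (ha : a ∈ U) (hq : q ∈ U)
    (hb : b ∈ U) {F₁ F₂ : ℝ} (h₁ : MdLe K F₁ a q) (h₂ : MdLe K F₂ q b) (haq : causal a q)
    (hqb : causal q b) (hr : InRange K (tauR a b)) : mdSum K F₁ F₂ ≤ md K (tauR a b) := by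
  obtain ⟨l₁, p₁, rfl, q₁⟩ := h₁
  obtain ⟨l₂, p₂, rfl, q₂⟩ := h₂
  have h := hU.tauR_add_le ha hq hb haq hqb
  rw [mdSum_md (sn_nonneg p₁ (hr.mono (by linarith))) (sn_nonneg p₂ (hr.mono (by linarith)))]
  exact md_le (by linarith) (by linarith) fun hK => (hr hK).le

/-- The crossing parameter is realized by a point q of S. Opposite slopes say that one of a, b lies
before q and the other after it, and concatenation through q gives the glued distance. -/
theorem Sees.crossing (hU : TauFiniteContinuousOn U) {p z a b : X} {S : Set X} {c d : ℝ}
    (hS : IsSide U p z S) (hd : tauR p z = d) (hd0 : 0 < d) (hrd : InRange K d)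
    (ha : a ∈ U) (hb : b ∈ U) (hr : InRange K c)
    (hba : tauR b a ≤ c) (hab : tauR a b ≤ c) {f₁ g₁ H₁ f₂ g₂ H₂ : ℝ}
    (s₁ : Sees K d p S b f₁ g₁) (s₂ : Sees K d p S a f₂ g₂)
    (hH₁ : 0 ≤ H₁) (hH₂ : 0 ≤ H₂) (e₁ : H₁ ^ 2 = g₁ ^ 2 - f₁ * (2 + K * f₁))
    (e₂ : H₂ ^ 2 = g₂ ^ 2 - f₂ * (2 + K * f₂))
    (p₁ : ∀ r, 0 ≤ r → r ≤ d → 0 < 2 + K * ray K f₁ g₁ r)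
    (p₂ : ∀ r, 0 ≤ r → r ≤ d → 0 < 2 + K * ray K f₂ g₂ r)
    (q₁ : 0 ≤ raySlope K f₁ g₁ d) (q₂ : 0 ≤ raySlope K f₂ g₂ d) (hg : g₂ ≤ 0)
    (hL : g₁ * H₂ + g₂ * H₁ ≤ 0) (hs : g₂ < 0 ∨ g₁ ≤ 0) :
    f₁ + f₂ + K * f₁ * f₂ - g₁ * g₂ - H₁ * H₂ ≤ md K (tauR b a) ∨
      f₁ + f₂ + K * f₁ * f₂ - g₁ * g₂ - H₁ * H₂ ≤ md K (tauR a b) := by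
  -- The strict failure of both inequalities supplies the margin δ for an approximate crossing.
  by_contra! hn
  obtain ⟨n1, n2⟩ := hn
  set N := f₁ + f₂ + K * f₁ * f₂ - g₁ * g₂ - H₁ * H₂ with hN
  have hN0 : 0 < N := (md_nonneg (tauR_nonneg _ _) (hr.mono hba)).trans_lt n1
  obtain ⟨r, r0, r1, F1, F2, hG, hM⟩ := exists_crossing hd0 hrd hH₁ hH₂ e₁ e₂ p₁ p₂ q₁ q₂ hg hL hs
    hN hN0 (lt_min (sub_pos.2 n1) (sub_pos.2 n2))
  -- At r = d both slopes are nonnegative, so their product cannot be negative.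
  have hrd' : r < d := by
    refine lt_of_le_of_ne r1 ?_
    rintro rfl
    exact absurd hG (not_lt.2 (mul_nonneg q₁ q₂))
  obtain ⟨q, hq, rfl⟩ : ∃ q ∈ S, tauR p q = r := hS.exists_toReal_tau_eq hU r0 (r1.trans_eq hd.symm)
  have t₁ := s₁ q hq hrd' F1
  have t₂ := s₂ q hq hrd' F2
  have hqU := hS.1 hq
  have m1 := min_le_left (N - md K (tauR b a)) (N - md K (tauR a b))
  have m2 := min_le_right (N - md K (tauR b a)) (N - md K (tauR a b))
  rcases mul_neg_iff.1 hG with ⟨h1, h2⟩ | ⟨h1, h2⟩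
  · have u₁ := t₁.1 h1
    have u₂ := t₂.2 h2
    have := u₁.mdSum_le hU hb hqU ha u₂ (causal_of_chron _ _ (chron_of_tauR_pos (u₁.tauR_pos F1)))
      (causal_of_chron _ _ (chron_of_tauR_pos (u₂.tauR_pos F2))) (hr.mono hba)
    linarith
  · have u₁ := t₁.2 h1
    have u₂ := t₂.1 h2
    have := u₂.mdSum_le hU ha hqU hb u₁ (causal_of_chron _ _ (chron_of_tauR_pos (u₂.tauR_pos F2)))
      (causal_of_chron _ _ (chron_of_tauR_pos (u₁.tauR_pos F1))) (hr.mono hab)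
    rw [mdSum_comm] at this
    linarith

/-- The distance in the straightened triangle is a lower bound for the time separation of points on
the two glued triangles. -/
theorem Glue.le_or_le (hU : TauFiniteContinuousOn U) {p z a b : X} {S : Set X}
    {a₀ b₀ c d e gx gy Hx Hy : ℝ} (G : Glue K a₀ b₀ c d e gx gy Hx Hy)
    (hS : IsSide U p z S) (hd : tauR p z = d) (ha : a ∈ U) (hb : b ∈ U)
    (hba : tauR b a ≤ c) (hab : tauR a b ≤ c)
    {f₁ g₁ l₁ m₁ k₁ fe₁ ge₁ f₂ g₂ l₂ m₂ k₂ fe₂ ge₂ w : ℝ}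
    (C₁ : Combo K d (md K a₀) gx l₁ m₁ k₁ fe₁ ge₁ f₁ g₁)
    (C₂ : Combo K d (md K b₀) gy l₂ m₂ k₂ fe₂ ge₂ f₂ g₂)
    (s₁ : Sees K d p S b f₁ g₁) (s₂ : Sees K d p S a f₂ g₂)
    (p₁ : ∀ r, 0 ≤ r → r ≤ d → 0 < 2 + K * ray K f₁ g₁ r)
    (p₂ : ∀ r, 0 ≤ r → r ≤ d → 0 < 2 + K * ray K f₂ g₂ r)
    (hpa : causal p a) (hpad : tauR p a ≤ d) (hpa' : MdLe K f₂ p a)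
    (hw : w ≤ l₁ * (l₂ * md K (a₀ + b₀)
        + m₂ * (md K a₀ + fe₂ + K * md K a₀ * fe₂ - gx * ge₂) - k₂) +
      m₁ * (l₂ * (fe₁ + md K b₀ + K * fe₁ * md K b₀ - ge₁ * gy)
        + m₂ * (fe₁ + fe₂ + K * fe₁ * fe₂ - ge₁ * ge₂) - k₂) - k₁) (hw0 : 0 < w) :
    w ≤ md K (tauR b a) ∨ w ≤ md K (tauR a b) := by
  have hrd : InRange K d := G.hr.mono (by linarith [G.ha, G.hac])
  have hpU := hS.1 hS.left_mem
  have e₁ := C₁.height_sq G.Hx2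
  have e₂ := C₂.height_sq G.Hy2
  have hpair := C₁.pairing C₂
  have hΔ := mul_le_mul_of_nonneg_left G.sn_mul_sn_le (mul_nonneg C₁.hl C₂.hl)
  have ge₁0 := C₁.axisEnd.nonpos G.sd.le
  have ge₂0 := C₂.axisEnd.nonpos G.sd.le
  have mg₁ := mul_nonneg C₁.hm (neg_nonneg.2 ge₁0)
  have mg₂ := mul_nonneg C₂.hm (neg_nonneg.2 ge₂0)
  have hgy : gy ≤ 0 := by linarith [G.gy_le, G.sb]
  have hg₂ : g₂ ≤ 0 := by
    rw [C₂.hg]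
    linarith [mul_nonneg C₂.hl (neg_nonneg.2 hgy)]
  set H₁ := l₁ * Hx with hH₁
  set H₂ := l₂ * Hy with hH₂
  have hH₁0 : 0 ≤ H₁ := mul_nonneg C₁.hl G.Hx0
  have hH₂0 : 0 ≤ H₂ := mul_nonneg C₂.hl G.Hy0
  rw [md_add] at hw
  have hwN : w ≤ f₁ + f₂ + K * f₁ * f₂ - g₁ * g₂ - H₁ * H₂
      - l₁ * l₂ * (-gx * gy - Hx * Hy - sn K a₀ * sn K b₀) := by
    rw [hpair, hH₁, hH₂]
    linarith
  have hwN' : w ≤ f₁ + f₂ + K * f₁ * f₂ - g₁ * g₂ - H₁ * H₂ := by linarith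
  -- Either the joining line meets the axis beyond p, or the path through p is used.
  by_cases hcase : g₁ * H₂ + g₂ * H₁ ≤ 0 ∧ (g₂ < 0 ∨ g₁ ≤ 0)
  · rcases Sees.crossing hU hS hd G.hd hrd ha hb G.hr hba hab s₁ s₂ hH₁0 hH₂0 e₁ e₂ p₁ p₂
      (C₁.raySlope_nonneg G.sd.le G.raySlope_x) (C₂.raySlope_nonneg G.sd.le G.raySlope_y) hg₂
      hcase.1 hcase.2 with h | h
    · exact Or.inl (hwN'.trans h)
    · exact Or.inr (hwN'.trans h)
  · obtain ⟨l, l0, hl, hla⟩ := hpa'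
    have hpar : InRange K l := hrd.mono (hla.trans hpad)
    have hf₂ : 0 ≤ f₂ := by rw [← hl]; exact md_nonneg l0 hpar
    have u₁ := p₁ 0 le_rfl G.hd.le
    have u₂ := p₂ 0 le_rfl G.hd.le
    rw [ray_zero] at u₁ u₂
    have hf₂' : 0 ≤ f₂ * (2 + K * f₂) := mul_nonneg hf₂ u₂.le
    have hH₂g : H₂ ≤ -g₂ := abs_le_of_sq_le_sq' (by rw [e₂, neg_sq]; linarith) (by linarith) |>.2
    -- In the second case b must be seen from p as a point of its past. The exceptional subcase g₂ =
    -- 0 puts a at modified distance 0 from p.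
    have hfacts : 0 < f₁ ∧ 0 < g₁ ∧ 0 ≤ g₁ * H₂ + g₂ * H₁ := by
      rcases lt_or_ge 0 (g₁ * H₂ + g₂ * H₁) with h | h
      · have h1 := raySlope_gt_height hH₁0 hH₂0 hH₂g h
        exact ⟨pos_of_height_lt hH₁0 h1 e₁ u₁, hH₁0.trans_lt h1, h.le⟩
      · have h1 : ¬(g₂ < 0 ∨ g₁ ≤ 0) := fun h' => hcase ⟨h, h'⟩
        push Not at h1
        have hg : g₂ = 0 := le_antisymm hg₂ h1.1
        rw [hg] at e₂ hH₂g
        have hH : H₂ = 0 := by linarith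
        have hf : f₂ * (2 + K * f₂) = 0 := by rw [hH] at e₂; linarith
        have hf' : f₂ = 0 := (mul_eq_zero.1 hf).resolve_right u₂.ne'
        rw [hf', hg, hH] at hwN'
        refine ⟨by linarith, h1.2, ?_⟩
        rw [hg, hH]; simp
    obtain ⟨hf₁, hg₁, hL⟩ := hfacts
    have hpp : tauR p p = 0 := by unfold tauR; rw [hU.tau_self hpU]; rfl
    have hbp : MdLe K f₁ b p := by
      have := s₁ p hS.left_mem (by rw [hpp]; exact G.hd)
      rw [hpp, ray_zero, raySlope_zero] at this
      exact (this hf₁).1 hg₁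
    have hsum := hbp.mdSum_le hU hb hpU ha ⟨l, l0, hl, hla⟩
      (causal_of_chron _ _ (chron_of_tauR_pos (hbp.tauR_pos hf₁))) hpa (G.hr.mono hba)
    refine Or.inl (le_trans ?_ hsum)
    exact hwN.trans (G.le_mdSum C₁ C₂ (mul_nonneg hf₁.le u₁.le) hf₂' hL)

end Sees

/-! ### Excluding reversed causal order. -/

section Orientation

variable {X : Type*} [EMetricSpace X] [LorentzianPreLengthSpace X] {U : Set X} {K : ℝ}

/-- If l ≤ s, the first inequality gives t ≤ s - l. If s ≤ l, it gives t ≤ l - s, hence s = 0 and t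
= l, and the second becomes sn(l)² ≤ 0. -/
theorem not_md_reverse {s t l : ℝ} (hs : 0 ≤ s) (hl : 0 < l) (hle : s + l ≤ t) (hr : InRange K t)
    (h₁ : md K t ≤ md K (s - l)) (h₂ : md K t + md K l + K * md K t * md K l ≤ md K s) : False := by
  have hlr : InRange K l := hr.mono (by linarith)
  rcases le_total l s with h | h
  · have := le_of_md_le (K := K) (s := t) (t := s - l) (by linarith)
      (fun hK => (hr hK).le) h₁
    linarith
  · rw [← neg_sub, md_neg] at h₁
    have := le_of_md_le (K := K) (s := t) (t := l - s) (by linarith)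
      (fun hK => (hr hK).le) h₁
    have e : s = 0 := by linarith
    have e' : t = l := by linarith
    rw [e, e', md_zero] at h₂
    have := pow_pos (sn_pos hl hlr) 2
    rw [sn_sq] at this
    linarith

theorem TauFiniteContinuousOn.tauR_self (hU : TauFiniteContinuousOn U) {a : X} (ha : a ∈ U) :
    tauR a a = 0 := by
  unfold tauR
  rw [hU.tau_self ha, ENNReal.toReal_zero]

namespace IsTriangle

variable {x y z : X} {sxy syz sxz : Set X} {x' y' z' a' b' : ℝ × ℝ} {a b : X}

/-- In X, x ≤ b ≪ a gives τ(x, b) + l ≤ τ(x, a), while a' before b' in the model gives the two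
opposite inequalities for the distances from x', excluded by `not_md_reverse`. -/
theorem false_of_rel_left (h : IsTriangle U K x y z sxy syz sxz)
    (hb : b ∈ U) (ha : a ∈ U) (hxb : causal x b) (haz : causal a z)
    {L M : ℝ} {u v : ℝ × ℝ} (ha' : IsOnSegment K x' u L (tauR x a) a')
    (hb' : IsOnSegment K x' v M (tauR x b) b') (hR : Rel K a' b') {l : ℝ} (hl : 0 < l)
    (hlb : l ≤ tauR b a) (hw : world K a' b' = md K l) : False := by
  have hba := causal_of_chron _ _ (chron_of_tauR_pos (hl.trans_le hlb))
  have h1 := h.finite.tauR_add_le h.mem_x hb ha hxb hba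
  have h2 := h.finite.tauR_add_le h.mem_x ha h.mem_z (causal_trans _ _ _ hxb hba) haz
  have hr : InRange K (tauR x a) := h.inRange.mono (by linarith [tauR_nonneg a z])
  have h3 := world_le_md_sub_past hb'.rel_left hR hb'.world_left hw
  have h4 := hinge_nonneg ha'.rel_left hR
  rw [ha'.world_left] at h3 h4
  rw [hw, hb'.world_left] at h4
  exact not_md_reverse (tauR_nonneg x b) hl (by linarith) hr h3 h4

theorem false_of_rel_right (h : IsTriangle U K x y z sxy syz sxz)
    (hb : b ∈ U) (ha : a ∈ U) (hxb : causal x b) (haz : causal a z)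
    (raz : Rel K a' z') (rbz : Rel K b' z') (waz : world K a' z' = md K (tauR a z))
    (wbz : world K b' z' = md K (tauR b z)) (hR : Rel K a' b') {l : ℝ} (hl : 0 < l)
    (hlb : l ≤ tauR b a) (hw : world K a' b' = md K l) : False := by
  have hba := causal_of_chron _ _ (chron_of_tauR_pos (hl.trans_le hlb))
  have h1 := h.finite.tauR_add_le hb ha h.mem_z hba haz
  have h2 := h.finite.tauR_add_le h.mem_x hb h.mem_z hxb (causal_trans _ _ _ hba haz)
  have hr : InRange K (tauR b z) := h.inRange.mono (by linarith [tauR_nonneg x b])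
  have h3 := world_le_md_sub_future hR raz hw waz
  have h4 := hinge_nonneg hR rbz
  rw [wbz] at h3 h4
  rw [hw, waz] at h4
  rw [← neg_sub, md_neg] at h3
  exact not_md_reverse (tauR_nonneg a z) hl (by linarith) hr h3 (by linarith)

theorem false_of_chron_of_causal (h : IsTriangle U K x y z sxy syz sxz) (ha : a ∈ U) (hb : b ∈ U)
    (hab : causal a b) (hba : 0 < tauR b a) : False := by
  have h1 := h.finite.tauR_add_le ha hb ha hab (causal_of_chron _ _ (chron_of_tauR_pos hba))
  rw [h.finite.tauR_self ha] at h1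
  linarith [tauR_nonneg a b]

theorem Matches.bounds {h : IsTriangle U K x y z sxy syz sxz}
    (hm : IsModelTriangle K (tauR x y) (tauR y z) (tauR x z) x' y' z')
    (ha : h.Matches x' y' z' a a') : x'.1 ≤ a'.1 ∧ a'.1 ≤ z'.1 := by
  rcases ha with ⟨-, ha⟩ | ⟨-, ha⟩ | ⟨-, ha⟩
  · exact ⟨ha.rel_left.1.fst_le, ha.rel_right.1.fst_le.trans hm.rel₂.1.fst_le⟩
  · exact ⟨hm.rel₁.1.fst_le.trans ha.rel_left.1.fst_le, ha.rel_right.1.fst_le⟩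
  · exact ⟨ha.rel_left.1.fst_le, ha.rel_right.1.fst_le⟩

theorem world_right_eq (h : IsTriangle U K x y z sxy syz sxz) {u : X} {S : Set X}
    (hS : IsSide U u z S) {u' : ℝ × ℝ} (ha : a ∈ S)
    (ha' : IsOnSegment K u' z' (tauR u z) (tauR u a) a') :
    world K a' z' = md K (tauR a z) := by
  rw [ha'.world_right, ← hS.tauR_add h.finite ha, add_sub_cancel_left]

/-- The orientation of a pair of model points determines that of the corresponding points. -/
theorem not_reverse (h : IsTriangle U K x y z sxy syz sxz)
    (ha : h.Matches x' y' z' a a') (hb : h.Matches x' y' z' b b') (hR : Rel K a' b') {l : ℝ}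
    (hl : 0 < l) (hlb : l ≤ tauR b a) (hw : world K a' b' = md K l) (hw0 : 0 < md K l) : False := by
  have haU := ha.mem
  have hbU := hb.mem
  have hxb := hb.causal_left
  have haz := ha.causal_right
  have left : ∀ {L M : ℝ} {u v : ℝ × ℝ}, IsOnSegment K x' u L (tauR x a) a' →
      IsOnSegment K x' v M (tauR x b) b' → False := fun h1 h2 =>
    h.false_of_rel_left hbU haU hxb haz h1 h2 hR hl hlb hw
  have right : Rel K a' z' → Rel K b' z' → world K a' z' = md K (tauR a z) →
      world K b' z' = md K (tauR b z) → False := fun h1 h2 h3 h4 =>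
    h.false_of_rel_right hbU haU hxb haz h1 h2 h3 h4 hR hl hlb hw
  rcases ha with ⟨ha, ha'⟩ | ⟨ha, ha'⟩ | ⟨ha, ha'⟩ <;>
    rcases hb with ⟨hb, hb'⟩ | ⟨hb, hb'⟩ | ⟨hb, hb'⟩
  · exact left ha' hb'
  -- Here a precedes b through y already in X.
  · exact h.false_of_chron_of_causal haU hbU
      (causal_trans _ _ _ (h.side₁.causal_right ha) (h.side₂.causal_left hb)) (hl.trans_le hlb)
  · exact left ha' hb'
  -- Here b' precedes y' and y' precedes a', so the time coordinates of a' and b' coincide.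
  · have := world_nonpos_of_fst_eq (K := K) (p := a') (q := b')
      (le_antisymm (hb'.rel_right.1.fst_le.trans ha'.rel_left.1.fst_le) hR.1.fst_le)
    linarith
  · exact right ha'.rel_right hb'.rel_right (h.world_right_eq h.side₂ ha ha')
      (h.world_right_eq h.side₂ hb hb')
  · exact right ha'.rel_right hb'.rel_right (h.world_right_eq h.side₂ ha ha')
      (h.world_right_eq h.side₃ hb hb')
  · exact left ha' hb'
  · exact right ha'.rel_right hb'.rel_right (h.world_right_eq h.side₃ ha ha')
      (h.world_right_eq h.side₂ hb hb')
  · exact left ha' hb'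

/-- The curvature bound follows from its version for unoriented pairs of points. -/
theorem boundAbove_of_le_or_le (h : IsTriangle U K x y z sxy syz sxz)
    (H : ∀ x' y' z', IsModelTriangle K (tauR x y) (tauR y z) (tauR x z) x' y' z' →
      ∀ a b a' b', h.Matches x' y' z' a a' → h.Matches x' y' z' b b' → 0 < world K a' b' →
        world K a' b' ≤ md K (tauR b a) ∨ world K a' b' ≤ md K (tauR a b)) :
    BoundAbove K x y z sxy syz sxz := by
  intro x' y' z' hc a b a' b' ha hb
  have hm := h.isModelTriangle hc
  replace ha := h.matches_of_isComparisonPoint hc ha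
  replace hb := h.matches_of_isComparisonPoint hc hb
  by_cases h0 : modelTau K a' b' = 0
  · rw [h0]; exact zero_le
  have hR : Rel K a' b' := rel_of_modelCausal (modelCausal_of_modelTau_ne_zero h0)
    (fun hK => by linarith [(ha.bounds hm).1, (hb.bounds hm).2, (hm.rel₃.2 hK).1])
    (hm.two_add_pos ha.isOnTriangle hb.isOnTriangle).le
  obtain ⟨l, l0, l1, hl⟩ := hR.exists_md_eq
  have e := modelTau_eq_ofReal hR l0 l1 hl
  have lpos : 0 < l := by
    refine lt_of_le_of_ne l0 ?_
    rintro rfl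
    rw [ENNReal.ofReal_zero] at e
    exact h0 e
  have wpos : 0 < world K a' b' := by
    refine lt_of_le_of_ne hR.world_nonneg fun hw => h0 ?_
    rw [modelTau_eq_ofReal hR le_rfl (by simp [Real.pi_pos.le]) (by rw [md_zero, hw]),
      ENNReal.ofReal_zero]
  have hab := h.finite.tauR_le h.mem_x ha.mem hb.mem h.mem_z ha.causal_left hb.causal_right
  have hba := h.finite.tauR_le h.mem_x hb.mem ha.mem h.mem_z hb.causal_left ha.causal_right
  rw [e, ← h.finite.ofReal_tauR ha.mem hb.mem]
  refine ENNReal.ofReal_le_ofReal ?_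
  rcases H x' y' z' hm a b a' b' ha hb wpos with h1 | h1
  · rw [hl] at h1
    exact (h.not_reverse ha hb hR lpos (le_of_md_le (tauR_nonneg _ _) l1 h1) hl
      (hl ▸ wpos)).elim
  · rw [hl] at h1
    exact le_of_md_le (tauR_nonneg _ _) l1 h1

end IsTriangle

end Orientation

/-! ### The sides of the two small triangles as seen from the common side. -/

section Seen

variable {X : Type*} [EMetricSpace X] [LorentzianPreLengthSpace X] {U : Set X} {K : ℝ}

/-- The point `b` lies on a side joining a vertex with coordinates `f₀`, `g₀` to an end point of the
common side, and its comparison distances to the common side are lower bounds. -/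
def Seen (K d f₀ g₀ : ℝ) (p : X) (S : Set X) (b : X) (l m k fe ge : ℝ) : Prop :=
  ∃ f g, Combo K d f₀ g₀ l m k fe ge f g ∧ Sees K d p S b f g ∧
    ∀ r, 0 ≤ r → r ≤ d → 0 < 2 + K * ray K f g r

theorem seen_of_model {p : X} {S : Set X} {b : X} {p' z' b' v' e' : ℝ × ℝ}
    {d f₀ g₀ l m k fe ge : ℝ}
    (hp : Near K p') (hz : Near K z') (hb : Near K b') (hpz : Rel K p' z')
    (hw : world K p' z' = md K d) (hd : 0 < d) (hr : InRange K d)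
    (hpos : ∀ r q', 0 ≤ r → r ≤ d → IsOnSegment K p' z' d r q' → 0 < 2 + K * world K b' q')
    (hM : ∀ q ∈ S, ∀ q', IsOnSegment K p' z' d (tauR p q) q' →
      (Rel K b' q' → MdLe K (world K b' q') b q) ∧ (Rel K q' b' → MdLe K (world K q' b') q b))
    (hf₀ : world K v' p' = f₀) (hg₀ : g₀ * sn K d = world K v' z' - f₀ - md K d - K * f₀ * md K d)
    (hl : 0 ≤ l) (hm : 0 ≤ m) (hsum : l + m + K * k = 1)
    (hquad : 2 * k - K * k ^ 2 = 2 * l * m * world K v' e')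
    (hb' : ∀ o, world K b' o = l * world K v' o + m * world K e' o - k)
    (he : e' = p' ∧ fe = 0 ∧ ge = 0 ∨ e' = z' ∧ fe = md K d ∧ ge = -sn K d) :
    Seen K d f₀ g₀ p S b l m k fe ge := by
  have hfe : world K e' p' = fe := by
    rcases he with ⟨rfl, rfl, rfl⟩ | ⟨rfl, rfl, rfl⟩
    · exact world_self _
    · rw [world_comm, hw]
  have hve : world K v' e' = f₀ + fe + K * f₀ * fe - g₀ * ge := by
    rcases he with ⟨rfl, rfl, rfl⟩ | ⟨rfl, rfl, rfl⟩
    · rw [hf₀]; ring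
    · linarith
  have hge : ge * sn K d = world K e' z' - fe - md K d - K * fe * md K d := by
    rcases he with ⟨rfl, rfl, rfl⟩ | ⟨rfl, rfl, rfl⟩
    · rw [hw]; ring
    · rw [world_self]; linear_combination -sn_sq (K := K) d
  obtain ⟨h1, h2⟩ := sees_of_model (f := l * f₀ + m * fe - k) (g := l * g₀ + m * ge) hp hz hb hpz hw
    hd hr hpos hM (by rw [hb', hf₀, hfe]) (by
      rw [hb' z']
      linear_combination l * hg₀ + m * hge - md K d * hsum)
  exact ⟨_, _, ⟨hl, hm, hsum, by rw [hquad, hve], he.imp And.right And.right, rfl, rfl⟩, h1, h2⟩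

namespace IsTriangle

variable {x y z p b : X} {sxp spz sxz spy syz : Set X}

/-- Every point of the two outer sides is a combination of x with one end of the common side: with p
on [x, p], with z on [x, z]. -/
theorem seen_left (h : IsTriangle U K x p z sxp spz sxz) (hB : BoundAbove K x p z sxp spz sxz)
    {g : ℝ} (hg : g * sn K (tauR p z) = md K (tauR x z) - md K (tauR x p) - md K (tauR p z)
      - K * md K (tauR x p) * md K (tauR p z)) :
    (∀ b ∈ sxp, Seen K (tauR p z) (md K (tauR x p)) g p spz b (lCoef K (tauR x p) (tauR x b))
      (rCoef K (tauR x p) (tauR x b)) (cCoef K (tauR x p) (tauR x b)) 0 0) ∧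
    ∀ b ∈ sxz, Seen K (tauR p z) (md K (tauR x p)) g p spz b (lCoef K (tauR x z) (tauR x b))
      (rCoef K (tauR x z) (tauR x b)) (cCoef K (tauR x z) (tauR x b)) (md K (tauR p z))
      (-sn K (tauR p z)) := by
  obtain ⟨x', p', z', nx, np, nz, hm⟩ := h.exists_model
  have s₁ := (sn_pos hm.pos₁ hm.inRange₁).ne'
  have s₃ := (sn_pos hm.pos₃ hm.inRange).ne'
  constructor
  · intro b hb
    have t0 := tauR_nonneg x b
    have t1 := h.side₁.tauR_le h.finite hb
    obtain ⟨b', nb, hb'⟩ := exists_isOnSegment nx np hm.rel₁ hm.pos₁ hm.inRange₁ hm.world₁ t0 t1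
    have mb : h.Matches x' p' z' b b' := Or.inl ⟨hb, hb'⟩
    exact seen_of_model np nz nb hm.rel₂ hm.world₂ hm.pos₂ hm.inRange₂
      (fun r q' r0 r1 hq => hm.two_add_pos mb.isOnTriangle (Or.inr (Or.inl ⟨r, r0, r1, hq⟩)))
      (fun q hq q' hq' => ⟨h.mdLe hB hm mb (Or.inr (Or.inl ⟨hq, hq'⟩)),
        h.mdLe hB hm (Or.inr (Or.inl ⟨hq, hq'⟩)) mb⟩)
      hm.world₁ (by rw [hg, hm.world₃]) (lCoef_nonneg hm.inRange₁ t0 t1)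
      (rCoef_nonneg hm.inRange₁ t0 t1) (coef_add s₁) (by rw [coef_quadratic s₁, hm.world₁])
      (hb'.world_eq hm.world₁ s₁) (Or.inl ⟨rfl, rfl, rfl⟩)
  · intro b hb
    have t0 := tauR_nonneg x b
    have t1 := h.side₃.tauR_le h.finite hb
    obtain ⟨b', nb, hb'⟩ := exists_isOnSegment nx nz hm.rel₃ hm.pos₃ hm.inRange hm.world₃ t0 t1
    have mb : h.Matches x' p' z' b b' := Or.inr (Or.inr ⟨hb, hb'⟩)
    exact seen_of_model np nz nb hm.rel₂ hm.world₂ hm.pos₂ hm.inRange₂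
      (fun r q' r0 r1 hq => hm.two_add_pos mb.isOnTriangle (Or.inr (Or.inl ⟨r, r0, r1, hq⟩)))
      (fun q hq q' hq' => ⟨h.mdLe hB hm mb (Or.inr (Or.inl ⟨hq, hq'⟩)),
        h.mdLe hB hm (Or.inr (Or.inl ⟨hq, hq'⟩)) mb⟩)
      hm.world₁ (by rw [hg, hm.world₃]) (lCoef_nonneg hm.inRange t0 t1)
      (rCoef_nonneg hm.inRange t0 t1) (coef_add s₃) (by rw [coef_quadratic s₃, hm.world₃])
      (hb'.world_eq hm.world₃ s₃) (Or.inr ⟨rfl, rfl, rfl⟩)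

/-- Instead of transitivity in the model, the reverse triangle inequality makes `world` positive;
the time coordinate of y' then excludes the reversed order. -/
theorem rel_left_of_side (h : IsTriangle U K p y z spy syz spz) {p' y' z' a' : ℝ × ℝ}
    (hm : IsModelTriangle K (tauR p y) (tauR y z) (tauR p z) p' y' z') (np : Near K p')
    (na : Near K a') {a : X} (ha : a ∈ syz)
    (ha' : IsOnSegment K y' z' (tauR y z) (tauR y a) a') : Rel K p' a' := by
  have t0 := tauR_nonneg y a
  have t1 := h.side₂.tauR_le h.finite ha
  have ma : h.Matches p' y' z' a a' := Or.inr (Or.inl ⟨ha, ha'⟩)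
  have mp : h.Matches p' y' z' p p' := Or.inl ⟨h.side₁.left_mem, by
    rw [h.finite.tauR_self h.mem_x]
    exact ⟨Rel.refl _, hm.rel₁, by rw [world_self, md_zero], by rw [sub_zero, hm.world₁]⟩⟩
  have w := md_add_le_world hm.rel₁ ha'.rel_left hm.world₁ ha'.world_left
  have wp : 0 < world K p' a' := lt_of_lt_of_le
    (md_pos (by linarith [hm.pos₁]) (hm.inRange.mono (by linarith [hm.add_le]))) w
  rcases np.rel_or na wp (hm.two_add_pos mp.isOnTriangle ma.isOnTriangle).le with hR | hR
  · exact hR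
  · have := world_nonpos_of_fst_eq (K := K) (p := p') (q := y')
      (le_antisymm (ha'.rel_left.1.fst_le.trans hR.1.fst_le) hm.rel₁.1.fst_le)
    rw [hm.world₁] at this
    linarith [md_pos hm.pos₁ hm.inRange₁]

/-- The combinations are based at y. Since [p, y] starts at p, the two weights exchange roles there.
The extra bound from p serves the path through p. -/
theorem seen_right (h : IsTriangle U K p y z spy syz spz) (hB : BoundAbove K p y z spy syz spz)
    {g : ℝ} (hg : g * sn K (tauR p z) = md K (tauR y z) - md K (tauR p y) - md K (tauR p z)
      - K * md K (tauR p y) * md K (tauR p z)) :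
    (∀ a ∈ spy, Seen K (tauR p z) (md K (tauR p y)) g p spz a (rCoef K (tauR p y) (tauR p a))
        (lCoef K (tauR p y) (tauR p a)) (cCoef K (tauR p y) (tauR p a)) 0 0 ∧
      MdLe K (rCoef K (tauR p y) (tauR p a) * md K (tauR p y) + lCoef K (tauR p y) (tauR p a) * 0
        - cCoef K (tauR p y) (tauR p a)) p a) ∧
    ∀ a ∈ syz, Seen K (tauR p z) (md K (tauR p y)) g p spz a (lCoef K (tauR y z) (tauR y a))
        (rCoef K (tauR y z) (tauR y a)) (cCoef K (tauR y z) (tauR y a)) (md K (tauR p z))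
        (-sn K (tauR p z)) ∧
      MdLe K (lCoef K (tauR y z) (tauR y a) * md K (tauR p y)
        + rCoef K (tauR y z) (tauR y a) * md K (tauR p z) - cCoef K (tauR y z) (tauR y a)) p a := by
  obtain ⟨p', y', z', np, ny, nz, hm⟩ := h.exists_model
  have s₁ := (sn_pos hm.pos₁ hm.inRange₁).ne'
  have s₂ := (sn_pos hm.pos₂ hm.inRange₂).ne'
  have yp : world K y' p' = md K (tauR p y) := by rw [world_comm, hm.world₁]
  have mp : h.Matches p' y' z' p p' := Or.inl ⟨h.side₁.left_mem, by
    rw [h.finite.tauR_self h.mem_x]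
    exact ⟨Rel.refl _, hm.rel₁, by rw [world_self, md_zero], by rw [sub_zero, hm.world₁]⟩⟩
  constructor
  · intro a ha
    have t0 := tauR_nonneg p a
    have t1 := h.side₁.tauR_le h.finite ha
    obtain ⟨a', na, ha'⟩ := exists_isOnSegment np ny hm.rel₁ hm.pos₁ hm.inRange₁ hm.world₁ t0 t1
    have ma : h.Matches p' y' z' a a' := Or.inl ⟨ha, ha'⟩
    constructor
    · exact seen_of_model np nz na hm.rel₃ hm.world₃ hm.pos₃ hm.inRange
        (fun r q' r0 r1 hq => hm.two_add_pos ma.isOnTriangle (Or.inr (Or.inr ⟨r, r0, r1, hq⟩)))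
        (fun q hq q' hq' => ⟨h.mdLe hB hm ma (Or.inr (Or.inr ⟨hq, hq'⟩)),
          h.mdLe hB hm (Or.inr (Or.inr ⟨hq, hq'⟩)) ma⟩)
        yp (by rw [hg, hm.world₂]) (rCoef_nonneg hm.inRange₁ t0 t1)
        (lCoef_nonneg hm.inRange₁ t0 t1) (by rw [← coef_add (K := K) (t := tauR p a) s₁]; ring)
        (by rw [coef_quadratic s₁, yp]; ring)
        (fun o => by rw [ha'.world_eq hm.world₁ s₁]; ring) (Or.inl ⟨rfl, rfl, rfl⟩)
    · have := h.mdLe hB hm mp ma ha'.rel_left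
      rw [world_comm, ha'.world_eq hm.world₁ s₁, world_self, yp] at this
      rwa [add_comm (rCoef K _ _ * _)]
  · intro a ha
    have t0 := tauR_nonneg y a
    have t1 := h.side₂.tauR_le h.finite ha
    obtain ⟨a', na, ha'⟩ := exists_isOnSegment ny nz hm.rel₂ hm.pos₂ hm.inRange₂ hm.world₂ t0 t1
    have ma : h.Matches p' y' z' a a' := Or.inr (Or.inl ⟨ha, ha'⟩)
    constructor
    · exact seen_of_model np nz na hm.rel₃ hm.world₃ hm.pos₃ hm.inRange
        (fun r q' r0 r1 hq => hm.two_add_pos ma.isOnTriangle (Or.inr (Or.inr ⟨r, r0, r1, hq⟩)))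
        (fun q hq q' hq' => ⟨h.mdLe hB hm ma (Or.inr (Or.inr ⟨hq, hq'⟩)),
          h.mdLe hB hm (Or.inr (Or.inr ⟨hq, hq'⟩)) ma⟩)
        yp (by rw [hg, hm.world₂]) (lCoef_nonneg hm.inRange₂ t0 t1)
        (rCoef_nonneg hm.inRange₂ t0 t1) (coef_add s₂) (by rw [coef_quadratic s₂, hm.world₂])
        (ha'.world_eq hm.world₂ s₂) (Or.inr ⟨rfl, rfl, rfl⟩)
    · have := h.mdLe hB hm mp ma (h.rel_left_of_side hm np na ha ha')
      rwa [world_comm, ha'.world_eq hm.world₂ s₂, yp, world_comm z' p', hm.world₃] at this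

end IsTriangle

/-- Two comparison triangles glued along the side from `p` to `z`. -/
theorem IsTriangle.slope_le_of_seen {x y z p : X} {spz : Set X} {a b c e gx gy Hx Hy : ℝ}
    (hU : TauFiniteContinuousOn U) (hx : x ∈ U) (hy : y ∈ U)
    (G : Glue K a b c (tauR p z) e gx gy Hx Hy) (hS : IsSide U p z spz)
    (hxy : causal x y) (hab : tauR x y = a + b) (habc : a + b ≤ c)
    (sx : Seen K (tauR p z) (md K a) gx p spz x 1 0 0 0 0)
    (sy : Seen K (tauR p z) (md K b) gy p spz y 1 0 0 0 0) :
    gx * sn K b ≤ -gy * sn K a := by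
  have hyx : tauR y x = 0 := by
    have h := hU.tauR_add_le hx hy hx hxy
    by_contra h0
    have h1 := lt_of_le_of_ne (tauR_nonneg y x) (Ne.symm h0)
    have h2 := h (causal_of_chron _ _ (chron_of_tauR_pos h1))
    rw [hU.tauR_self hx] at h2
    linarith [tauR_nonneg x y]
  refine G.slope_le fun hL => ?_
  obtain ⟨f₁, g₁, C₁, s₁, p₁⟩ := sx
  obtain ⟨f₂, g₂, C₂, s₂, p₂⟩ := sy
  have e1 : f₁ = md K a := by rw [C₁.hf]; ring
  have e2 : g₁ = gx := by rw [C₁.hg]; ring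
  have e3 : f₂ = md K b := by rw [C₂.hf]; ring
  have e4 : g₂ = gy := by rw [C₂.hg]; ring
  rw [e1, e2] at s₁ p₁
  rw [e3, e4] at s₂ p₂
  have hgy : gy < 0 := by linarith [G.gy_le, G.sb]
  have := Sees.crossing hU hS rfl G.hd (G.hr.mono (by linarith [G.ha, G.hac])) hy hx G.hr
    (by rw [hab]; exact habc) (by rw [hyx]; exact G.hc.le) s₁ s₂ G.Hx0 G.Hy0 G.Hx2 G.Hy2 p₁ p₂
    G.raySlope_x G.raySlope_y hgy.le hL (Or.inl hgy)
  rw [hab, hyx, md_zero] at this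
  rcases this with h | h
  · exact h
  · exact h.trans (md_nonneg (by linarith [G.ha, G.hb]) (G.hr.mono habc))

theorem Seen.le_or_le {p z a b : X} {S : Set X} {a₀ b₀ c e gx gy Hx Hy : ℝ}
    (hU : TauFiniteContinuousOn U) (G : Glue K a₀ b₀ c (tauR p z) e gx gy Hx Hy)
    (hS : IsSide U p z S) (ha : a ∈ U) (hb : b ∈ U) (hba : tauR b a ≤ c) (hab : tauR a b ≤ c)
    {l₁ m₁ k₁ fe₁ ge₁ l₂ m₂ k₂ fe₂ ge₂ w : ℝ}
    (sb : Seen K (tauR p z) (md K a₀) gx p S b l₁ m₁ k₁ fe₁ ge₁)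
    (sa : Seen K (tauR p z) (md K b₀) gy p S a l₂ m₂ k₂ fe₂ ge₂ ∧
      MdLe K (l₂ * md K b₀ + m₂ * fe₂ - k₂) p a)
    (hpa : causal p a) (haz : causal a z) (hw0 : 0 < w)
    (hw : 0 ≤ l₁ → 0 ≤ m₁ → 0 ≤ l₂ → 0 ≤ m₂ → w ≤ l₁ * (l₂ * md K (a₀ + b₀)
        + m₂ * (md K a₀ + fe₂ + K * md K a₀ * fe₂ - gx * ge₂) - k₂) +
      m₁ * (l₂ * (fe₁ + md K b₀ + K * fe₁ * md K b₀ - ge₁ * gy)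
        + m₂ * (fe₁ + fe₂ + K * fe₁ * fe₂ - ge₁ * ge₂) - k₂) - k₁) :
    w ≤ md K (tauR b a) ∨ w ≤ md K (tauR a b) := by
  obtain ⟨f₁, g₁, C₁, s₁, p₁⟩ := sb
  obtain ⟨⟨f₂, g₂, C₂, s₂, p₂⟩, hM⟩ := sa
  rw [← C₂.hf] at hM
  exact G.le_or_le hU hS rfl ha hb hba hab C₁ C₂ s₁ s₂ p₁ p₂ hpa
    (hU.tauR_le (hS.1 hS.left_mem) (hS.1 hS.left_mem) ha (hS.1 hS.right_mem) (causal_refl p) haz)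
    hM (hw C₁.hl C₁.hm C₂.hl C₂.hm) hw0

end Seen

/-! ### The gluing lemma. -/

section GluingLemma

variable {X : Type*} [EMetricSpace X] [LorentzianPreLengthSpace X] {U : Set X} {K : ℝ}

/-- The function `o ↦ world K q o` for the point `q` dividing the segment from `u` to `v`. -/
noncomputable def segWorld (K L t : ℝ) (u v o : ℝ × ℝ) : ℝ :=
  lCoef K L t * world K u o + rCoef K L t * world K v o - cCoef K L t

/-- The dividing point of the straightened side is used only through its distance function, and this
function obeys the same affine rule in its other argument. -/
theorem segWorld_of_combo {L t : ℝ} (hL : sn K L ≠ 0) {u v v' e' a' : ℝ × ℝ} {l m k : ℝ}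
    (hs : l + m + K * k = 1)
    (ha : ∀ o, world K a' o = l * world K v' o + m * world K e' o - k) :
    segWorld K L t u v a' = l * segWorld K L t u v v' + m * segWorld K L t u v e' - k := by
  unfold segWorld
  rw [world_comm u a', world_comm v a', ha, ha, world_comm u v', world_comm u e', world_comm v v',
    world_comm v e']
  linear_combination -k * coef_add (K := K) (t := t) hL + cCoef K L t * hs

namespace IsOnSegment

variable {u v a' : ℝ × ℝ} {a b t : ℝ}

/-- Change of base: a point on the first part of a divided segment is a combination of the initial
point and the dividing point, with the weights of that part alone. -/
theorem world_eq_of_le (h : IsOnSegment K u v (a + b) t a') (huv : world K u v = md K (a + b))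
    (ha : sn K a ≠ 0) (hab : sn K (a + b) ≠ 0) (o : ℝ × ℝ) :
    world K a' o = lCoef K a t * world K u o + rCoef K a t * segWorld K (a + b) a u v o
      - cCoef K a t := by
  rw [h.world_eq huv hab]
  have e1 : lCoef K (a + b) t = lCoef K a t + rCoef K a t * lCoef K (a + b) a := by
    unfold lCoef rCoef
    rw [add_sub_cancel_left]
    field_simp
    rw [sn_sub, sn_sub, sn_add, md_add]
    linear_combination -K * sn K t * sn K b * sn_sq (K := K) a
  have e2 : rCoef K (a + b) t = rCoef K a t * rCoef K (a + b) a := by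
    unfold rCoef
    field_simp
  unfold segWorld
  rw [e1]
  unfold cCoef
  rw [e2]
  ring

theorem world_eq_of_ge (h : IsOnSegment K u v (a + b) (a + t) a')
    (huv : world K u v = md K (a + b)) (hb : sn K b ≠ 0) (hab : sn K (a + b) ≠ 0) (o : ℝ × ℝ) :
    world K a' o = rCoef K b t * world K v o + lCoef K b t * segWorld K (a + b) a u v o
      - cCoef K b t := by
  rw [h.world_eq huv hab]
  have e1 : lCoef K (a + b) (a + t) = lCoef K b t * lCoef K (a + b) a := by
    unfold lCoef
    rw [add_sub_cancel_left, add_sub_add_left_eq_sub]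
    field_simp
  have e2 : rCoef K (a + b) (a + t) = rCoef K b t + lCoef K b t * rCoef K (a + b) a := by
    unfold lCoef rCoef
    field_simp
    rw [sn_sub, sn_add, sn_add]
    ring
  have e3 : cCoef K (a + b) (a + t) = cCoef K b t + lCoef K b t * cCoef K (a + b) a := by
    unfold cCoef
    rw [e2]
    have e4 : rCoef K b t * md K (a + b) - md K (a + t) + lCoef K b t * md K a
        = rCoef K b t * md K b - md K t := by
      unfold lCoef rCoef
      field_simp
      rw [sn_sub, md_add, md_add]
      ring
    linear_combination e4
  unfold segWorld
  rw [e1, e2, e3]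
  ring

end IsOnSegment

/-- In X the distance is exactly the difference of the parameters, and in the model it is at most
that. -/
theorem IsSide.le_or_le (hU : TauFiniteContinuousOn U) {u v a b : X} {S : Set X}
    (h : IsSide U u v S) (ha : a ∈ S) (hb : b ∈ S) {u' v' w' a' b' : ℝ × ℝ} {L M : ℝ}
    (ha' : IsOnSegment K u' v' L (tauR u a) a') (hb' : IsOnSegment K u' w' M (tauR u b) b') :
    world K a' b' ≤ md K (tauR b a) ∨ world K a' b' ≤ md K (tauR a b) := by
  have hu := h.1 h.left_mem
  have haU := h.1 ha
  have hbU := h.1 hb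
  have h1 := world_le_md_sub_future ha'.rel_left hb'.rel_left ha'.world_left hb'.world_left
  rcases h.tau_add_or ha hb with h2 | h2
  · have h3 : tauR u a + tauR a b = tauR u b := by
      unfold tauR
      rw [← ENNReal.toReal_add (hU.1 _ hu _ haU) (hU.1 _ haU _ hbU), h2]
    rw [← h3, sub_add_cancel_left, md_neg] at h1
    exact Or.inr h1
  · have h3 : tauR u b + tauR b a = tauR u a := by
      unfold tauR
      rw [← ENNReal.toReal_add (hU.1 _ hu _ hbU) (hU.1 _ hbU _ haU), h2]
    rw [← h3, add_sub_cancel_left] at h1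
    exact Or.inl h1

namespace IsTriangle

variable {x y z p a b : X} {sxy syz sxz sxp spy spz : Set X}

theorem tauR_le_of_matches (h : IsTriangle U K x y z sxy syz sxz) {x' y' z' a' b' : ℝ × ℝ}
    (ha : h.Matches x' y' z' a a') (hb : h.Matches x' y' z' b b') : tauR a b ≤ tauR x z :=
  h.finite.tauR_le h.mem_x ha.mem hb.mem h.mem_z ha.causal_left hb.causal_right

theorem le_or_le_of_near (h : IsTriangle U K x y z sxy syz sxz) (hB : BoundAbove K x y z sxy syz sxz)
    {x' y' z' a' b' : ℝ × ℝ} (hm : IsModelTriangle K (tauR x y) (tauR y z) (tauR x z) x' y' z')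
    (na : Near K a') (nb : Near K b') (ha : h.Matches x' y' z' a a') (hb : h.Matches x' y' z' b b')
    {w : ℝ} (hw0 : 0 < w) (hw : w ≤ world K a' b') :
    w ≤ md K (tauR b a) ∨ w ≤ md K (tauR a b) := by
  rcases na.rel_or nb (hw0.trans_le hw) (hm.two_add_pos ha.isOnTriangle hb.isOnTriangle).le
    with hR | hR
  · exact Or.inr (hw.trans ((h.mdLe hB hm ha hb hR).le
      (h.inRange.mono (h.tauR_le_of_matches ha hb))))
  · rw [world_comm] at hw
    exact Or.inl (hw.trans ((h.mdLe hB hm hb ha hR).le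
      (h.inRange.mono (h.tauR_le_of_matches hb ha))))

/-- Both points lie on Δ(x, p, z), so its own curvature bound applies; the bound for w is the
Stewart expansion in that comparison triangle. -/
theorem le_or_le_apex (h : IsTriangle U K x p z sxp spz sxz) (hB : BoundAbove K x p z sxp spz sxz)
    (ha : a ∈ sxp) (hb : b ∈ sxz) {w : ℝ} (hw0 : 0 < w)
    (hw : w ≤ lCoef K (tauR x p) (tauR x a) * (rCoef K (tauR x z) (tauR x b) * md K (tauR x z)
        - cCoef K (tauR x z) (tauR x b))
      + rCoef K (tauR x p) (tauR x a) * (lCoef K (tauR x z) (tauR x b) * md K (tauR x p)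
        + rCoef K (tauR x z) (tauR x b) * md K (tauR p z) - cCoef K (tauR x z) (tauR x b))
      - cCoef K (tauR x p) (tauR x a)) :
    w ≤ md K (tauR b a) ∨ w ≤ md K (tauR a b) := by
  obtain ⟨x', p', z', nx, np, nz, hm⟩ := h.exists_model
  obtain ⟨a', na, ha'⟩ := exists_isOnSegment nx np hm.rel₁ hm.pos₁ hm.inRange₁ hm.world₁
    (tauR_nonneg x a) (h.side₁.tauR_le h.finite ha)
  obtain ⟨b', nb, hb'⟩ := exists_isOnSegment nx nz hm.rel₃ hm.pos₃ hm.inRange hm.world₃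
    (tauR_nonneg x b) (h.side₃.tauR_le h.finite hb)
  refine h.le_or_le_of_near hB hm na nb (Or.inl ⟨ha, ha'⟩) (Or.inr (Or.inr ⟨hb, hb'⟩)) hw0
    (hw.trans (le_of_eq ?_))
  have hb'' := hb'.world_eq hm.world₃ (sn_pos hm.pos₃ hm.inRange).ne'
  rw [ha'.world_eq hm.world₁ (sn_pos hm.pos₁ hm.inRange₁).ne', world_comm x' b', world_comm p' b',
    hb'', hb'', world_self, world_comm z', world_comm z', hm.world₁, hm.world₂, hm.world₃]
  ring

theorem le_or_le_corner (h : IsTriangle U K p y z spy syz spz)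
    (hB : BoundAbove K p y z spy syz spz) (ha : a ∈ spy) (hb : b ∈ syz) {w : ℝ} (hw0 : 0 < w)
    (hw : w ≤ rCoef K (tauR p y) (tauR p a) * (rCoef K (tauR y z) (tauR y b) * md K (tauR y z)
        - cCoef K (tauR y z) (tauR y b))
      + lCoef K (tauR p y) (tauR p a) * (lCoef K (tauR y z) (tauR y b) * md K (tauR p y)
        + rCoef K (tauR y z) (tauR y b) * md K (tauR p z) - cCoef K (tauR y z) (tauR y b))
      - cCoef K (tauR p y) (tauR p a)) :
    w ≤ md K (tauR b a) ∨ w ≤ md K (tauR a b) := by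
  obtain ⟨p', y', z', np, ny, nz, hm⟩ := h.exists_model
  obtain ⟨a', na, ha'⟩ := exists_isOnSegment np ny hm.rel₁ hm.pos₁ hm.inRange₁ hm.world₁
    (tauR_nonneg p a) (h.side₁.tauR_le h.finite ha)
  obtain ⟨b', nb, hb'⟩ := exists_isOnSegment ny nz hm.rel₂ hm.pos₂ hm.inRange₂ hm.world₂
    (tauR_nonneg y b) (h.side₂.tauR_le h.finite hb)
  refine h.le_or_le_of_near hB hm na nb (Or.inl ⟨ha, ha'⟩) (Or.inr (Or.inl ⟨hb, hb'⟩)) hw0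
    (hw.trans (le_of_eq ?_))
  have hb'' := hb'.world_eq hm.world₂ (sn_pos hm.pos₂ hm.inRange₂).ne'
  rw [ha'.world_eq hm.world₁ (sn_pos hm.pos₁ hm.inRange₁).ne', world_comm p' b', world_comm y' b',
    hb'', hb'', world_self, world_comm z', world_comm z', world_comm y' p', hm.world₁, hm.world₂,
    hm.world₃]
  ring

/-- The gluing lemma for a point `p` on the side from `x` to `y`. -/
theorem boundAbove_of_glue (t₁ : IsTriangle U K x p z sxp spz sxz)
    (t₂ : IsTriangle U K p y z spy syz spz) (t : IsTriangle U K x y z (sxp ∪ spy) syz sxz)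
    (hadd : tauR x p + tauR p y = tauR x y) (hadd' : ∀ a ∈ spy, tauR x p + tauR p a = tauR x a)
    (B₁ : BoundAbove K x p z sxp spz sxz) (B₂ : BoundAbove K p y z spy syz spz) :
    BoundAbove K x y z (sxp ∪ spy) syz sxz := by
  obtain ⟨gx, gy, Hx, Hy, G⟩ := Glue.exists_of_le t₁.pos₁ t₂.pos₁ t₁.pos₂ t₂.pos₂ t₁.add_le
    t₂.add_le t₁.inRange
  obtain ⟨L₁, L₃⟩ := t₁.seen_left B₁ G.egx
  obtain ⟨R₁, R₂⟩ := t₂.seen_right B₂ G.egy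
  have habc : tauR x p + tauR p y ≤ tauR x z := by linarith [t.add_le, t.pos₂]
  -- The angle condition, obtained from the vertices x and y themselves, with weights 1, 0, 0.
  have hs := IsTriangle.slope_le_of_seen t.finite t.mem_x t.mem_y G t₁.side₂
    (causal_of_chron _ _ t.chron₁) hadd.symm habc (by
      have h := L₁ x t₁.side₁.left_mem
      have s := G.sa.ne'
      rw [t.finite.tauR_self t.mem_x] at h
      simpa [lCoef, rCoef, cCoef, s] using h) (by
      have h := (R₁ y t₂.side₁.right_mem).1
      have s := G.sb.ne'
      simpa [lCoef, rCoef, cCoef, s] using h)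
  have hz := G.straightened_le habc hs
  refine t.boundAbove_of_le_or_le fun x' y' z' hm a b a' b' ha hb hw => ?_
  have sab : sn K (tauR x p + tauR p y) ≠ 0 :=
    (sn_pos (by linarith [G.ha, G.hb]) (t.inRange.mono habc)).ne'
  have wxy : world K x' y' = md K (tauR x p + tauR p y) := by rw [hadd, hm.world₁]
  have wyx : world K y' x' = md K (tauR x p + tauR p y) := by rw [world_comm, wxy]
  have wyz := hm.world₂
  have wzy : world K z' y' = md K (tauR y z) := by rw [world_comm, wyz]
  have wxz := hm.world₃
  have wzx : world K z' x' = md K (tauR x z) := by rw [world_comm, wxz]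
  have qx : segWorld K (tauR x p + tauR p y) (tauR x p) x' y' x' = md K (tauR x p) := by
    unfold segWorld
    rw [world_self, wyx, mul_zero, zero_add, rCoef_mul_sub]
  have qy : segWorld K (tauR x p + tauR p y) (tauR x p) x' y' y' = md K (tauR p y) := by
    unfold segWorld
    rw [world_self, wxy, mul_zero, add_zero, lCoef_mul_sub sab, add_sub_cancel_left]
  -- Straightening leaves the distances of the dividing point to x' and y' as they were and can only
  -- decrease that to z'.
  have qz : segWorld K (tauR x p + tauR p y) (tauR x p) x' y' z' ≤ md K (tauR p z) := by
    unfold segWorld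
    rwa [wyz, wxz]
  have sc := G.sc.ne'
  have se := G.se.ne'
  have sa := G.sa.ne'
  have sb := G.sb.ne'
  -- The letters A, B, C, D stand for [x, p], [p, y], [y, z], [x, z].
  have eA : ∀ a a', IsOnSegment K x' y' (tauR x y) (tauR x a) a' → ∀ o, world K a' o =
      lCoef K (tauR x p) (tauR x a) * world K x' o + rCoef K (tauR x p) (tauR x a) *
        segWorld K (tauR x p + tauR p y) (tauR x p) x' y' o - cCoef K (tauR x p) (tauR x a) :=
    fun a a' ha => (hadd ▸ ha).world_eq_of_le wxy sa sab
  have eB : ∀ a ∈ spy, ∀ a', IsOnSegment K x' y' (tauR x y) (tauR x a) a' → ∀ o, world K a' o =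
      rCoef K (tauR p y) (tauR p a) * world K y' o + lCoef K (tauR p y) (tauR p a) *
        segWorld K (tauR x p + tauR p y) (tauR x p) x' y' o - cCoef K (tauR p y) (tauR p a) := by
    intro a hm a' ha
    rw [← hadd, ← hadd' a hm] at ha
    exact ha.world_eq_of_ge wxy sb sab
  have eC : ∀ a a', IsOnSegment K y' z' (tauR y z) (tauR y a) a' → ∀ o, world K a' o =
      lCoef K (tauR y z) (tauR y a) * world K y' o + rCoef K (tauR y z) (tauR y a) * world K z' o
        - cCoef K (tauR y z) (tauR y a) := fun a a' ha => ha.world_eq wyz se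
  have eD : ∀ a a', IsOnSegment K x' z' (tauR x z) (tauR x a) a' → ∀ o, world K a' o =
      lCoef K (tauR x z) (tauR x a) * world K x' o + rCoef K (tauR x z) (tauR x a) * world K z' o
        - cCoef K (tauR x z) (tauR x a) := fun a a' ha => ha.world_eq wxz sc
  have qC := fun a a' (ha : IsOnSegment K y' z' (tauR y z) (tauR y a) a') =>
    segWorld_of_combo (t := tauR x p) sab (coef_add se) (u := x') (v := y') (eC a a' ha)
  have qD := fun a a' (ha : IsOnSegment K x' z' (tauR x z) (tauR x a) a') =>
    segWorld_of_combo (t := tauR x p) sab (coef_add sc) (u := x') (v := y') (eD a a' ha)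
  have ex : md K (tauR x p) + md K (tauR p z) + K * md K (tauR x p) * md K (tauR p z)
      - gx * -sn K (tauR p z) = md K (tauR x z) := by linarith [G.egx]
  have ey : md K (tauR p z) + md K (tauR p y) + K * md K (tauR p z) * md K (tauR p y)
      - -sn K (tauR p z) * gy = md K (tauR y z) := by linarith [G.egy]
  have ed := sn_sq (K := K) (tauR p z)
  -- The pairs AC, DC, DB lie on different small triangles and use the crossing argument. For AC and
  -- DB the straightened and glued expansions differ only in the term controlled by `qz`; for DC
  -- they agree.
  have pAC : ∀ b b' a a', t.Matches x' y' z' b b' → t.Matches x' y' z' a a' → b ∈ sxp →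
      IsOnSegment K x' y' (tauR x y) (tauR x b) b' → a ∈ syz →
      IsOnSegment K y' z' (tauR y z) (tauR y a) a' → 0 < world K b' a' →
      world K b' a' ≤ md K (tauR b a) ∨ world K b' a' ≤ md K (tauR a b) := by
    intro b b' a a' hb ha hbS hb' haS ha' hw
    refine Seen.le_or_le t.finite G t₁.side₂ ha.mem hb.mem (t.tauR_le_of_matches hb ha)
      (t.tauR_le_of_matches ha hb) (L₁ b hbS) (R₂ a haS)
      (causal_trans _ _ _ (causal_of_chron _ _ t₂.chron₁) (t₂.side₂.causal_left haS))
      (t₂.side₂.causal_right haS) hw fun l₁ m₁ l₂ m₂ => ?_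
    rw [eA b b' hb' a', world_comm x' a', eC a a' ha', wyx, wzx, qC a a' ha', qy, ex]
    have := mul_le_mul_of_nonneg_left qz (mul_nonneg m₁ m₂)
    linarith
  have pDC : ∀ b b' a a', t.Matches x' y' z' b b' → t.Matches x' y' z' a a' → b ∈ sxz →
      IsOnSegment K x' z' (tauR x z) (tauR x b) b' → a ∈ syz →
      IsOnSegment K y' z' (tauR y z) (tauR y a) a' → 0 < world K b' a' →
      world K b' a' ≤ md K (tauR b a) ∨ world K b' a' ≤ md K (tauR a b) := by
    intro b b' a a' hb ha hbS hb' haS ha' hw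
    refine Seen.le_or_le t.finite G t₁.side₂ ha.mem hb.mem (t.tauR_le_of_matches hb ha)
      (t.tauR_le_of_matches ha hb) (L₃ b hbS) (R₂ a haS)
      (causal_trans _ _ _ (causal_of_chron _ _ t₂.chron₁) (t₂.side₂.causal_left haS))
      (t₂.side₂.causal_right haS) hw fun _ _ _ _ => ?_
    rw [eD b b' hb' a', world_comm x' a', world_comm z' a', eC a a' ha', eC a a' ha', wyx, wzx, wyz,
      world_self, ex, ey]
    refine le_of_eq ?_
    linear_combination rCoef K (tauR x z) (tauR x b) * rCoef K (tauR y z) (tauR y a) * ed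
  have pDB : ∀ b b' a a', t.Matches x' y' z' b b' → t.Matches x' y' z' a a' → b ∈ sxz →
      IsOnSegment K x' z' (tauR x z) (tauR x b) b' → a ∈ spy →
      IsOnSegment K x' y' (tauR x y) (tauR x a) a' → 0 < world K b' a' →
      world K b' a' ≤ md K (tauR b a) ∨ world K b' a' ≤ md K (tauR a b) := by
    intro b b' a a' hb ha hbS hb' haS ha' hw
    refine Seen.le_or_le t.finite G t₁.side₂ ha.mem hb.mem (t.tauR_le_of_matches hb ha)
      (t.tauR_le_of_matches ha hb) (L₃ b hbS) (R₁ a haS) (t₂.side₁.causal_left haS)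
      (causal_trans _ _ _ (t₂.side₁.causal_right haS) (causal_of_chron _ _ t₂.chron₂))
      hw fun l₁ m₁ l₂ m₂ => ?_
    rw [world_comm b' a', eB a haS a' ha', world_comm y' b', eD b b' hb', wxy, wzy, qD b b' hb', qx,
      ey]
    have e₁ := coef_add (K := K) (t := tauR x b) sc
    have e₂ := coef_add (K := K) (t := tauR p a) sb
    have e₃ : (lCoef K (tauR x z) (tauR x b) + rCoef K (tauR x z) (tauR x b)) *
          cCoef K (tauR p y) (tauR p a) + cCoef K (tauR x z) (tauR x b) =
        (lCoef K (tauR p y) (tauR p a) + rCoef K (tauR p y) (tauR p a)) *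
          cCoef K (tauR x z) (tauR x b) + cCoef K (tauR p y) (tauR p a) := by
      linear_combination cCoef K (tauR p y) (tauR p a) * e₁ - cCoef K (tauR x z) (tauR x b) * e₂
    have := mul_le_mul_of_nonneg_left qz (mul_nonneg m₁ m₂)
    linarith
  -- The pairs AD and BC lie on one small triangle, so its curvature bound and `qz` suffice.
  have pAD : ∀ b b' a a', b ∈ sxp →
      IsOnSegment K x' y' (tauR x y) (tauR x b) b' → a ∈ sxz →
      IsOnSegment K x' z' (tauR x z) (tauR x a) a' → 0 < world K b' a' →
      world K b' a' ≤ md K (tauR a b) ∨ world K b' a' ≤ md K (tauR b a) := by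
    intro b b' a a' hbS hb' haS ha' hw
    refine t₁.le_or_le_apex B₁ hbS haS hw ?_
    have l₁ := rCoef_nonneg (t₁.inRange.mono (by linarith [t₁.add_le, t₁.pos₂])) (tauR_nonneg x b)
      (t₁.side₁.tauR_le t.finite hbS)
    have l₂ := rCoef_nonneg t₁.inRange (tauR_nonneg x a) (t₁.side₃.tauR_le t.finite haS)
    rw [eA b b' hb' a', world_comm x' a', eD a a' ha', world_self, wzx, qD a a' ha', qx]
    have := mul_le_mul_of_nonneg_left qz (mul_nonneg l₁ l₂)
    linarith
  have pBC : ∀ b b' a a', b ∈ spy →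
      IsOnSegment K x' y' (tauR x y) (tauR x b) b' → a ∈ syz →
      IsOnSegment K y' z' (tauR y z) (tauR y a) a' → 0 < world K b' a' →
      world K b' a' ≤ md K (tauR a b) ∨ world K b' a' ≤ md K (tauR b a) := by
    intro b b' a a' hbS hb' haS ha' hw
    refine t₂.le_or_le_corner B₂ hbS haS hw ?_
    have l₁ := lCoef_nonneg (t₂.inRange.mono (by linarith [t₂.add_le, t₂.pos₂])) (tauR_nonneg p b)
      (t₂.side₁.tauR_le t.finite hbS)
    have l₂ := rCoef_nonneg (t₂.inRange.mono (by linarith [t₂.add_le, t₂.pos₁])) (tauR_nonneg y a)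
      (t₂.side₂.tauR_le t.finite haS)
    rw [eB b hbS b' hb' a', world_comm y' a', eC a a' ha', world_self, wzy, qC a a' ha', qy]
    have := mul_le_mul_of_nonneg_left qz (mul_nonneg l₁ l₂)
    linarith
  have hw' : 0 < world K b' a' := by rwa [world_comm]
  have ha₀ := ha
  have hb₀ := hb
  rcases ha with ⟨ha, ha'⟩ | ⟨ha, ha'⟩ | ⟨ha, ha'⟩ <;>
    rcases hb with ⟨hb, hb'⟩ | ⟨hb, hb'⟩ | ⟨hb, hb'⟩
  · exact t.side₁.le_or_le t.finite ha hb ha' hb'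
  · rcases ha with ha | ha
    · exact (pAC _ _ _ _ ha₀ hb₀ ha ha' hb hb' hw).symm
    · exact pBC _ _ _ _ ha ha' hb hb' hw
  · rcases ha with ha | ha
    · exact pAD _ _ _ _ ha ha' hb hb' hw
    · rw [world_comm]
      exact pDB _ _ _ _ hb₀ ha₀ hb hb' ha ha' hw'
  · rw [world_comm]
    rcases hb with hb | hb
    · exact pAC _ _ _ _ hb₀ ha₀ hb hb' ha ha' hw'
    · exact (pBC _ _ _ _ hb hb' ha ha' hw').symm
  · exact t.side₂.le_or_le t.finite ha hb ha' hb'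
  · rw [world_comm]
    exact pDC _ _ _ _ hb₀ ha₀ hb hb' ha ha' hw'
  · rcases hb with hb | hb
    · rw [world_comm]
      exact (pAD _ _ _ _ hb hb' ha ha' hw').symm
    · exact (pDB _ _ _ _ ha₀ hb₀ ha ha' hb hb' hw).symm
  · exact (pDC _ _ _ _ ha₀ hb₀ ha ha' hb hb' hw).symm
  · exact t.side₃.le_or_le t.finite ha hb ha' hb'

end IsTriangle

end GluingLemma

/-! ### Reversal of the time orientation. -/

section TimeReversal

/-- A Lorentzian pre-length space with reversed time orientation. -/
def TimeDual (X : Type*) := X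

instance {X : Type*} [h : EMetricSpace X] : EMetricSpace (TimeDual X) := h

instance {X : Type*} [EMetricSpace X] [h : LorentzianPreLengthSpace X] :
    LorentzianPreLengthSpace (TimeDual X) where
  causal x y := h.causal y x
  chron x y := h.chron y x
  tau x y := h.tau y x
  causal_refl := h.causal_refl
  causal_trans x y z hxy hyz := h.causal_trans z y x hyz hxy
  chron_trans x y z hxy hyz := h.chron_trans z y x hyz hxy
  causal_of_chron x y := h.causal_of_chron y x
  tau_lsc := h.tau_lsc.comp (g := fun q : X × X => (q.2, q.1)) continuous_swap
  tau_reverse_triangle x y z hxy hyz := by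
    rw [add_comm]
    exact h.tau_reverse_triangle z y x hyz hxy
  tau_pos_iff x y := h.tau_pos_iff y x

/-- Time reversal of the model space. -/
def timeRev (p : ℝ × ℝ) : ℝ × ℝ := (-p.1, p.2)

theorem dSProd_timeRev (p q : ℝ × ℝ) : dSProd (timeRev q) (timeRev p) = dSProd p q := by
  unfold dSProd timeRev
  rw [← neg_sub q.2 p.2]
  simp only [Real.cosh_neg, Real.sinh_neg, Real.cos_neg]
  ring

theorem adSProd_timeRev (p q : ℝ × ℝ) : adSProd (timeRev q) (timeRev p) = adSProd p q := by
  unfold adSProd timeRev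
  simp only [neg_sub_neg]
  ring

theorem modelCausal_timeRev {K : ℝ} (p q : ℝ × ℝ) :
    modelCausal K (timeRev q) (timeRev p) ↔ modelCausal K p q := by
  unfold modelCausal
  rw [dSProd_timeRev, adSProd_timeRev]
  simp only [timeRev, neg_le_neg_iff, neg_sub_neg, abs_sub_comm p.2 q.2]

theorem modelTau_timeRev {K : ℝ} (p q : ℝ × ℝ) :
    modelTau K (timeRev q) (timeRev p) = modelTau K p q := by
  unfold modelTau
  rw [dSProd_timeRev, adSProd_timeRev]
  by_cases h : modelCausal K p q
  · rw [if_pos h, if_pos ((modelCausal_timeRev p q).2 h)]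
    simp only [timeRev, neg_sub_neg]
    rw [← neg_sub q.2 p.2, neg_sq]
  · rw [if_neg h, if_neg (mt (modelCausal_timeRev p q).1 h)]

theorem timeRev_mem_modelSegment {K : ℝ} {p q r : ℝ × ℝ} (h : r ∈ modelSegment K p q) :
    timeRev r ∈ modelSegment K (timeRev q) (timeRev p) := by
  obtain ⟨h1, h2, h3⟩ := h
  refine ⟨(modelCausal_timeRev _ _).2 h2, (modelCausal_timeRev _ _).2 h1, ?_⟩
  rw [modelTau_timeRev, modelTau_timeRev, modelTau_timeRev, add_comm, h3]

variable {X : Type*} [EMetricSpace X] [LorentzianPreLengthSpace X] {U : Set X} {K : ℝ}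

theorem TauFiniteContinuousOn.timeDual (h : TauFiniteContinuousOn U) :
    TauFiniteContinuousOn (X := TimeDual X) U :=
  ⟨fun x hx y hy => h.1 y hy x hx, h.2.comp (f := fun q : X × X => (q.2, q.1))
    continuous_swap.continuousOn fun _ hq => ⟨hq.2, hq.1⟩⟩

theorem IsSide.timeDual {u v : X} {S : Set X} (h : IsSide U u v S) :
    IsSide (X := TimeDual X) U v u S := by
  obtain ⟨hS, γ, a, b, hab, hγ, rfl, rfl, rfl, hc, hadd⟩ := h
  refine ⟨hS, fun s => γ (-s), -b, -a, neg_le_neg hab, ?_,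
    congrArg γ (neg_neg b),
    congrArg γ (neg_neg a), ?_, ?_,
    ?_⟩
  · exact hγ.comp continuous_neg.continuousOn fun s hs => ⟨by linarith [hs.2], by linarith [hs.1]⟩
  · change (γ ∘ Neg.neg) '' _ = _
    rw [image_comp]
    simp
  · intro s t h1 h2 h3
    exact hc (-t) (-s) (by linarith) (by linarith) (by linarith)
  · intro r s t h1 h2 h3 h4
    have := hadd (-t) (-s) (-r) (by linarith) (by linarith) (by linarith) (by linarith)
    rw [add_comm] at this
    exact this

theorem IsTriangle.timeDual {x y z : X} {sxy syz sxz : Set X}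
    (h : IsTriangle U K x y z sxy syz sxz) :
    IsTriangle (X := TimeDual X) U K z y x syz sxy sxz :=
  ⟨h.finite.timeDual, h.chron₂, h.chron₁, h.side₂.timeDual, h.side₁.timeDual, h.side₃.timeDual,
    h.inRange⟩

/-- The dual correspondence measures from the other end of the side; additivity on both sides
converts one measurement into the other. -/
theorem CorrespondsOnSide.of_timeDual (hU : TauFiniteContinuousOn U) {u v a : X} {S : Set X}
    (h : IsSide U u v S) {u' v' a' : ℝ × ℝ} (hw : modelTau K v' u' = tau u v)
    (ha : CorrespondsOnSide (X := TimeDual X) K v S v' u' a a') :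
    CorrespondsOnSide K u S (timeRev u') (timeRev v') a (timeRev a') := by
  obtain ⟨haS, hs, ht⟩ := ha
  refine ⟨haS, timeRev_mem_modelSegment hs, ?_⟩
  rw [modelTau_timeRev]
  have h1 := hs.2.2
  have ht' : modelTau K v' a' = tau a v := ht
  rw [hw, ht', ← h.tau_add haS, add_comm (tau u a)] at h1
  exact (ENNReal.add_right_inj (hU.1 a (h.1 haS) v (h.1 h.right_mem))).1 h1

theorem BoundAbove.timeDual {x y z : X} {sxy syz sxz : Set X}
    (hB : BoundAbove K x y z sxy syz sxz) (h : IsTriangle U K x y z sxy syz sxz) :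
    BoundAbove (X := TimeDual X) K z y x syz sxy sxz := by
  intro z' y' x' hc a b a' b' ha hb
  obtain ⟨h1, h2, h3⟩ := hc
  have key : ∀ (c : X) (c' : ℝ × ℝ),
      IsComparisonPoint (X := TimeDual X) K z y syz sxy sxz z' y' x' c c' →
      IsComparisonPoint K x y sxy syz sxz (timeRev x') (timeRev y') (timeRev z') c (timeRev c') := by
    rintro c c' (hc | hc | hc)
    · exact Or.inr (Or.inl (hc.of_timeDual h.finite h.side₂ h1))
    · exact Or.inl (hc.of_timeDual h.finite h.side₁ h2)
    · exact Or.inr (Or.inr (hc.of_timeDual h.finite h.side₃ h3))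
  have := hB (timeRev x') (timeRev y') (timeRev z')
    ⟨(modelTau_timeRev _ _).trans h2, (modelTau_timeRev _ _).trans h1,
      (modelTau_timeRev _ _).trans h3⟩ b a (timeRev b') (timeRev a') (key b b' hb) (key a a' ha)
  rwa [modelTau_timeRev] at this

end TimeReversal

/-! ### The two assertions. -/

section Main

variable {X : Type*} [EMetricSpace X] [LorentzianPreLengthSpace X] {U : Set X} {K : ℝ}

theorem SizeBound.inRange {l : ℝ≥0∞} (h : SizeBound K l) : InRange K l.toReal := by
  intro hK
  have h0 : 0 < √(-K) := Real.sqrt_pos.2 (by linarith)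
  have h1 := (ENNReal.toReal_lt_toReal (h hK).ne_top ENNReal.ofReal_ne_top).2 (h hK)
  rw [ENNReal.toReal_ofReal (div_nonneg Real.pi_pos.le h0.le), lt_div_iff₀ h0] at h1
  linarith

theorem IsTimelikeTriangle.isTriangle (hU : TauFiniteContinuousOn U) {x y z : X}
    {sxy syz sxz : Set X} (h : IsTimelikeTriangle U x y z sxy syz sxz)
    (hs : SizeBound K (tau x z)) : IsTriangle U K x y z sxy syz sxz :=
  ⟨hU, h.1, h.2.1, h.2.2.1.isSide hU, h.2.2.2.1.isSide hU, h.2.2.2.2.isSide hU, hs.inRange⟩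

theorem TauFiniteContinuousOn.toReal_add (hU : TauFiniteContinuousOn U) {a b c d e f : X}
    (ha : a ∈ U) (hb : b ∈ U) (hc : c ∈ U) (hd : d ∈ U) (h : tau a b + tau c d = tau e f) :
    tauR a b + tauR c d = tauR e f := by
  unfold tauR
  rw [← ENNReal.toReal_add (hU.1 a ha b hb) (hU.1 c hc d hd), h]

end Main

end LorentzianPreLengthSpace

theorem mainTheorem6 {X : Type*} [EMetricSpace X] [LorentzianPreLengthSpace X]
    (U : Set X) (hU₁ : LorentzianPreLengthSpace.TauFiniteContinuousOn U)
    (hU₂ : LorentzianPreLengthSpace.HasRealizers U)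
    (K : ℝ) (x y z p : X) (sxy syz sxz : Set X)
    (hT : LorentzianPreLengthSpace.IsTimelikeTriangle U x y z sxy syz sxz)
    (hsize : LorentzianPreLengthSpace.SizeBound K (LorentzianPreLengthSpace.tau x z)) :
    (∀ sxp spy spz : Set X,
      LorentzianPreLengthSpace.IsSubdivision x p y sxy sxp spy →
      LorentzianPreLengthSpace.chron x p → LorentzianPreLengthSpace.chron p y →
      LorentzianPreLengthSpace.IsSegment U p z spz →
      LorentzianPreLengthSpace.BoundAbove K x p z sxp spz sxz →
      LorentzianPreLengthSpace.BoundAbove K p y z spy syz spz →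
      LorentzianPreLengthSpace.BoundAbove K x y z sxy syz sxz) ∧
    (∀ syp spz sxp : Set X,
      LorentzianPreLengthSpace.IsSubdivision y p z syz syp spz →
      LorentzianPreLengthSpace.chron y p → LorentzianPreLengthSpace.chron p z →
      LorentzianPreLengthSpace.IsSegment U x p sxp →
      LorentzianPreLengthSpace.BoundAbove K x y p sxy syp sxp →
      LorentzianPreLengthSpace.BoundAbove K x p z sxp spz sxz →
      LorentzianPreLengthSpace.BoundAbove K x y z sxy syz sxz) := by
  open LorentzianPreLengthSpace in
  have t := hT.isTriangle hU₁ hsize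
  constructor
  · intro sxp spy spz hsub hxp hpy hpz B₁ B₂
    obtain ⟨s₁, s₂, rfl, e, e'⟩ := hsub.isSide hU₁ t.side₁.1
    have hp := s₁.1 s₁.right_mem
    have t₁ : IsTriangle U K x p z sxp spz sxz :=
      ⟨hU₁, hxp, chron_trans _ _ _ hpy t.chron₂, s₁, hpz.isSide hU₁, t.side₃, t.inRange⟩
    have t₂ : IsTriangle U K p y z spy syz spz :=
      ⟨hU₁, hpy, t.chron₂, s₂, t.side₂, hpz.isSide hU₁,
        t.inRange.mono (by linarith [t₁.add_le, t₁.pos₁])⟩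
    exact t₁.boundAbove_of_glue t₂ t (hU₁.toReal_add t.mem_x hp hp t.mem_y e)
      (fun a ha => hU₁.toReal_add t.mem_x hp hp (s₂.1 ha) (e' a ha)) B₁ B₂
  · intro syp spz sxp hsub hyp hpz hxp B₁ B₂
    obtain ⟨s₁, s₂, rfl, e, -⟩ := hsub.isSide hU₁ t.side₂.1
    have hp := s₁.1 s₁.right_mem
    have t₂ : IsTriangle U K x p z sxp spz sxz :=
      ⟨hU₁, chron_trans _ _ _ t.chron₁ hyp, hpz, hxp.isSide hU₁, s₂, t.side₃, t.inRange⟩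
    have t₁ : IsTriangle U K x y p sxy syp sxp :=
      ⟨hU₁, t.chron₁, hyp, t.side₁, s₁, hxp.isSide hU₁,
        t.inRange.mono (by linarith [t₂.add_le, t₂.pos₂])⟩
    have e₀ := hU₁.toReal_add t.mem_y hp hp t.mem_z e
    -- In the dual triangle with vertices z, y, x, the point p divides the first side, whose initial
    -- part is [p, z] reversed; hence the order of the union is exchanged.
    rw [union_comm] at t ⊢
    refine BoundAbove.timeDual (X := TimeDual X) (U := U) ?_ t.timeDual
    refine t₂.timeDual.boundAbove_of_glue t₁.timeDual t.timeDual ?_ ?_ (B₂.timeDual t₂)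
      (B₁.timeDual t₁)
    · change tauR p z + tauR y p = tauR y z
      linarith
    · intro (a : X) ha
      change tauR p z + tauR a p = tauR a z
      have h1 := s₁.tauR_add hU₁ ha
      have h2 := t.side₂.tauR_add hU₁ (Or.inr ha)
      linarith
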